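/- **Setting.** A MA-STRIPS problem consists of a finite set $P$ of propositions, a finite nonempty set $\Phi$ of agents, a finite set of actions, each owned by one agent, an initial state $I\subseteq P$ and a goal $G\subseteq P$. An action $a$ has preconditions $\mathrm{pre}(a)$, add effects, delete effects (subsets of $P$) and a cost $c(a)\ge 0$. A plan is a sequence of actions executable from $I$ whose final state contains $G$; it is cost-optimal if no plan has smaller cost. $h^*(s)$ is the least cost of reaching a goal state from the state $s$ ($\infty$ if impossible). A proposition is private to an agent if only actions of this agent mention it (in preconditions or effects), and public if it is private to no agent. An action is public if it mentions a proposition that is not private to its owner, or if it adds a goal proposition (so every goal-achieving action is public). Each agent $i$ has an admissible heuristic $h_i$, i.e. $h_i(s)\in[0,\infty]$ and $h_i(s)\le h^*(s)$ for all states $s$. **The algorithm MAD-A\*.** Agents communicate through first-in-first-out channels, one for each ordered pair of agents (also from an agent to itself). Each agent $i$ keeps, for every state $s$ it knows, a cost $g(s)$, a heuristic value $h(s)$, the origin of its best path to $s$, and whether $s$ is open or closed; $f=g+h$. Initially every agent has $I$ open with $g=0$, $h=h_i(I)$. When a path of cost $g'$ to $s$ is found with heuristic estimate $h'$, then, if $s$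 is unknown or $g'<g(s)$, $s$ becomes open with $g(s)=g'$, its origin is the new path, and $h(s)$ is the maximum of $h'$ and the previous value; otherwise the path is dropped. The atomic operations, executed in arbitrary interleaving, are: * *Expand.* An agent chooses an open state $s$ of minimal $f$ and closes it. If $s$ is a goal state, it sends $(s,g(s),h(s))$ to all agents and initiates a verification of $s$. Otherwise, if the last action leading to $s$ was public, it sends $(s,g(s),h(s))$ to every agent that has a public action whose public preconditions hold in $s$; and for each of its own actions $a$ applicable in $s$ it finds a path of cost $g(s)+c(a)$ to the successor $s'$, with estimate $\max(h_i(s'),h(s)-c(a))$ (pathmax). * *Process a message* $(s,g,h)$: a path of cost $g$ to $s$ is found, with estimate $\max(h_i(s),h)$; if $s$ is a goal state, it is (re)opened in any case. * *Verification* of $s$ uses a Chandy–Lamport snapshot. The initiator records its open list and sends markers to all agents; an agent that receives a marker of this snapshot for the first time records its open list and sends markers to all agents; the states that arrive on a channel after the receiver has recorded its open list and before the marker arrives on that channel are recorded as well. When markers have arrived on all its channels, an agent reports the least recorded $f$-value to the initiator. When all reports have arrived, the verification returns true iff $f(s)$, as it was when $s$ was expanded, is at most the least reported value. * *Termination.*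 An agent whose verification returns true stops expanding states and starts a trace-back of $s$, which follows the recorded origins by messages from state to state and agent to agent back to $I$ and collects the plan. When $I$ is reached, a terminating message with the plan is broadcast; an agent that receives it outputs the plan and halts. Liveness: every message sent to an agent that has not halted is eventually received and processed, and an operation that remains possible forever is eventually carried out. **Theorem.** If the problem has a plan, then in every live execution MAD-A\* terminates with a cost-optimal plan: from some time on all agents have halted, and the plan that each agent has output is cost-optimal. -/

import Mathlib

open scoped NNReal ENNReal

namespace MADAStar

/-! ### Multi-agent STRIPS problems -/

/-- A MA-STRIPS problem with propositions `P`, agents `Φ` and actions `A`. The actions of agent `i`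
are those with `owner a = i`; the effect of an action consists of the propositions it adds and
those it deletes. Costs are nonnegative. -/
structure Problem (P Φ A : Type*) where
  owner : A → Φ
  pre : A → Finset P
  add : A → Finset P
  del : A → Finset P
  cost : A → ℝ≥0
  init : Finset P
  goal : Finset P

namespace Problem

variable {P Φ A : Type*} [DecidableEq P]

/-- The action `a` requires or affects the proposition `p`. -/
def Mentions (Q : Problem P Φ A) (a : A) (p : P) : Prop :=
  p ∈ Q.pre a ∨ p ∈ Q.add a ∨ p ∈ Q.del a

/-- `p` is a private proposition of agent `i`: only actions of `i` require or affect it. -/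
def PrivateProp (Q : Problem P Φ A) (i : Φ) (p : P) : Prop :=
  ∀ a, Q.Mentions a p → Q.owner a = i

/-- `p` is public: it is not a private proposition of any agent. -/
def PublicProp (Q : Problem P Φ A) (p : P) : Prop :=
  ∀ i, ¬ Q.PrivateProp i p

/-- The action `a` achieves some goal condition. -/
def AchievesGoal (Q : Problem P Φ A) (a : A) : Prop :=
  ∃ p ∈ Q.add a, p ∈ Q.goal

/-- An action is public if one of its preconditions or effects is not private to its owner.
The actions that achieve a goal condition are considered public as well. -/
def PublicAction (Q : Problem P Φ A) (a : A) : Prop :=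
  (∃ p, Q.Mentions a p ∧ ¬ Q.PrivateProp (Q.owner a) p) ∨ Q.AchievesGoal a

/-- The result of applying `a` in the state `s`. -/
def apply (Q : Problem P Φ A) (a : A) (s : Finset P) : Finset P :=
  (s \ Q.del a) ∪ Q.add a

/-- The sequence of actions is executable in `s` and leads to a goal state. -/
def Solves (Q : Problem P Φ A) : Finset P → List A → Prop
  | s, [] => Q.goal ⊆ s
  | s, a :: π => Q.pre a ⊆ s ∧ Q.Solves (Q.apply a s) π

/-- The cost of a sequence of actions. -/
noncomputable def planCost (Q : Problem P Φ A) (π : List A) : ℝ≥0 :=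
  (π.map Q.cost).sum

/-- A solution of the problem. -/
def IsPlan (Q : Problem P Φ A) (π : List A) : Prop :=
  Q.Solves Q.init π

/-- A solution of minimal cost. -/
def IsOptimalPlan (Q : Problem P Φ A) (π : List A) : Prop :=
  Q.IsPlan π ∧ ∀ π', Q.IsPlan π' → Q.planCost π ≤ Q.planCost π'

/-- The cost `h*(s)` of a cheapest solution from `s` (it is `⊤` if there is none). -/
noncomputable def hStar (Q : Problem P Φ A) (s : Finset P) : ℝ≥0∞ :=
  ⨅ (π : List A) (_ : Q.Solves s π), (Q.planCost π : ℝ≥0∞)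

/-- The heuristic never overestimates the cost of reaching the goal. -/
def Admissible (Q : Problem P Φ A) (h : Finset P → ℝ≥0∞) : Prop :=
  ∀ s, h s ≤ Q.hStar s

/-- The state `s` is relevant to agent `j`: some public action of `j` has all its public
preconditions satisfied in `s`. -/
def Relevant (Q : Problem P Φ A) (j : Φ) (s : Finset P) : Prop :=
  ∃ a, Q.owner a = j ∧ Q.PublicAction a ∧ ∀ p ∈ Q.pre a, Q.PublicProp p → p ∈ s

end Problem

/-! ### Data held and exchanged by the agents -/

/-- How an agent obtained its best known path to a state: the state is the initial state, or it was
generated from the state `s` by the agent's own action `a`, or it was received from agent `j`. -/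
inductive Origin (P Φ A : Type*) where
  | root : Origin P Φ A
  | action (s : Finset P) (a : A) : Origin P Φ A
  | message (j : Φ) : Origin P Φ A

/-- A search node: its `g`-value, its heuristic value, where it came from, and whether it is in the
open list (`isOpen = true`) or in the closed list (`isOpen = false`). -/
structure Node (P Φ A : Type*) where
  g : ℝ≥0
  h : ℝ≥0∞
  origin : Origin P Φ A
  isOpen : Bool

/-- `f = g + h`. -/
noncomputable def Node.f {P Φ A : Type*} (n : Node P Φ A) : ℝ≥0∞ :=
  (n.g : ℝ≥0∞) + n.h

/-- Messages. Verifications, and the snapshots they use, are identified by the agent that initiates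
them and a serial number.
* `search s g h`: a state with the `g`- and `h`-value of the sender;
* `marker id`: the marker of a Chandy–Lamport snapshot;
* `report n lb`: the sender's part of the snapshot of the receiver's verification number `n`,
  namely the least `f`-value in the recorded open list and the recorded incoming channels;
* `trace s π`: the trace-back of a solution has arrived at `s`, and `π` leads from `s` to the goal;
* `terminate π`: the solution `π` has been found. -/
inductive Msg (P Φ A : Type*) where
  | search (s : Finset P) (g : ℝ≥0) (h : ℝ≥0∞) : Msg P Φ A
  | marker (id : Φ × ℕ) : Msg P Φ A
  | report (n : ℕ) (lb : ℝ≥0∞) : Msg P Φ A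
  | trace (s : Finset P) (π : List A) : Msg P Φ A
  | terminate (π : List A) : Msg P Φ A

/-- An agent's part of a snapshot: the least `f`-value recorded so far, and the senders of the
incoming channels that are still being recorded. -/
structure Snapshot (Φ : Type*) where
  lb : ℝ≥0∞
  pending : Finset Φ

/-- A verification run by an agent: the solution state and its `f`-value, the least `f`-value
reported so far, and the agents that have not reported yet. -/
structure Verification (P Φ : Type*) where
  state : Finset P
  f : ℝ≥0∞
  lb : ℝ≥0∞
  pending : Finset Φ

/-- The local state of an agent. `accepted` says that one of its verifications has returned true;
`output` is the solution with which the agent has halted, if it has. -/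
structure LocalState (P Φ A : Type*) where
  node : Finset P → Option (Node P Φ A)
  snap : Φ × ℕ → Option (Snapshot Φ)
  verif : ℕ → Option (Verification P Φ)
  numVerif : ℕ
  accepted : Bool
  output : Option (List A)

/-- The messages an agent sends in one operation, for each receiver in order of sending. -/
abbrev Outbox (P Φ A : Type*) := Φ → List (Msg P Φ A)

section Operations

variable {P Φ A : Type*} [DecidableEq P] [DecidableEq Φ] [Fintype Φ]

/-- The least `f`-value in the open list. -/
noncomputable def LocalState.lowerBound (L : LocalState P Φ A) : ℝ≥0∞ :=
  ⨅ (s : Finset P) (n : Node P Φ A) (_ : L.node s = some n ∧ n.isOpen = true), n.f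

/-- Store `n` as the node of `s`. -/
def LocalState.setNode (L : LocalState P Φ A) (s : Finset P) (n : Node P Φ A) :
    LocalState P Φ A :=
  { L with node := Function.update L.node s (some n) }

/-- A path of cost `g` to the state `s` has been found. If `s` is unknown, or known only with a
larger `g`-value, then `s` enters the open list with the new `g`-value and with the largest
heuristic value known to the agent; otherwise the path is dropped. -/
noncomputable def LocalState.relax (L : LocalState P Φ A) (s : Finset P) (g : ℝ≥0) (h : ℝ≥0∞)
    (o : Origin P Φ A) : LocalState P Φ A :=
  match L.node s with
  | none => L.setNode s ⟨g, h, o, true⟩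
  | some n => if g < n.g then L.setNode s ⟨g, max n.h h, o, true⟩ else L

/-- Put the state `s`, if it is known, into the open list. -/
def LocalState.reopen (L : LocalState P Φ A) (s : Finset P) : LocalState P Φ A :=
  match L.node s with
  | none => L
  | some n => L.setNode s { n with isOpen := true }

/-- Processing of the message `⟨s, g, h⟩` from agent `j` by an agent with local heuristic `hi`:
the heuristic value is the maximum of the local one and the received one. A goal state always
(re-)enters the open list, so that it will be verified again. -/
noncomputable def processSearch (Q : Problem P Φ A) (hi : Finset P → ℝ≥0∞) (j : Φ)
    (s : Finset P) (g : ℝ≥0) (h : ℝ≥0∞) (L : LocalState P Φ A) : LocalState P Φ A :=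
  let L' := L.relax s g (max (hi s) h) (.message j)
  if Q.goal ⊆ s then L'.reopen s else L'

/-- Chandy–Lamport: a state `s` with `f`-value `f` that arrives from agent `j` belongs to the
channel state of all snapshots in which the channel from `j` is still being recorded. -/
noncomputable def LocalState.recordArrival (L : LocalState P Φ A) (j : Φ) (f : ℝ≥0∞) :
    LocalState P Φ A :=
  { L with snap := fun id => (L.snap id).map fun r =>
      if j ∈ r.pending then { r with lb := min r.lb f } else r }

/-- Generation of the successor of `s` by the action `a`, where `n` is the node of `s`. The
heuristic value of the successor is given by the pathmax equation. -/
noncomputable def generate (Q : Problem P Φ A) (hi : Finset P → ℝ≥0∞) (s : Finset P)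
    (n : Node P Φ A) (L : LocalState P Φ A) (a : A) : LocalState P Φ A :=
  L.relax (Q.apply a s) (n.g + Q.cost a)
    (max (hi (Q.apply a s)) (n.h - (Q.cost a : ℝ≥0∞))) (.action s a)

/-- The last action leading to the node was public. Agents forward a non-goal state only if this
holds, so it holds for every non-goal state that is received in a message. -/
def Origin.LastPublic (Q : Problem P Φ A) : Origin P Φ A → Prop
  | .root => False
  | .action _ a => Q.PublicAction a
  | .message _ => True

/-- The local state of agent `i` after the expansion of the goal state `s` with node `n`: a
verification of `s` is initiated, and the agent records its own part of the snapshot. -/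
noncomputable def expandGoalState (i : Φ) (s : Finset P) (n : Node P Φ A)
    (L : LocalState P Φ A) : LocalState P Φ A :=
  let L₁ := L.setNode s { n with isOpen := false }
  { L₁ with
    numVerif := L.numVerif + 1
    verif := Function.update L.verif L.numVerif (some ⟨s, n.f, ⊤, Finset.univ⟩)
    snap := Function.update L.snap (i, L.numVerif) (some ⟨L₁.lowerBound, Finset.univ⟩) }

/-- The messages sent when a goal state is expanded: the state is broadcast to all agents, followed
by the markers of the snapshot. -/
def expandGoalOut (i : Φ) (s : Finset P) (n : Node P Φ A) (L : LocalState P Φ A) :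
    Outbox P Φ A :=
  fun _ => [.search s n.g n.h, .marker (i, L.numVerif)]

/-- The local state after the expansion of the non-goal state `s` with node `n`, where the
applicable actions of the agent are taken in the order `acts`. -/
noncomputable def expandState (Q : Problem P Φ A) (hi : Finset P → ℝ≥0∞) (s : Finset P)
    (n : Node P Φ A) (acts : List A) (L : LocalState P Φ A) : LocalState P Φ A :=
  acts.foldl (generate Q hi s n) (L.setNode s { n with isOpen := false })

open Classical in
/-- The messages sent when a non-goal state is expanded. -/
noncomputable def expandOut (Q : Problem P Φ A) (s : Finset P) (n : Node P Φ A) :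
    Outbox P Φ A :=
  fun j => if n.origin.LastPublic Q ∧ Q.Relevant j s then [.search s n.g n.h] else []

/-- Arrival of the marker of snapshot `id` from agent `j`. At the first marker the agent records its
local state, starts to record its other incoming channels, and sends markers to all agents; every
marker ends the recording of the channel on which it arrives. When no channel is left, the agent
reports to the initiator of the snapshot. -/
noncomputable def receiveMarker (j : Φ) (id : Φ × ℕ) (L : LocalState P Φ A) :
    LocalState P Φ A × Outbox P Φ A :=
  let r : Snapshot Φ := match L.snap id with
    | none => ⟨L.lowerBound, Finset.univ.erase j⟩
    | some r => ⟨r.lb, r.pending.erase j⟩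
  ({ L with snap := Function.update L.snap id (some r) },
    fun k => (if (L.snap id).isNone then [.marker id] else []) ++
      (if r.pending = ∅ ∧ k = id.1 then [.report id.2 r.lb] else []))

/-- Arrival of agent `j`'s report on verification `n` of agent `i`. When all agents have reported,
the verification returns true if and only if the `f`-value of the solution does not exceed the
lower bound given by the snapshot; if it returns true, the agent initiates the trace-back. -/
noncomputable def receiveReport (i j : Φ) (n : ℕ) (lb : ℝ≥0∞) (L : LocalState P Φ A) :
    LocalState P Φ A × Outbox P Φ A :=
  match L.verif n with
  | none => (L, fun _ => [])
  | some v =>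
    let v' : Verification P Φ := { v with lb := min v.lb lb, pending := v.pending.erase j }
    let L' : LocalState P Φ A := { L with verif := Function.update L.verif n (some v') }
    if v'.pending = ∅ ∧ v'.f ≤ v'.lb then
      ({ L' with accepted := true }, fun k => if k = i then [.trace v.state []] else [])
    else (L', fun _ => [])

/-- One step of the trace-back, at agent `i`: it continues at the predecessor state, or at the agent
from which the state was received; at the initial state the solution is complete, and a terminating
message is broadcast. -/
def receiveTrace (i : Φ) (s : Finset P) (π : List A) (L : LocalState P Φ A) : Outbox P Φ A :=
  match L.node s with
  | none => fun _ => []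
  | some n =>
    match n.origin with
    | .root => fun _ => [.terminate π]
    | .action s' a => fun k => if k = i then [.trace s' (a :: π)] else []
    | .message j => fun k => if k = j then [.trace s π] else []

/-- Processing by agent `i`, with local heuristic `hi`, of a message from agent `j`. -/
noncomputable def receive (Q : Problem P Φ A) (hi : Finset P → ℝ≥0∞) (i j : Φ)
    (L : LocalState P Φ A) : Msg P Φ A → LocalState P Φ A × Outbox P Φ A
  | .search s g h =>
    (processSearch Q hi j s g h (L.recordArrival j ((g : ℝ≥0∞) + h)), fun _ => [])
  | .marker id => receiveMarker j id L
  | .report n lb => receiveReport i j n lb L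
  | .trace s π => (L, receiveTrace i s π L)
  | .terminate π => ({ L with output := some π }, fun _ => [])

end Operations

/-! ### The distributed system -/

/-- A configuration: the local states of the agents and the contents of the channels. There is a
first-in-first-out channel `chan i j` from every agent `i` to every agent `j` (also from an agent to
itself); the head of the list is the next message to arrive. -/
structure Config (P Φ A : Type*) where
  loc : Φ → LocalState P Φ A
  chan : Φ → Φ → List (Msg P Φ A)

/-- The atomic operations: agent `i` extracts a state from its open list and expands it, or agent `i`
receives and processes the next message from agent `j`. -/
inductive Event (Φ : Type*) where
  | expand (i : Φ) : Event Φ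
  | receive (i j : Φ) : Event Φ

section System

variable {P Φ A : Type*} [DecidableEq P] [DecidableEq Φ] [Fintype Φ]

/-- Agent `i` moves to the local state `L` and sends the messages `out`. -/
def Config.act (c : Config P Φ A) (i : Φ) (L : LocalState P Φ A) (out : Outbox P Φ A) :
    Config P Φ A where
  loc := Function.update c.loc i L
  chan := fun a b => if a = i then c.chan a b ++ out b else c.chan a b

/-- Replace the contents of the channel from `j` to `i`. -/
def Config.setChan (c : Config P Φ A) (j i : Φ) (l : List (Msg P Φ A)) : Config P Φ A where
  loc := c.loc
  chan := fun a b => if a = j ∧ b = i then l else c.chan a b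

/-- Initially every agent has the initial state in its open list, and all channels are empty. -/
noncomputable def initConfig (Q : Problem P Φ A) (h : Φ → Finset P → ℝ≥0∞) : Config P Φ A where
  loc := fun i =>
    { node := Function.update (fun _ => none) Q.init (some ⟨0, h i Q.init, .root, true⟩)
      snap := fun _ => none
      verif := fun _ => none
      numVerif := 0
      accepted := false
      output := none }
  chan := fun _ _ => []

/-- In the local state `L`, `s` is an open state with node `n` whose `f`-value is minimal in the
open list. -/
def LocalState.IsMin (L : LocalState P Φ A) (s : Finset P) (n : Node P Φ A) : Prop :=
  L.node s = some n ∧ n.isOpen = true ∧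
    ∀ s' n', L.node s' = some n' → n'.isOpen = true → n.f ≤ n'.f

/-- The transitions of MAD-A*, where `h i` is the local heuristic of agent `i`. An agent expands
states until a verification returns true, and takes part in the processing of messages until it
halts. -/
inductive Step (Q : Problem P Φ A) (h : Φ → Finset P → ℝ≥0∞) :
    Event Φ → Config P Φ A → Config P Φ A → Prop
  | expandGoal (c : Config P Φ A) (i : Φ) (s : Finset P) (n : Node P Φ A)
      (hrun : (c.loc i).output = none) (hacc : (c.loc i).accepted = false)
      (hmin : (c.loc i).IsMin s n) (hgoal : Q.goal ⊆ s) :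
      Step Q h (.expand i) c
        (c.act i (expandGoalState i s n (c.loc i)) (expandGoalOut i s n (c.loc i)))
  | expandNonGoal (c : Config P Φ A) (i : Φ) (s : Finset P) (n : Node P Φ A) (acts : List A)
      (hrun : (c.loc i).output = none) (hacc : (c.loc i).accepted = false)
      (hmin : (c.loc i).IsMin s n) (hgoal : ¬ Q.goal ⊆ s)
      (hnodup : acts.Nodup) (hacts : ∀ a, a ∈ acts ↔ Q.owner a = i ∧ Q.pre a ⊆ s) :
      Step Q h (.expand i) c
        (c.act i (expandState Q (h i) s n acts (c.loc i)) (expandOut Q s n))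
  | receive (c : Config P Φ A) (i j : Φ) (m : Msg P Φ A) (rest : List (Msg P Φ A))
      (hrun : (c.loc i).output = none) (hm : c.chan j i = m :: rest) :
      Step Q h (.receive i j) c
        ((c.setChan j i rest).act i (receive Q (h i) i j (c.loc i) m).1
          (receive Q (h i) i j (c.loc i) m).2)

/-- `σ` is an execution of MAD-A* with the operations `ev` (`none` means that nothing happens), and
it is live: an operation that is possible at all times from some time on is eventually carried out.
So every message sent to an agent that has not halted arrives and is processed, and every operation
of an agent is completed in finite time. -/
structure IsLiveExecution (Q : Problem P Φ A) (h : Φ → Finset P → ℝ≥0∞)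
    (σ : ℕ → Config P Φ A) (ev : ℕ → Option (Event Φ)) : Prop where
  start : σ 0 = initConfig Q h
  idle : ∀ t, ev t = none → σ (t + 1) = σ t
  step : ∀ t e, ev t = some e → Step Q h e (σ t) (σ (t + 1))
  live : ∀ e t, (∀ t' ≥ t, ∃ c, Step Q h e (σ t') c) → ∃ t' ≥ t, ev t' = some e

end System

end MADAStar

set_option linter.unusedSectionVars false

namespace MADAStar

/-! ### Plans, costs and private actions -/

namespace Problem

variable {P Φ A : Type*} [DecidableEq P] (Q : Problem P Φ A)

/-! The proof separates the search from the protocol around it. A `SearchConfig` holds only nodes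
and states in transit, and `SearchStep` lists the elementary changes. `SearchConfig.Inv` is
preserved by them and has one main consequence, `SearchConfig.Inv.hasFrontier`: as long as the
problem is solvable, some open node or some state in transit has an `f`-value of at most `h*(I)`. To
see this, follow an optimal plan. Private actions commute with the actions of other agents, so the
private actions that the owner of the first public action performs before it can be moved to the
front (`Problem.exists_reorder`). That owner knows the starting state or has it in a channel,
because every closed state reached by a public action was sent to the agents for which it is
relevant. Its closed nodes have known successors, so the plan is followed beyond its first public
action, and induction on the number of public actions finishes.

Safety. A Chandy–Lamport snapshot need not show a configuration that ever existed, but it shows one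
that the search could have reached. `Cut` expresses this during the recording, and `Cut.step` shows
that each operation is either a run of search steps in the cut or invisible there. Hence the cut
satisfies `Inv` and has a frontier of value at most `h*(I)`. Once all parts are complete, everything
on this frontier lies above a reported bound, so the least report is at most `h*(I)`
(`Cut.le_hStar`), and a verification that returns true concerns a goal state of cost at most
`h*(I)`. The trace-back preserves the bound that `g(s)` plus the cost of the collected actions is at
most `h*(I)`, so the plan that is broadcast is optimal (`Step.sound`).

Liveness. Suppose that no terminating message is ever broadcast. Then no agent halts and all
messages are delivered. No verification returns true either: an accepted goal node lies on an
optimal path, such nodes never change their origins, and the trace-back would reach `I`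
(`IsLiveExecution.broadcast_of_trace`). So all agents keep expanding. The `g`-values lie in a
well-founded set and there are finitely many states, so from some time on only goal states are
closed and reopened (`IsLiveExecution.exists_settled`), and later only goal states are in transit.
The frontier then forces the expansion of a goal state with `f ≤ h*(I)`, while everything that its
snapshot can record has `f ≥ h*(I)`. Its verification must return true, a contradiction
(`IsLiveExecution.exists_broadcast`). -/

@[simp] theorem planCost_nil : Q.planCost [] = 0 := by simp [planCost]

@[simp] theorem planCost_cons (a : A) (π : List A) :
    Q.planCost (a :: π) = Q.cost a + Q.planCost π := by simp [planCost]

@[simp] theorem planCost_append (π ρ : List A) :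
    Q.planCost (π ++ ρ) = Q.planCost π + Q.planCost ρ := by simp [planCost]

theorem planCost_perm {π ρ : List A} (hp : π.Perm ρ) : Q.planCost π = Q.planCost ρ :=
  (hp.map _).sum_eq

theorem hStar_le {s : Finset P} {π : List A} (hπ : Q.Solves s π) :
    Q.hStar s ≤ Q.planCost π :=
  iInf₂_le π hπ

theorem hStar_eq_zero {s : Finset P} (hs : Q.goal ⊆ s) : Q.hStar s = 0 := by
  have : Q.Solves s [] := hs
  simpa using Q.hStar_le this

/-- Prefixing `a` to a solution of the successor solves `s`. This is why pathmax estimates stay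
admissible. -/
theorem hStar_sub_le {s : Finset P} {a : A} (ha : Q.pre a ⊆ s) :
    Q.hStar s - Q.cost a ≤ Q.hStar (Q.apply a s) := by
  refine le_iInf₂ fun π hπ => ?_
  rw [tsub_le_iff_left]
  have : Q.Solves s (a :: π) := ⟨ha, hπ⟩
  simpa using Q.hStar_le this

theorem hStar_le_apply {s : Finset P} {a : A} (ha : Q.pre a ⊆ s) :
    Q.hStar s ≤ Q.cost a + Q.hStar (Q.apply a s) :=
  tsub_le_iff_left.1 (Q.hStar_sub_le ha)

variable {Q} in
theorem mentions_disjoint {a b : A} (ha : ¬ Q.PublicAction a) (hab : Q.owner b ≠ Q.owner a)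
    {p : P} (hp : Q.Mentions a p) : ¬ Q.Mentions b p := by
  intro hb
  have : Q.PrivateProp (Q.owner a) p := by
    by_contra h
    exact ha (Or.inl ⟨p, hp, h⟩)
  exact hab (this b hb)

variable {Q} in
/-- A private action commutes with the actions of the other agents. -/
theorem solves_swap {a b : A} (ha : ¬ Q.PublicAction a) (hab : Q.owner b ≠ Q.owner a)
    {s : Finset P} {π : List A} (hs : Q.Solves s (a :: b :: π)) :
    Q.Solves s (b :: a :: π) := by
  obtain ⟨h1, h2, h3⟩ := hs
  have hd : ∀ p, Q.Mentions a p → ¬ Q.Mentions b p := fun p => mentions_disjoint ha hab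
  unfold Mentions at hd
  have hcomm : Q.apply a (Q.apply b s) = Q.apply b (Q.apply a s) := by
    ext p
    have := hd p
    simp only [apply, Finset.mem_union, Finset.mem_sdiff]
    tauto
  refine ⟨fun p hp => ?_, fun p hp => ?_, hcomm ▸ h3⟩
  · have := h2 hp
    have := hd p
    simp only [apply, Finset.mem_union, Finset.mem_sdiff] at *
    tauto
  · have := h1 hp
    have := hd p
    simp only [apply, Finset.mem_union, Finset.mem_sdiff] at *
    tauto

variable {Q} in
-- Actions that add a goal proposition count as public, so private actions can at best leave goal
-- propositions in place. It is the base case of the induction on the number of public actions.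
theorem goal_subset_of_private {π : List A} (hπ : ∀ a ∈ π, ¬ Q.PublicAction a) :
    ∀ {s : Finset P}, Q.Solves s π → Q.goal ⊆ s := by
  induction π with
  | nil => exact fun h => h
  | cons a π ih =>
    intro s hs p hp
    have h1 := ih (fun b hb => hπ b (by simp [hb])) hs.2 hp
    simp only [apply, Finset.mem_union, Finset.mem_sdiff] at h1
    rcases h1 with h1 | h1
    · exact h1.1
    · exact absurd (Or.inr ⟨p, h1, hp⟩) (hπ a (by simp))

variable {Q} in
-- A private action adds no public proposition, so the public preconditions that hold after it held
-- before it.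
theorem Relevant.of_apply_private {j : Φ} {a : A} {s : Finset P} (ha : ¬ Q.PublicAction a)
    (h : Q.Relevant j (Q.apply a s)) : Q.Relevant j s := by
  obtain ⟨b, hb, hb', hpre⟩ := h
  refine ⟨b, hb, hb', fun p hp hpub => ?_⟩
  have := hpre p hp hpub
  simp only [apply, Finset.mem_union, Finset.mem_sdiff] at this
  rcases this with h1 | h1
  · exact h1.1
  · refine absurd (Or.inl ⟨p, Or.inr (Or.inl h1), hpub _⟩) ha

variable {Q} in
theorem solves_move_back {a b : A} (ha : ¬ Q.PublicAction a) {π : List A} :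
    ∀ {τ : List A} {s : Finset P}, (∀ c ∈ τ, Q.owner c ≠ Q.owner a) → Q.owner b ≠ Q.owner a →
    Q.Solves s (a :: (τ ++ b :: π)) → Q.Solves s (τ ++ b :: a :: π) := by
  intro τ
  induction τ with
  | nil => exact fun _ hb hs => solves_swap ha hb hs
  | cons c τ ih =>
    intro s hc hb hs
    have := solves_swap ha (hc c (by simp)) hs
    exact ⟨this.1, ih (fun d hd => hc d (by simp [hd])) hb this.2⟩

variable {Q} in
/-- The private actions that precede the first public action of a solution and belong to the same
agent can be executed first. -/
theorem exists_reorder {π : List A} : ∀ {s : Finset P}, Q.Solves s π →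
    (∃ a ∈ π, Q.PublicAction a) →
    ∃ (a : A) (τ ρ : List A), Q.PublicAction a ∧ (∀ b ∈ τ, Q.owner b = Q.owner a) ∧
      Q.Relevant (Q.owner a) s ∧ Q.Solves s (τ ++ a :: ρ) ∧ π.Perm (τ ++ a :: ρ) := by
  induction π with
  | nil => simp
  | cons b π ih =>
    intro s hs hex
    by_cases hb : Q.PublicAction b
    · exact ⟨b, [], π, hb, by simp, ⟨b, rfl, hb, fun p hp _ => hs.1 hp⟩, hs, List.Perm.refl _⟩
    · have hex' : ∃ a ∈ π, Q.PublicAction a := by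
        obtain ⟨a, ha, ha'⟩ := hex
        rcases List.mem_cons.1 ha with rfl | ha
        · exact absurd ha' hb
        · exact ⟨a, ha, ha'⟩
      obtain ⟨a, τ, ρ, ha, hτ, hrel, hsol, hperm⟩ := ih hs.2 hex'
      by_cases hab : Q.owner b = Q.owner a
      · refine ⟨a, b :: τ, ρ, ha, ?_, hrel.of_apply_private hb, ⟨hs.1, hsol⟩, by simpa using hperm⟩
        intro c hc
        rcases List.mem_cons.1 hc with rfl | hc
        · exact hab
        · exact hτ c hc
      -- Here `b` is a private action of a different agent, so it commutes with `τ` and with `a` and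
      -- is postponed until after `a`.
      · refine ⟨a, τ, b :: ρ, ha, hτ, hrel.of_apply_private hb,
          solves_move_back hb (fun c hc => by rw [hτ c hc]; exact Ne.symm hab) (Ne.symm hab)
            ⟨hs.1, hsol⟩, ?_⟩
        calc (b :: π).Perm (b :: (τ ++ a :: ρ)) := hperm.cons b
          _ = (b :: τ) ++ a :: ρ := rfl
          _ |>.Perm (τ ++ a :: b :: ρ) := by
            rw [← List.singleton_append (l := τ), List.append_assoc]
            have h1 : ([b] ++ (τ ++ a :: ρ)).Perm ((τ ++ [a]) ++ ([b] ++ ρ)) := by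
              have : τ ++ a :: ρ = (τ ++ [a]) ++ ρ := by simp
              rw [this, ← List.append_assoc, ← List.append_assoc (τ ++ [a])]
              exact (List.perm_append_comm (l₁ := [b]) (l₂ := τ ++ [a])).append_right ρ
            simpa using h1

/-! ### Well-foundedness of the possible costs -/

/-- The costs of sequences of actions. -/
def costSet : AddSubmonoid ℝ≥0 := AddSubmonoid.closure (Set.range Q.cost)

theorem cost_mem_costSet (a : A) : Q.cost a ∈ Q.costSet :=
  AddSubmonoid.subset_closure ⟨a, rfl⟩

theorem planCost_mem_costSet (π : List A) : Q.planCost π ∈ Q.costSet := by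
  induction π with
  | nil => simp [Q.costSet.zero_mem]
  | cons a π ih => simpa using Q.costSet.add_mem (Q.cost_mem_costSet a) ih

/-- Real costs could in general decrease forever. A submonoid of the nonnegative reals generated by
a finite set is partially well-ordered, however, so an optimal plan exists and each node is improved
only finitely often, even with actions of cost zero. -/
theorem costSet_isWF [Finite A] : (Q.costSet : Set ℝ≥0).IsWF :=
  (Set.IsPWO.addSubmonoid_closure (fun _ _ => zero_le)
    (Set.finite_range Q.cost).isPWO).isWF

theorem exists_optimal [Finite A] (hsol : ∃ π, Q.IsPlan π) :
    ∃ π, Q.IsPlan π ∧ (Q.planCost π : ℝ≥0∞) ≤ Q.hStar Q.init := by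
  have hwf : (Q.planCost '' {π | Q.IsPlan π}).IsWF :=
    Q.costSet_isWF.mono (by rintro _ ⟨π, -, rfl⟩; exact Q.planCost_mem_costSet π)
  have hne : (Q.planCost '' {π | Q.IsPlan π}).Nonempty := by
    obtain ⟨π, hπ⟩ := hsol
    exact ⟨_, π, hπ, rfl⟩
  obtain ⟨π, hπ, hmin⟩ := hwf.min_mem hne
  refine ⟨π, hπ, le_iInf₂ fun π' hπ' => ?_⟩
  rw [hmin]
  exact_mod_cast hwf.min_le hne ⟨π', hπ', rfl⟩

theorem isOptimalPlan_of_le {π : List A} (hπ : Q.IsPlan π)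
    (hle : (Q.planCost π : ℝ≥0∞) ≤ Q.hStar Q.init) : Q.IsOptimalPlan π :=
  ⟨hπ, fun _ hπ' => by exact_mod_cast hle.trans (Q.hStar_le hπ')⟩

/-! ### Paths that extend to optimal solutions -/

/-- A path of cost `g` to `s` can be extended to an optimal solution. -/
def OnOptimal (s : Finset P) (g : ℝ≥0) : Prop :=
  ∃ π, Q.Solves s π ∧ (g : ℝ≥0∞) + Q.planCost π ≤ Q.hStar Q.init

variable {Q}

theorem OnOptimal.mono {s : Finset P} {g g' : ℝ≥0} (hg : Q.OnOptimal s g) (hle : g' ≤ g) :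
    Q.OnOptimal s g' := by
  obtain ⟨π, hπ, h⟩ := hg
  exact ⟨π, hπ, le_trans (by gcongr) h⟩

theorem OnOptimal.le {s : Finset P} {g : ℝ≥0} (hg : Q.OnOptimal s g) :
    (g : ℝ≥0∞) + Q.hStar s ≤ Q.hStar Q.init := by
  obtain ⟨π, hπ, h⟩ := hg
  exact le_trans (by gcongr; exact Q.hStar_le hπ) h

theorem OnOptimal.of_apply {s : Finset P} {a : A} {g g' : ℝ≥0} (ha : Q.pre a ⊆ s)
    (hg : Q.OnOptimal (Q.apply a s) g) (hle : g' + Q.cost a ≤ g) : Q.OnOptimal s g' := by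
  obtain ⟨π, hπ, h⟩ := hg
  refine ⟨a :: π, ⟨ha, hπ⟩, le_trans ?_ h⟩
  rw [planCost_cons, ENNReal.coe_add, ← add_assoc]
  gcongr
  exact_mod_cast hle

/-- A path that can be extended to an optimal solution is a cheapest path. -/
theorem OnOptimal.not_lt {s : Finset P} {g g' : ℝ≥0} (hg : Q.OnOptimal s g)
    (hlow : Q.hStar Q.init ≤ g' + Q.hStar s) : ¬ g' < g := by
  intro hlt
  obtain ⟨π, hπ, h⟩ := hg
  have h1 : (g : ℝ≥0∞) + Q.planCost π ≤ g' + Q.planCost π :=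
    h.trans (hlow.trans (by gcongr; exact Q.hStar_le hπ))
  have h2 : g + Q.planCost π ≤ g' + Q.planCost π := by exact_mod_cast h1
  exact absurd (le_of_add_le_add_right h2) (not_le.2 hlt)

end Problem

/-! ### The search without snapshots, verifications and trace-back -/

/-- The nodes of the agents and the states in transit. -/
structure SearchConfig (P Φ A : Type*) where
  node : Φ → Finset P → Option (Node P Φ A)
  chan : Φ → Φ → List (Finset P × ℝ≥0 × ℝ≥0∞)

variable {P Φ A : Type*} [DecidableEq P] [DecidableEq Φ]

namespace SearchConfig

def setNode (V : SearchConfig P Φ A) (k : Φ) (s : Finset P) (n : Node P Φ A) :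
    SearchConfig P Φ A :=
  { V with node := Function.update V.node k (Function.update (V.node k) s (some n)) }

def send (V : SearchConfig P Φ A) (k : Φ) (out : Φ → List (Finset P × ℝ≥0 × ℝ≥0∞)) :
    SearchConfig P Φ A :=
  { V with chan := fun a b => if a = k then V.chan a b ++ out b else V.chan a b }

def setChan (V : SearchConfig P Φ A) (j k : Φ) (l : List (Finset P × ℝ≥0 × ℝ≥0∞)) :
    SearchConfig P Φ A :=
  { V with chan := fun a b => if a = j ∧ b = k then l else V.chan a b }

theorem setNode_node (V : SearchConfig P Φ A) (k : Φ) (s : Finset P) (n : Node P Φ A) (k' : Φ)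
    (s' : Finset P) :
    (V.setNode k s n).node k' s' = if k' = k ∧ s' = s then some n else V.node k' s' := by
  by_cases hk : k' = k
  · subst hk
    by_cases hs : s' = s <;> simp [setNode, hs]
  · simp [setNode, hk]

theorem setNode_node_self (V : SearchConfig P Φ A) (k : Φ) (s : Finset P) (n : Node P Φ A) :
    (V.setNode k s n).node k s = some n := by simp [setNode_node]

@[simp] theorem setNode_chan (V : SearchConfig P Φ A) (k : Φ) (s : Finset P) (n : Node P Φ A) :
    (V.setNode k s n).chan = V.chan := rfl

@[simp] theorem send_node (V : SearchConfig P Φ A) (k : Φ)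
    (out : Φ → List (Finset P × ℝ≥0 × ℝ≥0∞)) : (V.send k out).node = V.node := rfl

/-- Agent `k` knows a path to `s` of cost at most `g`. -/
def Knows (V : SearchConfig P Φ A) (k : Φ) (s : Finset P) (g : ℝ≥0) : Prop :=
  ∃ n, V.node k s = some n ∧ n.g ≤ g

end SearchConfig

/-- Agent `k` has found a path of cost `g` to `s`, with a heuristic estimate and an origin. -/
inductive Source (Q : Problem P Φ A) (h : Φ → Finset P → ℝ≥0∞) (V : SearchConfig P Φ A) (k : Φ)
    (s : Finset P) : ℝ≥0 → ℝ≥0∞ → Origin P Φ A → Prop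
  | action (s₀ : Finset P) (a : A) (n₀ : Node P Φ A) (hn : V.node k s₀ = some n₀)
      (ho : Q.owner a = k) (hp : Q.pre a ⊆ s₀) (hs : s = Q.apply a s₀) :
      Source Q h V k s (n₀.g + Q.cost a) (max (h k s) (n₀.h - (Q.cost a : ℝ≥0∞))) (.action s₀ a)
  | message (j : Φ) (g : ℝ≥0) (e : ℝ≥0∞) (hm : (s, g, e) ∈ V.chan j k) :
      Source Q h V k s g (max (h k s) e) (.message j)

/-- The elementary changes of which the operations of the search consist. -/
inductive SearchStep (Q : Problem P Φ A) (h : Φ → Finset P → ℝ≥0∞) :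
    SearchConfig P Φ A → SearchConfig P Φ A → Prop
  | improve (V : SearchConfig P Φ A) (k : Φ) (s : Finset P) (g : ℝ≥0) (e e' : ℝ≥0∞)
      (o : Origin P Φ A) (hlt : ∀ n, V.node k s = some n → g < n.g)
      (he : e' = e ∨ ∃ n, V.node k s = some n ∧ e' = max n.h e) (hsrc : Source Q h V k s g e o) :
      SearchStep Q h V (V.setNode k s ⟨g, e', o, true⟩)
  | reopen (V : SearchConfig P Φ A) (k : Φ) (s : Finset P) (n : Node P Φ A)
      (hn : V.node k s = some n) (hgoal : Q.goal ⊆ s) :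
      SearchStep Q h V (V.setNode k s { n with isOpen := true })
  | close (V : SearchConfig P Φ A) (k : Φ) (s : Finset P) (n : Node P Φ A)
      (out : Φ → List (Finset P × ℝ≥0 × ℝ≥0∞)) (hn : V.node k s = some n)
      (hsucc : ¬ Q.goal ⊆ s → ∀ a, Q.owner a = k → Q.pre a ⊆ s →
        V.Knows k (Q.apply a s) (n.g + Q.cost a))
      (hout : ∀ b, out b = [] ∨ out b = [(s, n.g, n.h)])
      (hgoal : Q.goal ⊆ s → ∀ b, out b = [(s, n.g, n.h)])
      (hrel : ¬ Q.goal ⊆ s → n.origin.LastPublic Q → ∀ b, Q.Relevant b s →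
        out b = [(s, n.g, n.h)]) :
      SearchStep Q h V ((V.setNode k s { n with isOpen := false }).send k out)
  | consume (V : SearchConfig P Φ A) (j k : Φ) (s : Finset P) (g : ℝ≥0) (e : ℝ≥0∞)
      (rest : List (Finset P × ℝ≥0 × ℝ≥0∞)) (n : Node P Φ A)
      (hc : V.chan j k = (s, g, e) :: rest) (hn : V.node k s = some n) (hle : n.g ≤ g)
      (hgoal : Q.goal ⊆ s → n.isOpen = true) :
      SearchStep Q h V (V.setChan j k rest)

/-- How the node of the state `s` can change in the course of time. -/
def Node.Evolves (Q : Problem P Φ A) (s : Finset P) (n n' : Node P Φ A) : Prop :=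
  n'.g < n.g ∨ (n'.g = n.g ∧ n'.h = n.h ∧ n'.origin = n.origin ∧
    (¬ Q.goal ⊆ s → n'.isOpen = true → n.isOpen = true))

theorem Node.Evolves.refl (Q : Problem P Φ A) (s : Finset P) (n : Node P Φ A) :
    n.Evolves Q s n :=
  Or.inr ⟨rfl, rfl, rfl, fun _ h => h⟩

theorem Node.Evolves.g_le {Q : Problem P Φ A} {s : Finset P} {n n' : Node P Φ A}
    (hn : n.Evolves Q s n') : n'.g ≤ n.g := by
  rcases hn with h | h
  · exact h.le
  · exact h.1.le

theorem Node.Evolves.trans {Q : Problem P Φ A} {s : Finset P} {n₁ n₂ n₃ : Node P Φ A}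
    (h₁ : n₁.Evolves Q s n₂) (h₂ : n₂.Evolves Q s n₃) : n₁.Evolves Q s n₃ := by
  rcases h₁ with h₁ | ⟨h₁, h₁', h₁'', h₁o⟩
  · exact Or.inl (h₂.g_le.trans_lt h₁)
  · rcases h₂ with h₂ | ⟨h₂, h₂', h₂'', h₂o⟩
    · exact Or.inl (h₁ ▸ h₂)
    · exact Or.inr ⟨h₂.trans h₁, h₂'.trans h₁', h₂''.trans h₁'', fun hg ho => h₁o hg (h₂o hg ho)⟩

section Steps

variable {Q : Problem P Φ A} {h : Φ → Finset P → ℝ≥0∞} {V V' : SearchConfig P Φ A}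

theorem SearchStep.evolves (hst : SearchStep Q h V V') {k : Φ} {s : Finset P} {n : Node P Φ A}
    (hn : V.node k s = some n) : ∃ n', V'.node k s = some n' ∧ n.Evolves Q s n' := by
  cases hst with
  | improve k₀ s₀ g e e' o hlt he hsrc =>
    by_cases hks : k = k₀ ∧ s = s₀
    · obtain ⟨rfl, rfl⟩ := hks
      exact ⟨_, V.setNode_node_self .., Or.inl (hlt n hn)⟩
    · exact ⟨n, by simp [SearchConfig.setNode_node, hks, hn], .refl ..⟩
  | reopen k₀ s₀ n₀ hn₀ hgoal =>
    by_cases hks : k = k₀ ∧ s = s₀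
    · obtain ⟨rfl, rfl⟩ := hks
      obtain rfl : n₀ = n := Option.some.inj (hn₀ ▸ hn)
      exact ⟨_, V.setNode_node_self .., Or.inr ⟨rfl, rfl, rfl, fun hg => absurd hgoal hg⟩⟩
    · exact ⟨n, by simp [SearchConfig.setNode_node, hks, hn], .refl ..⟩
  | close k₀ s₀ n₀ out hn₀ =>
    by_cases hks : k = k₀ ∧ s = s₀
    · obtain ⟨rfl, rfl⟩ := hks
      obtain rfl : n₀ = n := Option.some.inj (hn₀ ▸ hn)
      exact ⟨_, V.setNode_node_self .., Or.inr ⟨rfl, rfl, rfl, fun _ => by simp⟩⟩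
    · exact ⟨n, by simp [SearchConfig.setNode_node, hks, hn], .refl ..⟩
  | consume => exact ⟨n, hn, .refl ..⟩

theorem SearchStep.knows (hst : SearchStep Q h V V') {k : Φ} {s : Finset P} {g : ℝ≥0}
    (hk : V.Knows k s g) : V'.Knows k s g := by
  obtain ⟨n, hn, hle⟩ := hk
  obtain ⟨n', hn', hev⟩ := hst.evolves hn
  exact ⟨n', hn', hev.g_le.trans hle⟩

/-- The preservation proofs need only this dichotomy: apart from its open flag a node is old, or it
is strictly better than before and has a source in the old configuration. -/
theorem SearchStep.node_cases (hst : SearchStep Q h V V') {k : Φ} {s : Finset P}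
    {n' : Node P Φ A} (hn' : V'.node k s = some n') :
    (∃ n, V.node k s = some n ∧ n'.g = n.g ∧ n'.h = n.h ∧ n'.origin = n.origin) ∨
    ((∀ n, V.node k s = some n → n'.g < n.g) ∧ ∃ e, Source Q h V k s n'.g e n'.origin ∧
      (n'.h = e ∨ ∃ n, V.node k s = some n ∧ n'.h = max n.h e)) := by
  cases hst with
  | improve k₀ s₀ g e e' o hlt he hsrc =>
    rw [SearchConfig.setNode_node] at hn'
    split_ifs at hn' with hks
    · obtain ⟨rfl, rfl⟩ := hks
      obtain rfl := Option.some.inj hn'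
      exact Or.inr ⟨hlt, e, hsrc, he⟩
    · exact Or.inl ⟨n', hn', rfl, rfl, rfl⟩
  | reopen k₀ s₀ n₀ hn₀ hgoal =>
    rw [SearchConfig.setNode_node] at hn'
    split_ifs at hn' with hks
    · obtain ⟨rfl, rfl⟩ := hks
      obtain rfl := Option.some.inj hn'
      exact Or.inl ⟨n₀, hn₀, rfl, rfl, rfl⟩
    · exact Or.inl ⟨n', hn', rfl, rfl, rfl⟩
  | close k₀ s₀ n₀ out hn₀ =>
    rw [SearchConfig.send_node, SearchConfig.setNode_node] at hn'
    split_ifs at hn' with hks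
    · obtain ⟨rfl, rfl⟩ := hks
      obtain rfl := Option.some.inj hn'
      exact Or.inl ⟨n₀, hn₀, rfl, rfl, rfl⟩
    · exact Or.inl ⟨n', hn', rfl, rfl, rfl⟩
  | consume => exact Or.inl ⟨n', hn', rfl, rfl, rfl⟩

theorem SearchStep.chan_cases (hst : SearchStep Q h V V') {j k : Φ} {s : Finset P} {g : ℝ≥0}
    {e : ℝ≥0∞} (hm : (s, g, e) ∈ V'.chan j k) :
    (s, g, e) ∈ V.chan j k ∨ ∃ n, V.node j s = some n ∧ n.g = g ∧ n.h = e := by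
  cases hst with
  | improve => exact Or.inl hm
  | reopen => exact Or.inl hm
  | close k₀ s₀ n₀ out hn₀ hsucc hout =>
    simp only [SearchConfig.send, SearchConfig.setNode_chan] at hm
    split_ifs at hm with hj
    · subst hj
      rcases List.mem_append.1 hm with hm | hm
      · exact Or.inl hm
      · rcases hout k with h0 | h0
        · simp [h0] at hm
        · rw [h0, List.mem_singleton] at hm
          simp only [Prod.mk.injEq] at hm
          obtain ⟨rfl, rfl, rfl⟩ := hm
          exact Or.inr ⟨n₀, hn₀, rfl, rfl⟩
    · exact Or.inl hm
  | consume j₀ k₀ s₀ g₀ e₀ rest n₀ hc =>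
    simp only [SearchConfig.setChan] at hm
    split_ifs at hm with hj
    · obtain ⟨rfl, rfl⟩ := hj
      exact Or.inl (by rw [hc]; exact List.mem_cons_of_mem _ hm)
    · exact Or.inl hm

/-- A state leaves a channel only by being processed. By then the receiver has a node at least as
good, which is open if the state is a goal. -/
theorem SearchStep.chan_persists (hst : SearchStep Q h V V') {j k : Φ} {s : Finset P} {g : ℝ≥0}
    {e : ℝ≥0∞} (hm : (s, g, e) ∈ V.chan j k) :
    (s, g, e) ∈ V'.chan j k ∨
      (V'.node = V.node ∧ ∃ n, V.node k s = some n ∧ n.g ≤ g ∧ (Q.goal ⊆ s → n.isOpen = true)) := by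
  cases hst with
  | improve => exact Or.inl hm
  | reopen => exact Or.inl hm
  | close k₀ s₀ n₀ out hn₀ hsucc hout =>
    left
    simp only [SearchConfig.send, SearchConfig.setNode_chan]
    split_ifs with hj
    · exact List.mem_append_left _ hm
    · exact hm
  | consume j₀ k₀ s₀ g₀ e₀ rest n₀ hc hn hle hgoal =>
    simp only [SearchConfig.setChan]
    split_ifs with hj
    · obtain ⟨rfl, rfl⟩ := hj
      rw [hc] at hm
      rcases List.mem_cons.1 hm with hm | hm
      · simp only [Prod.mk.injEq] at hm
        obtain ⟨rfl, rfl, rfl⟩ := hm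
        exact Or.inr ⟨trivial, n₀, hn, hle, hgoal⟩
      · exact Or.inl hm
    · exact Or.inl hm

end Steps

/-! ### Invariants of the search -/

/-- The values stored and sent are costs of paths and admissible estimates. -/
structure SearchConfig.ValuesSound (Q : Problem P Φ A) (V : SearchConfig P Φ A) : Prop where
  lower : ∀ k s n, V.node k s = some n → Q.hStar Q.init ≤ n.g + Q.hStar s
  adm : ∀ k s n, V.node k s = some n → n.h ≤ Q.hStar s
  mem : ∀ k s n, V.node k s = some n → n.g ∈ Q.costSet
  msg_lower : ∀ j k s g e, (s, g, e) ∈ V.chan j k → Q.hStar Q.init ≤ g + Q.hStar s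
  msg_adm : ∀ j k s g e, (s, g, e) ∈ V.chan j k → e ≤ Q.hStar s
  msg_mem : ∀ j k s g e, (s, g, e) ∈ V.chan j k → g ∈ Q.costSet

/-- A node obtained in the given way is backed by the nodes of `V`. -/
def SearchConfig.Backed (Q : Problem P Φ A) (V : SearchConfig P Φ A) (k : Φ) (s : Finset P)
    (g : ℝ≥0) : Origin P Φ A → Prop
  | .root => s = Q.init
  | .action s₀ a => Q.owner a = k ∧ Q.pre a ⊆ s₀ ∧ s = Q.apply a s₀ ∧
      ∃ n, V.node k s₀ = some n ∧ n.g + Q.cost a ≤ g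
  | .message j => V.Knows j s g

/-- Nodes and messages are backed by other nodes. -/
structure SearchConfig.Linked (Q : Problem P Φ A) (V : SearchConfig P Φ A) : Prop where
  msg : ∀ j k s g e, (s, g, e) ∈ V.chan j k → V.Knows j s g
  init : ∀ k, V.Knows k Q.init 0
  origin : ∀ k s n, V.node k s = some n → V.Backed Q k s n.g n.origin

/-- Closed nodes have been expanded, and the results are known or on their way. -/
structure SearchConfig.Expanded (Q : Problem P Φ A) (V : SearchConfig P Φ A) : Prop where
  succ : ∀ k s n, V.node k s = some n → n.isOpen = false → ¬ Q.goal ⊆ s →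
    ∀ a, Q.owner a = k → Q.pre a ⊆ s → V.Knows k (Q.apply a s) (n.g + Q.cost a)
  sent : ∀ k s n, V.node k s = some n → n.isOpen = false → ¬ Q.goal ⊆ s →
    n.origin.LastPublic Q → ∀ j, Q.Relevant j s →
      V.Knows j s n.g ∨ (s, n.g, n.h) ∈ V.chan k j
  goal : ∀ k s n, V.node k s = some n → n.isOpen = false → Q.goal ⊆ s →
    (s, n.g, n.h) ∈ V.chan k k

/-- The node of an agent is reached by private actions from one that the agent will send, or from
the initial state. -/
def SearchConfig.Anchored (Q : Problem P Φ A) (V : SearchConfig P Φ A) : Prop :=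
  ∀ k s n, V.node k s = some n → ∃ r m, ∃ ρ : List A, V.node k r = some m ∧
    (m.origin = .root ∨ m.origin.LastPublic Q) ∧ (∀ a ∈ ρ, ¬ Q.PublicAction a) ∧
    (∀ π, Q.Solves s π → Q.Solves r (ρ ++ π)) ∧ m.g + Q.planCost ρ ≤ n.g

/-- The recorded origins lead from the node of agent `k` for `s` to the initial state, through nodes
on optimal paths. -/
inductive Traceable (Q : Problem P Φ A) (N : Φ → Finset P → Option (Node P Φ A)) :
    Φ → Finset P → Prop
  | root (k : Φ) (s : Finset P) (n : Node P Φ A) (hn : N k s = some n) (hopt : Q.OnOptimal s n.g)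
      (ho : n.origin = .root) : Traceable Q N k s
  | action (k : Φ) (s : Finset P) (n : Node P Φ A) (hn : N k s = some n)
      (hopt : Q.OnOptimal s n.g) (s₀ : Finset P) (a : A) (ho : n.origin = .action s₀ a)
      (htr : Traceable Q N k s₀) : Traceable Q N k s
  | message (k : Φ) (s : Finset P) (n : Node P Φ A) (hn : N k s = some n)
      (hopt : Q.OnOptimal s n.g) (j : Φ) (ho : n.origin = .message j)
      (htr : Traceable Q N j s) : Traceable Q N k s

/-- The field `traceable` is restricted to nodes on optimal paths, since these are the ones whose
origins never change again. -/
structure SearchConfig.Inv (Q : Problem P Φ A) (V : SearchConfig P Φ A) : Prop where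
  values : V.ValuesSound Q
  linked : V.Linked Q
  expanded : V.Expanded Q
  anchored : V.Anchored Q
  traceable : ∀ k s n, V.node k s = some n → Q.OnOptimal s n.g → Traceable Q V.node k s

section Invariants

variable {Q : Problem P Φ A} {h : Φ → Finset P → ℝ≥0∞} {V V' : SearchConfig P Φ A}

/-- The bound `h*(I) ≤ g + h*(s)` replaces the statement that `g` is the cost of an actual path: it
is all that the lower-bound arguments use, and it passes to successors by `h*(s) ≤ c(a) + h*(s')`.
-/
theorem SearchConfig.ValuesSound.source (hV : V.ValuesSound Q) (hadm : ∀ i, Q.Admissible (h i))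
    {k : Φ} {s : Finset P} {g : ℝ≥0} {e : ℝ≥0∞} {o : Origin P Φ A}
    (hsrc : Source Q h V k s g e o) :
    Q.hStar Q.init ≤ g + Q.hStar s ∧ e ≤ Q.hStar s ∧ g ∈ Q.costSet := by
  cases hsrc with
  | action s₀ a n₀ hn ho hp hs =>
    subst hs
    refine ⟨?_, max_le (hadm k _) ?_, ?_⟩
    · calc Q.hStar Q.init ≤ n₀.g + Q.hStar s₀ := hV.lower _ _ _ hn
        _ ≤ n₀.g + (Q.cost a + Q.hStar (Q.apply a s₀)) := by gcongr; exact Q.hStar_le_apply hp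
        _ = _ := by rw [ENNReal.coe_add, add_assoc]
    · exact le_trans (tsub_le_tsub_right (hV.adm _ _ _ hn) _) (Q.hStar_sub_le hp)
    · exact Q.costSet.add_mem (hV.mem _ _ _ hn) (Q.cost_mem_costSet a)
  | message j g e hm =>
    exact ⟨hV.msg_lower _ _ _ _ _ hm, max_le (hadm k _) (hV.msg_adm _ _ _ _ _ hm),
      hV.msg_mem _ _ _ _ _ hm⟩

theorem SearchConfig.ValuesSound.step (hadm : ∀ i, Q.Admissible (h i)) (hV : V.ValuesSound Q)
    (hst : SearchStep Q h V V') : V'.ValuesSound Q := by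
  have hnode : ∀ k s n, V'.node k s = some n →
      Q.hStar Q.init ≤ n.g + Q.hStar s ∧ n.h ≤ Q.hStar s ∧ n.g ∈ Q.costSet := by
    intro k s n' hn'
    rcases hst.node_cases hn' with ⟨n, hn, hg, hh, -⟩ | ⟨-, e, hsrc, he⟩
    · rw [hg, hh]
      exact ⟨hV.lower _ _ _ hn, hV.adm _ _ _ hn, hV.mem _ _ _ hn⟩
    · obtain ⟨h1, h2, h3⟩ := hV.source hadm hsrc
      refine ⟨h1, ?_, h3⟩
      rcases he with he | ⟨n, hn, he⟩
      · rwa [he]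
      · rw [he]; exact max_le (hV.adm _ _ _ hn) h2
  have hchan : ∀ j k s g e, (s, g, e) ∈ V'.chan j k →
      Q.hStar Q.init ≤ g + Q.hStar s ∧ e ≤ Q.hStar s ∧ g ∈ Q.costSet := by
    intro j k s g e hm
    rcases hst.chan_cases hm with hm | ⟨n, hn, rfl, rfl⟩
    · exact ⟨hV.msg_lower _ _ _ _ _ hm, hV.msg_adm _ _ _ _ _ hm, hV.msg_mem _ _ _ _ _ hm⟩
    · exact ⟨hV.lower _ _ _ hn, hV.adm _ _ _ hn, hV.mem _ _ _ hn⟩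
  exact ⟨fun k s n hn => (hnode k s n hn).1, fun k s n hn => (hnode k s n hn).2.1,
    fun k s n hn => (hnode k s n hn).2.2, fun j k s g e hm => (hchan j k s g e hm).1,
    fun j k s g e hm => (hchan j k s g e hm).2.1, fun j k s g e hm => (hchan j k s g e hm).2.2⟩

theorem SearchStep.backed (hst : SearchStep Q h V V') {k : Φ} {s : Finset P} {g : ℝ≥0}
    {o : Origin P Φ A} (hb : V.Backed Q k s g o) : V'.Backed Q k s g o := by
  cases o with
  | root => exact hb
  | action s₀ a =>
    obtain ⟨h1, h2, h3, n, hn, hle⟩ := hb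
    obtain ⟨n', hn', hev⟩ := hst.evolves hn
    exact ⟨h1, h2, h3, n', hn', le_trans (by gcongr; exact hev.g_le) hle⟩
  | message j => exact hst.knows hb

theorem SearchConfig.Linked.source (hV : V.Linked Q) {k : Φ} {s : Finset P} {g : ℝ≥0} {e : ℝ≥0∞}
    {o : Origin P Φ A} (hsrc : Source Q h V k s g e o) : V.Backed Q k s g o := by
  cases hsrc with
  | action s₀ a n₀ hn ho hp hs => exact ⟨ho, hp, hs, n₀, hn, le_rfl⟩
  | message j g e hm => exact hV.msg _ _ _ _ _ hm

theorem SearchConfig.Linked.step (hV : V.Linked Q) (hst : SearchStep Q h V V') :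
    V'.Linked Q where
  msg j k s g e hm := by
    rcases hst.chan_cases hm with hm | ⟨n, hn, rfl, rfl⟩
    · exact hst.knows (hV.msg _ _ _ _ _ hm)
    · exact hst.knows ⟨n, hn, le_rfl⟩
  init k := hst.knows (hV.init k)
  origin k s n' hn' := by
    rcases hst.node_cases hn' with ⟨n, hn, hg, -, ho⟩ | ⟨-, e, hsrc, -⟩
    · rw [hg, ho]
      exact hst.backed (hV.origin _ _ _ hn)
    · exact hst.backed (hV.source hsrc)

/-- What closing a node promises holds at that moment and survives, since knowledge only improves
and a message is lost only when it has become knowledge. For goal states the promise is a message to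
the agent itself. -/
theorem SearchConfig.Expanded.step (hV : V.Expanded Q) (hst : SearchStep Q h V V') :
    V'.Expanded Q := by
  -- A closed node either was there before with the same data, or was closed by this very step.
  have key : ∀ k s n, V'.node k s = some n → n.isOpen = false →
      V.node k s = some n ∨
      ((¬ Q.goal ⊆ s → ∀ a, Q.owner a = k → Q.pre a ⊆ s →
        V.Knows k (Q.apply a s) (n.g + Q.cost a)) ∧
      (Q.goal ⊆ s → ∀ b, (s, n.g, n.h) ∈ V'.chan k b) ∧
      (¬ Q.goal ⊆ s → n.origin.LastPublic Q → ∀ b, Q.Relevant b s →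
        (s, n.g, n.h) ∈ V'.chan k b)) := by
    intro k s n hn ho
    cases hst with
    | improve k₀ s₀ g e e' o hlt he hsrc =>
      rw [SearchConfig.setNode_node] at hn
      split_ifs at hn with hks
      · obtain rfl := Option.some.inj hn
        simp at ho
      · exact Or.inl hn
    | reopen k₀ s₀ n₀ hn₀ hgoal =>
      rw [SearchConfig.setNode_node] at hn
      split_ifs at hn with hks
      · obtain rfl := Option.some.inj hn
        simp at ho
      · exact Or.inl hn
    | close k₀ s₀ n₀ out hn₀ hsucc hout hgoal hrel =>
      rw [SearchConfig.send_node, SearchConfig.setNode_node] at hn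
      split_ifs at hn with hks
      · obtain ⟨rfl, rfl⟩ := hks
        obtain rfl := Option.some.inj hn
        refine Or.inr ⟨hsucc, fun hg b => ?_, fun hg hl b hb => ?_⟩
        · simp [SearchConfig.send, hgoal hg b]
        · simp [SearchConfig.send, hrel hg hl b hb]
      · exact Or.inl hn
    | consume => exact Or.inl hn
  constructor
  · intro k s n hn ho hg a ha hp
    rcases key k s n hn ho with h1 | h1
    · exact hst.knows (hV.succ _ _ _ h1 ho hg a ha hp)
    · exact hst.knows (h1.1 hg a ha hp)
  · intro k s n hn ho hg hl j hj
    rcases key k s n hn ho with h1 | h1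
    · rcases hV.sent _ _ _ h1 ho hg hl j hj with h2 | h2
      · exact Or.inl (hst.knows h2)
      · rcases hst.chan_persists h2 with h3 | ⟨-, m, hm, hle, -⟩
        · exact Or.inr h3
        · exact Or.inl (hst.knows ⟨m, hm, hle⟩)
    · exact Or.inr (h1.2.2 hg hl j hj)
  · intro k s n hn ho hg
    rcases key k s n hn ho with h1 | h1
    · rcases hst.chan_persists (hV.goal _ _ _ h1 ho hg) with h3 | ⟨-, m, hm, -, hop⟩
      · exact h3
      -- Processing the agent's message to itself would require the goal node to be open, but it is
      -- closed.
      · obtain rfl : n = m := Option.some.inj (h1 ▸ hm)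
        simp [hop hg] at ho
    · exact h1.2.1 hg k

theorem SearchConfig.Anchored.step (hV : V.Anchored Q) (hst : SearchStep Q h V V') :
    V'.Anchored Q := by
  -- an anchor remains one, or it has been improved and its new path has an anchor of its own
  have self : ∀ k s n, V'.node k s = some n → (n.origin = .root ∨ n.origin.LastPublic Q) →
      ∃ r m, ∃ ρ : List A, V'.node k r = some m ∧
      (m.origin = .root ∨ m.origin.LastPublic Q) ∧ (∀ a ∈ ρ, ¬ Q.PublicAction a) ∧
      (∀ π, Q.Solves s π → Q.Solves r (ρ ++ π)) ∧ m.g + Q.planCost ρ ≤ n.g :=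
    fun k s n hn ho => ⟨s, n, [], hn, ho, by simp, fun π hπ => hπ, by simp⟩
  have improved : ∀ k s n, V'.node k s = some n → (∀ m, V.node k s = some m → n.g < m.g) →
      (∃ e, Source Q h V k s n.g e n.origin) →
      ∃ r m, ∃ ρ : List A, V'.node k r = some m ∧
      (m.origin = .root ∨ m.origin.LastPublic Q) ∧ (∀ a ∈ ρ, ¬ Q.PublicAction a) ∧
      (∀ π, Q.Solves s π → Q.Solves r (ρ ++ π)) ∧ m.g + Q.planCost ρ ≤ n.g := by
    rintro k s n hn hlt ⟨e, hsrc⟩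
    generalize hg : n.g = g at hsrc hlt
    generalize ho : n.origin = o at hsrc
    cases hsrc with
    | message j g e hm => exact hg ▸ self k s n hn (Or.inr (by rw [ho]; trivial))
    | action s₀ a n₀ hn₀ how hp hs =>
      by_cases ha : Q.PublicAction a
      · exact hg ▸ self k s n hn (Or.inr (by rw [ho]; exact ha))
      obtain ⟨r, m, ρ, hm, hmo, hρ, hsol, hle⟩ := hV k s₀ n₀ hn₀
      -- The anchor of `s₀` costs no more than the new path to `s`, whereas the new path is strictly
      -- cheaper than the old node of `s`. So this step does not overwrite the anchor.
      have hmlt : ¬ r = s := by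
        rintro rfl
        have h1 := hlt m hm
        have h2 : m.g ≤ n₀.g + Q.cost a :=
          (le_add_of_nonneg_right (by simp)).trans (hle.trans (le_add_of_nonneg_right (by simp)))
        exact absurd h1 (not_lt.2 h2)
      have hm' : ∃ m', V'.node k r = some m' ∧ m'.g = m.g ∧ m'.origin = m.origin := by
        cases hst with
        | improve k₁ s₁ g e e' o hlt' he hsrc =>
          by_cases hk : k = k₁ ∧ s = s₁
          · obtain ⟨rfl, rfl⟩ := hk
            exact ⟨m, by simp [SearchConfig.setNode_node, hmlt, hm], rfl, rfl⟩
          · rw [SearchConfig.setNode_node, if_neg hk] at hn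
            exact absurd (hlt n hn) (by simp [hg])
        | reopen k₁ s₁ n₁ hn₁ hgoal =>
          by_cases hk : k = k₁ ∧ r = s₁
          · obtain ⟨rfl, rfl⟩ := hk
            obtain rfl : m = n₁ := Option.some.inj (hm ▸ hn₁)
            exact ⟨_, V.setNode_node_self .., rfl, rfl⟩
          · exact ⟨m, by simp [SearchConfig.setNode_node, hk, hm], rfl, rfl⟩
        | close k₁ s₁ n₁ out hn₁ =>
          by_cases hk : k = k₁ ∧ r = s₁
          · obtain ⟨rfl, rfl⟩ := hk
            obtain rfl : m = n₁ := Option.some.inj (hm ▸ hn₁)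
            exact ⟨_, V.setNode_node_self .., rfl, rfl⟩
          · exact ⟨m, by simp [SearchConfig.setNode_node, hk, hm], rfl, rfl⟩
        | consume => exact ⟨m, hm, rfl, rfl⟩
      obtain ⟨m', hm', hg', ho'⟩ := hm'
      refine ⟨r, m', ρ ++ [a], hm', ho' ▸ hmo, ?_, ?_, ?_⟩
      · intro b hb
        rcases List.mem_append.1 hb with hb | hb
        · exact hρ b hb
        · rw [List.mem_singleton.1 hb]; exact ha
      · intro π hπ
        have : Q.Solves s₀ (a :: π) := ⟨hp, hs ▸ hπ⟩
        simpa using hsol _ this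
      · rw [hg', Problem.planCost_append, ← add_assoc]
        simpa using hle
  intro k s n hn
  rcases hst.node_cases hn with ⟨n₀, hn₀, hg, -, ho⟩ | ⟨hlt, e, hsrc, -⟩
  · obtain ⟨r, m, ρ, hm, hmo, hρ, hsol, hle⟩ := hV k s n₀ hn₀
    obtain ⟨m', hm', hev⟩ := hst.evolves hm
    rcases hst.node_cases hm' with ⟨m₁, hm₁, hg₁, -, ho₁⟩ | ⟨hlt, e, hsrc, -⟩
    · obtain rfl : m = m₁ := Option.some.inj (hm ▸ hm₁)
      exact ⟨r, m', ρ, hm', ho₁ ▸ hmo, hρ, hsol, by rw [hg₁, hg]; exact hle⟩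
    -- The anchor itself has just been improved and may have lost its public origin, so it is
    -- replaced by an anchor of its new path.
    · obtain ⟨r₁, m₁, ρ₁, hm₁, hmo₁, hρ₁, hsol₁, hle₁⟩ := improved k r m' hm' hlt ⟨e, hsrc⟩
      refine ⟨r₁, m₁, ρ₁ ++ ρ, hm₁, hmo₁, ?_, ?_, ?_⟩
      · intro b hb
        rcases List.mem_append.1 hb with hb | hb
        · exact hρ₁ b hb
        · exact hρ b hb
      · intro π hπ
        simpa using hsol₁ _ (hsol π hπ)
      · rw [Problem.planCost_append, ← add_assoc, hg]
        exact le_trans (by gcongr; exact hle₁.trans hev.g_le) hle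
  · exact improved k s n hn hlt ⟨e, hsrc⟩

theorem Traceable.mono {N N' : Φ → Finset P → Option (Node P Φ A)}
    (hN : ∀ k s n, N k s = some n → Q.OnOptimal s n.g →
      ∃ n', N' k s = some n' ∧ n'.g = n.g ∧ n'.origin = n.origin)
    {k : Φ} {s : Finset P} (htr : Traceable Q N k s) : Traceable Q N' k s := by
  induction htr with
  | root k s n hn hopt ho =>
    obtain ⟨n', hn', hg, ho'⟩ := hN k s n hn hopt
    exact .root k s n' hn' (hg ▸ hopt) (ho'.trans ho)
  | action k s n hn hopt s₀ a ho htr ih =>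
    obtain ⟨n', hn', hg, ho'⟩ := hN k s n hn hopt
    exact .action k s n' hn' (hg ▸ hopt) s₀ a (ho'.trans ho) ih
  | message k s n hn hopt j ho htr ih =>
    obtain ⟨n', hn', hg, ho'⟩ := hN k s n hn hopt
    exact .message k s n' hn' (hg ▸ hopt) j (ho'.trans ho) ih

/-- Nodes on optimal paths are final. -/
theorem SearchStep.optimal_stable (hV' : V'.ValuesSound Q) (hst : SearchStep Q h V V') {k : Φ}
    {s : Finset P} {n : Node P Φ A} (hn : V.node k s = some n) (hopt : Q.OnOptimal s n.g) :
    ∃ n', V'.node k s = some n' ∧ n'.g = n.g ∧ n'.origin = n.origin := by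
  obtain ⟨n', hn', hev⟩ := hst.evolves hn
  rcases hev with hlt | hev
  · exact absurd hlt (hopt.not_lt (hV'.lower _ _ _ hn'))
  · exact ⟨n', hn', hev.1, hev.2.2.1⟩

/-- For `traceable`, a new node on an optimal path hangs on a node that was already there and is
itself on an optimal path. The chain of origins is thus finite by induction over the steps; with
actions of cost zero, decreasing `g`-values would not show this. -/
theorem SearchConfig.Inv.step (hadm : ∀ i, Q.Admissible (h i)) (hV : V.Inv Q)
    (hst : SearchStep Q h V V') : V'.Inv Q := by
  have hval := hV.values.step hadm hst
  refine ⟨hval, hV.linked.step hst, hV.expanded.step hst, hV.anchored.step hst, ?_⟩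
  intro k s n' hn' hopt
  have hmono : ∀ {k s}, Traceable Q V.node k s → Traceable Q V'.node k s :=
    Traceable.mono fun k s n hn hopt => hst.optimal_stable hval hn hopt
  rcases hst.node_cases hn' with ⟨n, hn, hg, -, -⟩ | ⟨-, e, hsrc, -⟩
  · exact hmono (hV.traceable k s n hn (hg ▸ hopt))
  · generalize hg : n'.g = g at hsrc
    generalize ho : n'.origin = o at hsrc
    cases hsrc with
    | action s₀ a n₀ hn₀ how hp hs =>
      refine .action k s n' hn' hopt s₀ a ho (hmono (hV.traceable k s₀ n₀ hn₀ ?_))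
      exact Problem.OnOptimal.of_apply hp (hs ▸ hopt) hg.ge
    | message j g e hm =>
      obtain ⟨m, hm', hle⟩ := hV.linked.msg _ _ _ _ _ hm
      exact .message k s n' hn' hopt j ho
        (hmono (hV.traceable j s m hm' (hopt.mono (hle.trans hg.ge))))

theorem SearchConfig.Inv.steps (hadm : ∀ i, Q.Admissible (h i)) (hV : V.Inv Q)
    (hst : Relation.ReflTransGen (SearchStep Q h) V V') : V'.Inv Q := by
  induction hst with
  | refl => exact hV
  | tail _ hst ih => exact ih.step hadm hst

theorem steps_evolves (hst : Relation.ReflTransGen (SearchStep Q h) V V') {k : Φ} {s : Finset P}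
    {n : Node P Φ A} (hn : V.node k s = some n) :
    ∃ n', V'.node k s = some n' ∧ n.Evolves Q s n' := by
  induction hst with
  | refl => exact ⟨n, hn, .refl ..⟩
  | tail _ hst ih =>
    obtain ⟨n₁, hn₁, h₁⟩ := ih
    obtain ⟨n₂, hn₂, h₂⟩ := hst.evolves hn₁
    exact ⟨n₂, hn₂, h₁.trans h₂⟩

end Invariants

/-! ### The search never loses the optimal solutions -/

/-- Some open node, or some state in transit, has an `f`-value of at most `x`. -/
def SearchConfig.HasFrontier (V : SearchConfig P Φ A) (x : ℝ≥0∞) : Prop :=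
  (∃ k s n, V.node k s = some n ∧ n.isOpen = true ∧ n.f ≤ x) ∨
    ∃ j k s g e, (s, g, e) ∈ V.chan j k ∧ (g : ℝ≥0∞) + e ≤ x

section Frontier

variable {Q : Problem P Φ A} {V : SearchConfig P Φ A}

theorem SearchConfig.Inv.frontier_of_open (hV : V.Inv Q) {k : Φ} {s : Finset P} {n : Node P Φ A}
    (hn : V.node k s = some n) (hopt : Q.OnOptimal s n.g) (ho : n.isOpen = true) :
    V.HasFrontier (Q.hStar Q.init) := by
  refine Or.inl ⟨k, s, n, hn, ho, le_trans ?_ hopt.le⟩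
  unfold Node.f
  gcongr
  exact hV.values.adm _ _ _ hn

theorem SearchConfig.Inv.frontier_of_msg (hV : V.Inv Q) {j k : Φ} {s : Finset P} {g : ℝ≥0}
    {e : ℝ≥0∞} (hm : (s, g, e) ∈ V.chan j k) (hopt : Q.OnOptimal s g) :
    V.HasFrontier (Q.hStar Q.init) := by
  refine Or.inr ⟨j, k, s, g, e, hm, le_trans ?_ hopt.le⟩
  gcongr
  exact hV.values.msg_adm _ _ _ _ _ hm

/-- A closed goal node is no obstacle: its message to its own agent is still in transit and supplies
the frontier. -/
theorem SearchConfig.Inv.frontier_or_closed (hV : V.Inv Q) {k : Φ} {s : Finset P}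
    {n : Node P Φ A} (hn : V.node k s = some n) (hopt : Q.OnOptimal s n.g) :
    V.HasFrontier (Q.hStar Q.init) ∨ (n.isOpen = false ∧ ¬ Q.goal ⊆ s) := by
  by_cases ho : n.isOpen = true
  · exact Or.inl (hV.frontier_of_open hn hopt ho)
  · rw [Bool.not_eq_true] at ho
    by_cases hg : Q.goal ⊆ s
    · exact Or.inl (hV.frontier_of_msg (hV.expanded.goal _ _ _ hn ho hg) hopt)
    · exact Or.inr ⟨ho, hg⟩

/-- Along actions of a single agent no communication is needed: each closed node has a known
successor of no larger cost, and any other node on the way supplies the frontier. -/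
theorem SearchConfig.Inv.frontier_or_knows (hV : V.Inv Q) {k : Φ} {ρ : List A} :
    ∀ {τ : List A} {s : Finset P} {g : ℝ≥0}, V.Knows k s g → (∀ a ∈ τ, Q.owner a = k) →
    Q.Solves s (τ ++ ρ) → (g : ℝ≥0∞) + Q.planCost (τ ++ ρ) ≤ Q.hStar Q.init →
    V.HasFrontier (Q.hStar Q.init) ∨ ∃ s' g', V.Knows k s' g' ∧ Q.Solves s' ρ ∧
      (g' : ℝ≥0∞) + Q.planCost ρ ≤ Q.hStar Q.init := by
  intro τ
  induction τ with
  | nil => exact fun hk _ hsol hle => Or.inr ⟨_, _, hk, hsol, hle⟩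
  | cons a τ ih =>
    intro s g hk hown hsol hle
    obtain ⟨n, hn, hng⟩ := hk
    have hopt : Q.OnOptimal s n.g := Problem.OnOptimal.mono ⟨_, hsol, hle⟩ hng
    rcases hV.frontier_or_closed hn hopt with hf | ⟨ho, hg⟩
    · exact Or.inl hf
    · refine ih (hV.expanded.succ _ _ _ hn ho hg a (hown a (by simp)) hsol.1)
        (fun b hb => hown b (by simp [hb])) hsol.2 (le_trans ?_ hle)
      rw [List.cons_append, Problem.planCost_cons, ENNReal.coe_add, ENNReal.coe_add, ← add_assoc]
      gcongr

open Classical in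
-- Induction on the number of public actions left. It cannot be on the length of the plan, because
-- the argument returns from `s` to its anchor and puts private actions back in front.
theorem SearchConfig.Inv.frontier_of_onOptimal (hV : V.Inv Q) (c : ℕ) :
    ∀ {k : Φ} {s : Finset P} {g : ℝ≥0} {π : List A}, V.Knows k s g → Q.Solves s π →
    (g : ℝ≥0∞) + Q.planCost π ≤ Q.hStar Q.init → π.countP (fun a => Q.PublicAction a) ≤ c →
    V.HasFrontier (Q.hStar Q.init) := by
  induction c with
  | zero =>
    rintro k s g π ⟨n, hn, hng⟩ hsol hle hc
    rw [Nat.le_zero, List.countP_eq_zero] at hc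
    have hgoal := Problem.goal_subset_of_private (fun a ha => by simpa using hc a ha) hsol
    rcases hV.frontier_or_closed hn (Problem.OnOptimal.mono ⟨_, hsol, hle⟩ hng) with hf | hf
    · exact hf
    · exact absurd hgoal hf.2
  | succ c ih =>
    rintro k s g π ⟨n, hn, hng⟩ hsol hle hc
    by_cases hpub : ∃ a ∈ π, Q.PublicAction a
    swap
    · push Not at hpub
      refine ih ⟨n, hn, hng⟩ hsol hle ?_
      rw [List.countP_eq_zero.2 (fun a ha => by simpa using hpub a ha)]
      exact Nat.zero_le _
    -- The state `s` may never be sent, since its last action may be private. Its anchor is sent or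
    -- is the initial state, and going back to it costs only private actions.
    obtain ⟨r, m, ρ, hm, hmo, hρ, hext, hmle⟩ := hV.anchored k s n hn
    have hle' : (m.g : ℝ≥0∞) + Q.planCost (ρ ++ π) ≤ Q.hStar Q.init := by
      refine le_trans ?_ hle
      rw [Problem.planCost_append, ENNReal.coe_add, ← add_assoc]
      gcongr
      exact_mod_cast hmle.trans hng
    have hcount : (ρ ++ π).countP (fun a => Q.PublicAction a) ≤ c + 1 := by
      rw [List.countP_append, List.countP_eq_zero.2 (fun a ha => by simpa using hρ a ha),
        zero_add]
      exact hc
    have hex : ∃ a ∈ ρ ++ π, Q.PublicAction a := by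
      obtain ⟨a, ha, ha'⟩ := hpub
      exact ⟨a, List.mem_append_right _ ha, ha'⟩
    obtain ⟨a, τ, π', ha, hτ, hrel, hsol', hperm⟩ := Problem.exists_reorder (hext π hsol) hex
    rw [Problem.planCost_perm Q hperm] at hle'
    rw [hperm.countP_eq] at hcount
    have hopt : Q.OnOptimal r m.g := ⟨_, hsol', hle'⟩
    -- Every agent knows the initial state at cost zero; any other anchor, once closed, has been
    -- sent to the owner of `a`, for which it is relevant.
    have hknows : V.HasFrontier (Q.hStar Q.init) ∨ V.Knows (Q.owner a) r m.g := by
      rcases hmo with hmo | hmo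
      · have hr : r = Q.init := by
          have := hV.linked.origin _ _ _ hm
          rwa [hmo] at this
        obtain ⟨m₀, hm₀, hle₀⟩ := hV.linked.init (Q.owner a)
        exact Or.inr ⟨m₀, hr ▸ hm₀, hle₀.trans zero_le⟩
      · rcases hV.frontier_or_closed hm hopt with hf | ⟨ho, hg⟩
        · exact Or.inl hf
        · rcases hV.expanded.sent _ _ _ hm ho hg hmo _ hrel with h1 | h1
          · exact Or.inr h1
          · exact Or.inl (hV.frontier_of_msg h1 hopt)
    rcases hknows with hf | hknows
    · exact hf
    have hassoc : τ ++ a :: π' = (τ ++ [a]) ++ π' := by simp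
    rw [hassoc] at hsol' hle' hcount
    rcases hV.frontier_or_knows hknows (by
      intro b hb
      rcases List.mem_append.1 hb with hb | hb
      · exact hτ b hb
      · rw [List.mem_singleton.1 hb]) hsol' hle' with hf | ⟨s', g', hk', hs', hle''⟩
    · exact hf
    · refine ih hk' hs' hle'' ?_
      have : 0 < (τ ++ [a]).countP (fun a => Q.PublicAction a) :=
        List.countP_pos_iff.2 ⟨a, by simp, by simpa using ha⟩
      rw [List.countP_append] at hcount
      omega

/-- If the problem has a solution, then an open node or a state in transit has an `f`-value that
does not exceed the cost of an optimal solution. -/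
theorem SearchConfig.Inv.hasFrontier [Finite A] [Nonempty Φ] (hV : V.Inv Q)
    (hsol : ∃ π, Q.IsPlan π) : V.HasFrontier (Q.hStar Q.init) := by
  obtain ⟨π, hπ, hle⟩ := Q.exists_optimal hsol
  obtain ⟨k⟩ := ‹Nonempty Φ›
  exact hV.frontier_of_onOptimal _ (hV.linked.init k) hπ (by simpa using hle) le_rfl

end Frontier

/-! ### The operations of the agents as changes of the search -/

theorem LocalState.lowerBound_le {L : LocalState P Φ A} {s : Finset P} {n : Node P Φ A}
    (hn : L.node s = some n) (ho : n.isOpen = true) : L.lowerBound ≤ n.f :=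
  iInf_le_of_le s (iInf₂_le n ⟨hn, ho⟩)

theorem LocalState.le_lowerBound {L : LocalState P Φ A} {x : ℝ≥0∞}
    (hx : ∀ s n, L.node s = some n → n.isOpen = true → x ≤ n.f) : x ≤ L.lowerBound :=
  le_iInf fun s => le_iInf₂ fun n hn => hx s n hn.1 hn.2

/-- `L'` differs from `L` at most in the nodes. -/
def LocalState.SameProtocol (L L' : LocalState P Φ A) : Prop :=
  L' = { L with node := L'.node }

theorem LocalState.SameProtocol.trans {L₁ L₂ L₃ : LocalState P Φ A} (h₁ : L₁.SameProtocol L₂)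
    (h₂ : L₂.SameProtocol L₃) : L₁.SameProtocol L₃ := by
  unfold SameProtocol at *
  rw [h₂, h₁]

theorem LocalState.sameProtocol_setNode (L : LocalState P Φ A) (s : Finset P) (n : Node P Φ A) :
    L.SameProtocol (L.setNode s n) := rfl

namespace LocalState.SameProtocol

variable {L L' : LocalState P Φ A}

theorem snap (h : L.SameProtocol L') : L'.snap = L.snap := by rw [h]
theorem verif (h : L.SameProtocol L') : L'.verif = L.verif := by rw [h]
theorem numVerif (h : L.SameProtocol L') : L'.numVerif = L.numVerif := by rw [h]
theorem accepted (h : L.SameProtocol L') : L'.accepted = L.accepted := by rw [h]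
theorem output (h : L.SameProtocol L') : L'.output = L.output := by rw [h]

end LocalState.SameProtocol

theorem LocalState.relax_cases (L : LocalState P Φ A) (s : Finset P) (g : ℝ≥0) (e : ℝ≥0∞)
    (o : Origin P Φ A) :
    (∃ n, L.node s = some n ∧ n.g ≤ g ∧ L.relax s g e o = L) ∨
    ((∀ n, L.node s = some n → g < n.g) ∧ ∃ e', (e' = e ∨ ∃ n, L.node s = some n ∧ e' = max n.h e) ∧
      L.relax s g e o = L.setNode s ⟨g, e', o, true⟩) := by
  unfold relax
  split
  · next hn => exact Or.inr ⟨by simp [hn], e, Or.inl rfl, rfl⟩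
  · next n hn =>
    split_ifs with hlt
    · exact Or.inr ⟨fun m hm => Option.some.inj (hn.symm.trans hm) ▸ hlt, _,
        Or.inr ⟨n, hn, rfl⟩, rfl⟩
    · exact Or.inl ⟨n, hn, not_lt.1 hlt, rfl⟩

theorem LocalState.sameProtocol_relax (L : LocalState P Φ A) (s : Finset P) (g : ℝ≥0) (e : ℝ≥0∞)
    (o : Origin P Φ A) : L.SameProtocol (L.relax s g e o) := by
  rcases L.relax_cases s g e o with ⟨n, -, -, h⟩ | ⟨-, e', -, h⟩ <;> rw [h] <;> rfl

theorem LocalState.sameProtocol_reopen (L : LocalState P Φ A) (s : Finset P) :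
    L.SameProtocol (L.reopen s) := by
  unfold reopen
  split <;> rfl

theorem sameProtocol_processSearch (Q : Problem P Φ A) (hi : Finset P → ℝ≥0∞) (j : Φ)
    (s : Finset P) (g : ℝ≥0) (e : ℝ≥0∞) (L : LocalState P Φ A) :
    L.SameProtocol (processSearch Q hi j s g e L) := by
  unfold processSearch
  dsimp only
  split_ifs
  · exact (L.sameProtocol_relax ..).trans (LocalState.sameProtocol_reopen ..)
  · exact L.sameProtocol_relax ..

theorem sameProtocol_foldl_generate (Q : Problem P Φ A) (hi : Finset P → ℝ≥0∞) (s : Finset P)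
    (n : Node P Φ A) (acts : List A) : ∀ L : LocalState P Φ A,
    L.SameProtocol (acts.foldl (generate Q hi s n) L) := by
  induction acts with
  | nil => exact fun L => rfl
  | cons a acts ih => exact fun L => (L.sameProtocol_relax ..).trans (ih _)

theorem sameProtocol_expandState (Q : Problem P Φ A) (hi : Finset P → ℝ≥0∞) (s : Finset P)
    (n : Node P Φ A) (acts : List A) (L : LocalState P Φ A) :
    L.SameProtocol (expandState Q hi s n acts L) :=
  (L.sameProtocol_setNode ..).trans (sameProtocol_foldl_generate ..)

theorem LocalState.setNode_setNode_comm (L : LocalState P Φ A) {s s' : Finset P} (hs : s' ≠ s)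
    (n n' : Node P Φ A) : (L.setNode s n).setNode s' n' = (L.setNode s' n').setNode s n := by
  simp only [setNode]
  rw [Function.update_comm hs.symm]

/-- Closing a state commutes with the generation of its successors. -/
theorem generate_setNode (Q : Problem P Φ A) (hi : Finset P → ℝ≥0∞) (s : Finset P)
    (n : Node P Φ A) (b : Bool) (L : LocalState P Φ A) (hn : L.node s = some n) (a : A) :
    generate Q hi s n (L.setNode s { n with isOpen := b }) a =
      (generate Q hi s n L a).setNode s { n with isOpen := b } ∧
    (generate Q hi s n L a).node s = some n := by
  -- An action that leads from `s` back to `s` is never an improvement, so the node being expanded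
  -- stays untouched.
  have hge : ¬ n.g + Q.cost a < n.g := not_lt.2 (le_add_of_nonneg_right (by simp))
  unfold generate LocalState.relax
  by_cases hs : Q.apply a s = s
  · have h1 : (L.setNode s { n with isOpen := b }).node s = some { n with isOpen := b } := by
      simp [LocalState.setNode]
    simp only [hs, hn, h1, if_neg hge, and_self]
  · have h1 : (L.setNode s { n with isOpen := b }).node (Q.apply a s) = L.node (Q.apply a s) := by
      simp [LocalState.setNode, hs]
    rw [h1]
    constructor
    · split
      · exact L.setNode_setNode_comm hs _ _
      · split_ifs
        · exact L.setNode_setNode_comm hs _ _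
        · rfl
    · split
      · simp [LocalState.setNode, Ne.symm hs, hn]
      · split_ifs
        · simp [LocalState.setNode, Ne.symm hs, hn]
        · exact hn

theorem foldl_generate_setNode (Q : Problem P Φ A) (hi : Finset P → ℝ≥0∞) (s : Finset P)
    (n : Node P Φ A) (b : Bool) (acts : List A) : ∀ (L : LocalState P Φ A), L.node s = some n →
    acts.foldl (generate Q hi s n) (L.setNode s { n with isOpen := b }) =
      (acts.foldl (generate Q hi s n) L).setNode s { n with isOpen := b } ∧
    (acts.foldl (generate Q hi s n) L).node s = some n := by
  induction acts with
  | nil => exact fun L hn => ⟨rfl, hn⟩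
  | cons a acts ih =>
    intro L hn
    obtain ⟨h1, h2⟩ := generate_setNode Q hi s n b L hn a
    rw [List.foldl_cons, h1]
    exact ih _ h2

/-- Replace the nodes of agent `k`. -/
def SearchConfig.withNodes (V : SearchConfig P Φ A) (k : Φ)
    (N : Finset P → Option (Node P Φ A)) : SearchConfig P Φ A :=
  { V with node := Function.update V.node k N }

theorem SearchConfig.withNodes_self {V : SearchConfig P Φ A} {k : Φ}
    {N : Finset P → Option (Node P Φ A)} (hN : V.node k = N) : V.withNodes k N = V := by
  subst hN
  simp [withNodes]

@[simp] theorem SearchConfig.withNodes_withNodes (V : SearchConfig P Φ A) (k : Φ)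
    (N N' : Finset P → Option (Node P Φ A)) :
    (V.withNodes k N).withNodes k N' = V.withNodes k N' := by
  simp [withNodes]

theorem SearchConfig.withNodes_setNode (V : SearchConfig P Φ A) (k : Φ) (L : LocalState P Φ A)
    (s : Finset P) (n : Node P Φ A) :
    (V.withNodes k L.node).setNode k s n = V.withNodes k (L.setNode s n).node := by
  simp [withNodes, setNode, LocalState.setNode]

@[simp] theorem SearchConfig.withNodes_node_self (V : SearchConfig P Φ A) (k : Φ)
    (N : Finset P → Option (Node P Φ A)) : (V.withNodes k N).node k = N := by
  simp [withNodes]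

section Simulation

variable {Q : Problem P Φ A} {h : Φ → Finset P → ℝ≥0∞} {V : SearchConfig P Φ A}

open Relation (ReflTransGen)

theorem steps_relax {k : Φ} {L : LocalState P Φ A} (hV : V.node k = L.node) {s : Finset P}
    {g : ℝ≥0} {e : ℝ≥0∞} {o : Origin P Φ A} (hsrc : Source Q h V k s g e o) :
    ReflTransGen (SearchStep Q h) V (V.withNodes k (L.relax s g e o).node) ∧
      (V.withNodes k (L.relax s g e o).node).Knows k s g := by
  rcases L.relax_cases s g e o with ⟨n, hn, hle, heq⟩ | ⟨hlt, e', he', heq⟩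
  · rw [heq, SearchConfig.withNodes_self hV]
    exact ⟨.refl, n, hV ▸ hn, hle⟩
  · rw [heq, ← SearchConfig.withNodes_setNode, SearchConfig.withNodes_self hV]
    exact ⟨.single (.improve V k s g e e' o (hV ▸ hlt) (hV ▸ he') hsrc),
      _, V.setNode_node_self .., le_rfl⟩

theorem steps_foldl_generate {k : Φ} {s : Finset P} {n : Node P Φ A} (acts : List A) :
    ∀ {V : SearchConfig P Φ A} {L : LocalState P Φ A}, V.node k = L.node → L.node s = some n →
    (∀ a ∈ acts, Q.owner a = k ∧ Q.pre a ⊆ s) →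
    ReflTransGen (SearchStep Q h) V
      (V.withNodes k (acts.foldl (generate Q (h k) s n) L).node) ∧
    ∀ a ∈ acts, (V.withNodes k (acts.foldl (generate Q (h k) s n) L).node).Knows k
      (Q.apply a s) (n.g + Q.cost a) := by
  induction acts with
  | nil =>
    intro V L hV hn _
    exact ⟨by rw [List.foldl_nil, SearchConfig.withNodes_self hV], by simp⟩
  | cons a acts ih =>
    intro V L hV hn hacts
    obtain ⟨ho, hp⟩ := hacts a (by simp)
    have hsrc : Source Q h V k (Q.apply a s) (n.g + Q.cost a)
        (max (h k (Q.apply a s)) (n.h - (Q.cost a : ℝ≥0∞))) (.action s a) :=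
      .action s a n (hV ▸ hn) ho hp rfl
    obtain ⟨h1, h2⟩ := steps_relax hV hsrc
    obtain ⟨h3, h4⟩ := ih (V := V.withNodes k (generate Q (h k) s n L a).node)
      (L := generate Q (h k) s n L a) (by simp)
      -- Only the second component is used, so the flag `true` is arbitrary.
      (generate_setNode Q (h k) s n true L hn a).2 (fun b hb => hacts b (by simp [hb]))
    rw [SearchConfig.withNodes_withNodes] at h3 h4
    refine ⟨h1.trans h3, fun b hb => ?_⟩
    rcases List.mem_cons.1 hb with rfl | hb
    · obtain ⟨m, hm, hle⟩ := h2
      obtain ⟨m', hm', hev⟩ := steps_evolves h3 hm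
      exact ⟨m', hm', hev.g_le.trans hle⟩
    · exact h4 b hb

/-- The states among the messages. -/
def searches (l : List (Msg P Φ A)) : List (Finset P × ℝ≥0 × ℝ≥0∞) :=
  l.filterMap fun
    | .search s g e => some (s, g, e)
    | _ => none

/-- The agent closes `s` before generating the successors, but the elementary step `close` demands
that they be known already. The two orders give the same result by `foldl_generate_setNode`. -/
theorem steps_expandState {k : Φ} {s : Finset P} {n : Node P Φ A} {L : LocalState P Φ A}
    {acts : List A} (hV : V.node k = L.node) (hn : L.node s = some n) (hgoal : ¬ Q.goal ⊆ s)
    (hacts : ∀ a, a ∈ acts ↔ Q.owner a = k ∧ Q.pre a ⊆ s) :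
    ReflTransGen (SearchStep Q h) V ((V.withNodes k (expandState Q (h k) s n acts L).node).send k
      fun b => searches (expandOut Q s n b)) := by
  obtain ⟨h1, h2⟩ := foldl_generate_setNode Q (h k) s n false acts L hn
  obtain ⟨h3, h4⟩ := steps_foldl_generate (h := h) acts hV hn (fun a ha => (hacts a).1 ha)
  unfold expandState
  rw [h1, ← SearchConfig.withNodes_setNode]
  refine h3.tail (.close _ k s n _ (by simpa using h2) (fun _ a ho hp => h4 a ((hacts a).2 ⟨ho, hp⟩))
    (fun b => ?_) (fun hg => absurd hg hgoal) (fun _ hl b hb => ?_))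
  · unfold expandOut
    split_ifs
    · exact Or.inr rfl
    · exact Or.inl rfl
  · simp [expandOut, hl, hb, searches]

theorem steps_closeGoal {k : Φ} {s : Finset P} {n : Node P Φ A} {L : LocalState P Φ A}
    (hV : V.node k = L.node) (hn : L.node s = some n) (hgoal : Q.goal ⊆ s) :
    ReflTransGen (SearchStep Q h) V
      ((V.withNodes k (L.setNode s { n with isOpen := false }).node).send k
        fun _ => [(s, n.g, n.h)]) := by
  rw [← SearchConfig.withNodes_setNode, SearchConfig.withNodes_self hV]
  exact .single (.close V k s n _ (hV ▸ hn) (fun hg => absurd hgoal hg) (fun _ => Or.inr rfl)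
    (fun _ _ => rfl) (fun hg => absurd hgoal hg))

/-- The message is removed from the channel last: while it is still there, it serves as the source
of the improved node. -/
theorem steps_processSearch {j k : Φ} {s : Finset P} {g : ℝ≥0} {e : ℝ≥0∞}
    {rest : List (Finset P × ℝ≥0 × ℝ≥0∞)} {L : LocalState P Φ A} (hV : V.node k = L.node)
    (hc : V.chan j k = (s, g, e) :: rest) :
    ReflTransGen (SearchStep Q h) V
      ((V.withNodes k (processSearch Q (h k) j s g e L).node).setChan j k rest) := by
  have hsrc : Source Q h V k s g (max (h k s) e) (.message j) := .message j g e (by simp [hc])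
  obtain ⟨h1, n, hn, hle⟩ := steps_relax hV hsrc
  unfold processSearch
  dsimp only
  split_ifs with hg
  · have hn' : (L.relax s g (max (h k s) e) (.message j)).node s = some n := by simpa using hn
    have hre : ((L.relax s g (max (h k s) e) (.message j)).reopen s) =
        (L.relax s g (max (h k s) e) (.message j)).setNode s { n with isOpen := true } := by
      simp [LocalState.reopen, hn']
    rw [hre, ← SearchConfig.withNodes_setNode]
    exact (h1.tail (.reopen _ k s n hn hg)).tail
      (.consume _ j k s g e rest { n with isOpen := true } hc
        (SearchConfig.setNode_node_self ..) hle (fun _ => rfl))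
  · exact h1.tail (.consume _ j k s g e rest n hc hn hle (fun hg' => absurd hg' hg))

end Simulation

/-! ### Consistent cuts -/

/-- The states that precede the marker of snapshot `id` in a channel. -/
def searchesBefore (id : Φ × ℕ) : List (Msg P Φ A) → List (Finset P × ℝ≥0 × ℝ≥0∞)
  | [] => []
  | .search s g e :: l => (s, g, e) :: searchesBefore id l
  | .marker id' :: l => if id' = id then [] else searchesBefore id l
  | .report _ _ :: l => searchesBefore id l
  | .trace _ _ :: l => searchesBefore id l
  | .terminate _ :: l => searchesBefore id l

theorem searchesBefore_append_of_mem {id : Φ × ℕ} {l l' : List (Msg P Φ A)}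
    (hl : .marker id ∈ l) : searchesBefore id (l ++ l') = searchesBefore id l := by
  induction l with
  | nil => simp at hl
  | cons m l ih =>
    cases m with
    | marker id' =>
      by_cases h : id' = id
      · simp [searchesBefore, h]
      · have : Msg.marker id ∈ l := by simpa [Ne.symm h] using hl
        simp [searchesBefore, h, ih this]
    | _ =>
      have : Msg.marker id ∈ l := by simpa using hl
      simp [searchesBefore, ih this]

theorem searchesBefore_append_of_notMem {id : Φ × ℕ} {l l' : List (Msg P Φ A)}
    (hl : .marker id ∉ l) :
    searchesBefore id (l ++ l') = searchesBefore id l ++ searchesBefore id l' := by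
  induction l with
  | nil => rfl
  | cons m l ih =>
    rw [List.mem_cons, not_or] at hl
    cases m with
    | marker id' =>
      have h : id' ≠ id := fun h => hl.1 (by rw [h])
      simp [searchesBefore, h, ih hl.2]
    | _ => simp [searchesBefore, ih hl.2]

theorem searchesBefore_eq_searches {id : Φ × ℕ} {l : List (Msg P Φ A)} (hl : .marker id ∉ l) :
    searchesBefore id l = searches l := by
  induction l with
  | nil => rfl
  | cons m l ih =>
    rw [List.mem_cons, not_or] at hl
    cases m with
    | marker id' =>
      have h : id' ≠ id := fun h => hl.1 (by rw [h])
      simp [searchesBefore, h, ih hl.2, searches]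
    | _ => simp [searchesBefore, ih hl.2, searches]

theorem Config.act_loc_self (c : Config P Φ A) (i : Φ) (L : LocalState P Φ A)
    (out : Outbox P Φ A) : (c.act i L out).loc i = L := by simp [act]

theorem Config.act_loc_ne (c : Config P Φ A) {i k : Φ} (hk : k ≠ i) (L : LocalState P Φ A)
    (out : Outbox P Φ A) : (c.act i L out).loc k = c.loc k := by simp [act, hk]

theorem Config.act_chan_self (c : Config P Φ A) (i : Φ) (L : LocalState P Φ A)
    (out : Outbox P Φ A) (b : Φ) : (c.act i L out).chan i b = c.chan i b ++ out b := by
  simp [act]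

theorem Config.act_chan_ne (c : Config P Φ A) {i a : Φ} (ha : a ≠ i) (L : LocalState P Φ A)
    (out : Outbox P Φ A) (b : Φ) : (c.act i L out).chan a b = c.chan a b := by
  simp [act, ha]

theorem Config.setChan_chan_self (c : Config P Φ A) (j i : Φ) (l : List (Msg P Φ A)) :
    (c.setChan j i l).chan j i = l := by simp [setChan]

theorem Config.setChan_chan_ne (c : Config P Φ A) {j i a b : Φ} (hab : ¬ (a = j ∧ b = i))
    (l : List (Msg P Φ A)) : (c.setChan j i l).chan a b = c.chan a b := by
  simp [setChan, hab]

@[simp] theorem Config.setChan_loc (c : Config P Φ A) (j i : Φ) (l : List (Msg P Φ A)) :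
    (c.setChan j i l).loc = c.loc := rfl

theorem Config.act_act (c : Config P Φ A) (i : Φ) (L L' : LocalState P Φ A)
    (out out' : Outbox P Φ A) :
    (c.act i L out).act i L' out' = c.act i L' (fun b => out b ++ out' b) := by
  simp only [act, Function.update_idem, mk.injEq, true_and]
  funext a b
  split_ifs <;> simp

/-- The search configuration `V` is the part of the snapshot `id` that has been recorded so far,
completed by the present state of the agents that have not recorded theirs: these agents have the
nodes that they have in `c`, while the nodes and states in transit that belong to the recorded part
are above the recorded bounds. -/
structure Cut (id : Φ × ℕ) (c : Config P Φ A) (V : SearchConfig P Φ A) : Prop where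
  recorded_of_marker : ∀ j k, .marker id ∈ c.chan j k → (c.loc j).snap id ≠ none
  marker_of_recorded : ∀ j k, (c.loc j).snap id ≠ none →
    .marker id ∈ c.chan j k ∨ ∃ r, (c.loc k).snap id = some r ∧ j ∉ r.pending
  recorded_of_done : ∀ j k r, (c.loc k).snap id = some r → j ∉ r.pending →
    (c.loc j).snap id ≠ none
  node_eq : ∀ k, (c.loc k).snap id = none → V.node k = (c.loc k).node
  node_lb : ∀ k r, (c.loc k).snap id = some r → ∀ s n, V.node k s = some n → n.isOpen = true →
    r.lb ≤ n.f
  chan_eq : ∀ j k, (c.loc k).snap id = none → V.chan j k = searchesBefore id (c.chan j k)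
  chan_recorded : ∀ j k r, (c.loc k).snap id = some r → ∃ R : List (Finset P × ℝ≥0 × ℝ≥0∞),
    (∀ m ∈ R, r.lb ≤ (m.2.1 : ℝ≥0∞) + m.2.2) ∧
    V.chan j k = R ++ if j ∈ r.pending then searchesBefore id (c.chan j k) else []

namespace Cut

variable {id : Φ × ℕ} {c : Config P Φ A} {V : SearchConfig P Φ A}

/-- What an agent sends after it has recorded its state is not in the cut. -/
theorem send_recorded (hV : Cut id c V) {k : Φ} (hk : (c.loc k).snap id ≠ none)
    (out : Outbox P Φ A) : Cut id (c.act k (c.loc k) out) V := by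
  have hloc : (c.act k (c.loc k) out).loc = c.loc := by simp [Config.act]
  have hch : ∀ a b, .marker id ∈ c.chan a b → .marker id ∈ (c.act k (c.loc k) out).chan a b := by
    intro a b hm
    by_cases ha : a = k
    · subst ha; rw [Config.act_chan_self]; exact List.mem_append_left _ hm
    · rwa [Config.act_chan_ne _ ha]
  -- If the receiver still records the channel or has not recorded its state, then the sender's
  -- marker is in the channel already, and what is appended comes after it.
  have hbefore : ∀ a b, (∀ r, (c.loc b).snap id = some r → a ∈ r.pending) →
      searchesBefore id ((c.act k (c.loc k) out).chan a b) = searchesBefore id (c.chan a b) := by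
    intro a b hr
    by_cases ha : a = k
    · subst ha
      rw [Config.act_chan_self]
      rcases hV.marker_of_recorded a b hk with h1 | ⟨r, h1, h2⟩
      · exact searchesBefore_append_of_mem h1
      · exact absurd (hr r h1) h2
    · rw [Config.act_chan_ne _ ha]
  constructor
  · intro a b hm
    rw [hloc]
    by_cases ha : a = k
    · rwa [ha]
    · rw [Config.act_chan_ne _ ha] at hm
      exact hV.recorded_of_marker a b hm
  · intro a b ha
    rw [hloc] at ha ⊢
    exact (hV.marker_of_recorded a b ha).imp_left (hch a b)
  · rw [hloc]; exact hV.recorded_of_done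
  · rw [hloc]; exact hV.node_eq
  · rw [hloc]; exact hV.node_lb
  · intro a b hb
    rw [hloc] at hb
    rw [hbefore a b (by simp [hb])]
    exact hV.chan_eq a b hb
  · intro a b r hb
    rw [hloc] at hb
    obtain ⟨R, hR, hc⟩ := hV.chan_recorded a b r hb
    refine ⟨R, hR, ?_⟩
    rw [hc]
    split_ifs with ha
    · rw [hbefore a b (fun r' hr' => by rwa [Option.some.inj (hr'.symm.trans hb)])]
    · rfl

/-- What an agent sends before it records its state is in the cut. -/
theorem send_unrecorded (hV : Cut id c V) {k : Φ} (hk : (c.loc k).snap id = none)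
    (out : Outbox P Φ A) (hout : ∀ b, .marker id ∉ out b) :
    Cut id (c.act k (c.loc k) out) (V.send k fun b => searchesBefore id (out b)) := by
  have hloc : (c.act k (c.loc k) out).loc = c.loc := by simp [Config.act]
  have hmem : ∀ a b, .marker id ∈ (c.act k (c.loc k) out).chan a b ↔ .marker id ∈ c.chan a b := by
    intro a b
    by_cases ha : a = k
    · subst ha; rw [Config.act_chan_self, List.mem_append]; simp [hout b]
    · rw [Config.act_chan_ne _ ha]
  have hkm : ∀ b, .marker id ∉ c.chan k b := fun b hm => hV.recorded_of_marker k b hm hk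
  constructor
  · intro a b hm
    rw [hloc]
    exact hV.recorded_of_marker a b ((hmem a b).1 hm)
  · intro a b ha
    rw [hloc] at ha ⊢
    rw [hmem]
    exact hV.marker_of_recorded a b ha
  · rw [hloc]; exact hV.recorded_of_done
  · rw [hloc]; exact hV.node_eq
  · rw [hloc]; exact hV.node_lb
  · intro a b hb
    rw [hloc] at hb
    by_cases ha : a = k
    · subst ha
      rw [Config.act_chan_self, searchesBefore_append_of_notMem (hkm b), ← hV.chan_eq a b hb]
      simp [SearchConfig.send]
    · rw [Config.act_chan_ne _ ha, ← hV.chan_eq a b hb]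
      simp [SearchConfig.send, ha]
  · intro a b r hb
    rw [hloc] at hb
    obtain ⟨R, hR, hc⟩ := hV.chan_recorded a b r hb
    refine ⟨R, hR, ?_⟩
    by_cases ha : a = k
    · subst ha
      -- The sender has not recorded its state, so its marker cannot have closed this channel yet.
      have hp : a ∈ r.pending := by
        by_contra hp
        exact hV.recorded_of_done a b r hb hp hk
      rw [Config.act_chan_self, searchesBefore_append_of_notMem (hkm b)]
      simp [SearchConfig.send, hc, hp]
    · rw [Config.act_chan_ne _ ha]
      simp [SearchConfig.send, ha, hc]

/-- A recorded agent can change its state as long as its part of the snapshot is unaffected. -/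
theorem local_recorded (hV : Cut id c V) {k : Φ} {L : LocalState P Φ A}
    (hL : L.snap id = (c.loc k).snap id) (hk : (c.loc k).snap id = none → L.node = (c.loc k).node) :
    Cut id (c.act k L fun _ => []) V := by
  have hsnap : ∀ a, ((c.act k L fun _ => []).loc a).snap id = (c.loc a).snap id := by
    intro a
    by_cases ha : a = k
    · subst ha; rw [Config.act_loc_self, hL]
    · rw [Config.act_loc_ne _ ha]
  have hch : (c.act k L fun _ => []).chan = c.chan := by
    funext a b; simp [Config.act]
  constructor
  · simpa only [hsnap, hch] using hV.recorded_of_marker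
  · simpa only [hsnap, hch] using hV.marker_of_recorded
  · simpa only [hsnap, hch] using hV.recorded_of_done
  · intro a ha
    rw [hsnap] at ha
    rw [hV.node_eq a ha]
    by_cases hak : a = k
    · subst hak; rw [Config.act_loc_self, hk ha]
    · rw [Config.act_loc_ne _ hak]
  · simpa only [hsnap, hch] using hV.node_lb
  · simpa only [hsnap, hch] using hV.chan_eq
  · simpa only [hsnap, hch] using hV.chan_recorded

/-- Before recording, an agent is represented in the cut by its present state, so the cut follows
its changes. -/
theorem local_unrecorded (hV : Cut id c V) {k : Φ} {L : LocalState P Φ A}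
    (hL : L.snap id = none) (hk : (c.loc k).snap id = none) :
    Cut id (c.act k L fun _ => []) (V.withNodes k L.node) := by
  have hsnap : ∀ a, ((c.act k L fun _ => []).loc a).snap id = (c.loc a).snap id := by
    intro a
    by_cases ha : a = k
    · subst ha; rw [Config.act_loc_self, hL, hk]
    · rw [Config.act_loc_ne _ ha]
  have hch : (c.act k L fun _ => []).chan = c.chan := by
    funext a b; simp [Config.act]
  constructor
  · simpa only [hsnap, hch] using hV.recorded_of_marker
  · simpa only [hsnap, hch] using hV.marker_of_recorded
  · simpa only [hsnap, hch] using hV.recorded_of_done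
  · intro a ha
    rw [hsnap] at ha
    by_cases hak : a = k
    · subst hak; rw [Config.act_loc_self]; simp
    · rw [Config.act_loc_ne _ hak, ← hV.node_eq a ha]
      simp [SearchConfig.withNodes, hak]
  · intro a r ha
    rw [hsnap] at ha
    have hak : a ≠ k := by
      rintro rfl
      simp [hk] at ha
    simpa [SearchConfig.withNodes, hak] using hV.node_lb a r ha
  · simp only [hsnap, hch]; exact hV.chan_eq
  · simp only [hsnap, hch]; exact hV.chan_recorded

theorem mem_of_mem_setChan {j k : Φ} {m : Msg P Φ A} {rest : List (Msg P Φ A)}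
    (hc : c.chan j k = m :: rest) {m' : Msg P Φ A} {a b : Φ}
    (hm : m' ∈ (c.setChan j k rest).chan a b) : m' ∈ c.chan a b := by
  by_cases hab : a = j ∧ b = k
  · obtain ⟨rfl, rfl⟩ := hab
    rw [Config.setChan_chan_self] at hm
    rw [hc]
    exact List.mem_cons_of_mem _ hm
  · rwa [Config.setChan_chan_ne _ hab] at hm

theorem mem_setChan_of_ne {j k : Φ} {m : Msg P Φ A} {rest : List (Msg P Φ A)}
    (hc : c.chan j k = m :: rest) {m' : Msg P Φ A} (hne : m' ≠ m) {a b : Φ}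
    (hm : m' ∈ c.chan a b) : m' ∈ (c.setChan j k rest).chan a b := by
  by_cases hab : a = j ∧ b = k
  · obtain ⟨rfl, rfl⟩ := hab
    rw [Config.setChan_chan_self]
    rw [hc] at hm
    exact (List.mem_cons.1 hm).resolve_left hne
  · rwa [Config.setChan_chan_ne _ hab]

/-- The arrival of a message that is neither a state nor a marker of the snapshot. -/
theorem consume_inert (hV : Cut id c V) {j k : Φ} {m : Msg P Φ A} {rest : List (Msg P Φ A)}
    (hc : c.chan j k = m :: rest) (hm : m ≠ .marker id)
    (hb : searchesBefore id (m :: rest) = searchesBefore id rest) :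
    Cut id (c.setChan j k rest) V := by
  have hbefore : ∀ a b, searchesBefore id ((c.setChan j k rest).chan a b) =
      searchesBefore id (c.chan a b) := by
    intro a b
    by_cases hab : a = j ∧ b = k
    · obtain ⟨rfl, rfl⟩ := hab
      rw [Config.setChan_chan_self, hc, hb]
    · rw [Config.setChan_chan_ne _ hab]
  constructor
  · exact fun a b hm' => hV.recorded_of_marker a b (mem_of_mem_setChan hc hm')
  · exact fun a b ha => (hV.marker_of_recorded a b ha).imp_left (mem_setChan_of_ne hc hm.symm)
  · exact hV.recorded_of_done
  · exact hV.node_eq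
  · exact hV.node_lb
  · simp only [hbefore]; exact hV.chan_eq
  · simp only [hbefore]; exact hV.chan_recorded

/-- A state arrives at an agent that has not recorded its state. -/
theorem consume_search_unrecorded (hV : Cut id c V) {j k : Φ} {s : Finset P} {g : ℝ≥0} {e : ℝ≥0∞}
    {rest : List (Msg P Φ A)} (hc : c.chan j k = .search s g e :: rest)
    (hk : (c.loc k).snap id = none) :
    Cut id (c.setChan j k rest) (V.setChan j k (searchesBefore id rest)) := by
  constructor
  · exact fun a b hm' => hV.recorded_of_marker a b (mem_of_mem_setChan hc hm')
  · exact fun a b ha => (hV.marker_of_recorded a b ha).imp_left (mem_setChan_of_ne hc (by simp))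
  · exact hV.recorded_of_done
  · exact hV.node_eq
  · exact hV.node_lb
  · intro a b hb
    by_cases hab : a = j ∧ b = k
    · obtain ⟨rfl, rfl⟩ := hab
      simp [Config.setChan, SearchConfig.setChan]
    · rw [Config.setChan_chan_ne _ hab, ← hV.chan_eq a b hb]
      simp [SearchConfig.setChan, hab]
  · intro a b r hb
    have hab : ¬ (a = j ∧ b = k) := by
      rintro ⟨rfl, rfl⟩
      rw [Config.setChan_loc, hk] at hb
      simp at hb
    rw [Config.setChan_chan_ne _ hab]
    simpa [SearchConfig.setChan, hab] using hV.chan_recorded a b r hb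

/-- A state arrives at an agent that has recorded its state. -/
theorem consume_search_recorded (hV : Cut id c V) {j k : Φ} {s : Finset P} {g : ℝ≥0} {e : ℝ≥0∞}
    {rest : List (Msg P Φ A)} (hc : c.chan j k = .search s g e :: rest) {r : Snapshot Φ}
    (hk : (c.loc k).snap id = some r) {L : LocalState P Φ A}
    (hL : L.snap id = some (if j ∈ r.pending then { r with lb := min r.lb ((g : ℝ≥0∞) + e) } else r)) :
    Cut id ((c.setChan j k rest).act k L fun _ => []) V := by
  have hch : ((c.setChan j k rest).act k L fun _ => []).chan = (c.setChan j k rest).chan := by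
    funext a b; simp [Config.act]
  have hr' : ∃ r', L.snap id = some r' ∧ r'.pending = r.pending ∧ r'.lb ≤ r.lb ∧
      (j ∈ r.pending → r'.lb ≤ (g : ℝ≥0∞) + e) := by
    refine ⟨_, hL, ?_⟩
    split_ifs with hj
    · exact ⟨rfl, min_le_left _ _, fun _ => min_le_right _ _⟩
    · exact ⟨rfl, le_rfl, fun h => absurd h hj⟩
  obtain ⟨r', hr', hpend, hlb, hlbj⟩ := hr'
  have hsnap : ∀ a, ((((c.setChan j k rest).act k L fun _ => []).loc a).snap id = none ↔
      (c.loc a).snap id = none) := by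
    intro a
    by_cases ha : a = k
    · subst ha; rw [Config.act_loc_self, hr', hk]; simp
    · rw [Config.act_loc_ne _ ha, Config.setChan_loc]
  have hsome : ∀ a q', (((c.setChan j k rest).act k L fun _ => []).loc a).snap id = some q' →
      (a ≠ k ∧ (c.loc a).snap id = some q') ∨ (a = k ∧ q' = r') := by
    intro a q' ha
    by_cases hak : a = k
    · subst hak
      rw [Config.act_loc_self, hr'] at ha
      exact Or.inr ⟨rfl, (Option.some.inj ha).symm⟩
    · rw [Config.act_loc_ne _ hak] at ha
      exact Or.inl ⟨hak, ha⟩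
  constructor
  · intro a b hm
    rw [hch] at hm
    rw [Ne, hsnap]
    exact hV.recorded_of_marker a b (mem_of_mem_setChan hc hm)
  · intro a b ha
    rw [Ne, hsnap] at ha
    rw [hch]
    rcases hV.marker_of_recorded a b ha with h1 | ⟨q, h1, h2⟩
    · exact Or.inl (mem_setChan_of_ne hc (by simp) h1)
    · right
      by_cases hb : b = k
      · subst hb
        rw [Config.act_loc_self]
        refine ⟨r', hr', ?_⟩
        rw [hpend, Option.some.inj (hk.symm.trans h1)]
        exact h2
      · rw [Config.act_loc_ne _ hb]
        exact ⟨q, h1, h2⟩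
  · intro a b q hq hp
    rw [Ne, hsnap]
    rcases hsome b q hq with ⟨-, h1⟩ | ⟨rfl, rfl⟩
    · exact hV.recorded_of_done a b q h1 hp
    · exact hV.recorded_of_done a b r hk (hpend ▸ hp)
  · intro a ha
    have hak : a ≠ k := by
      rintro rfl
      rw [Config.act_loc_self, hr'] at ha
      simp at ha
    rw [Config.act_loc_ne _ hak] at ha ⊢
    exact hV.node_eq a ha
  · intro a q hq s' n hn ho
    rcases hsome a q hq with ⟨-, h1⟩ | ⟨rfl, rfl⟩
    · exact hV.node_lb a q h1 s' n hn ho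
    · exact hlb.trans (hV.node_lb a r hk s' n hn ho)
  · intro a b hb
    have hbk : b ≠ k := by
      rintro rfl
      rw [Config.act_loc_self, hr'] at hb
      simp at hb
    rw [Config.act_loc_ne _ hbk] at hb
    rw [hch, Config.setChan_chan_ne _ (fun h => hbk h.2)]
    exact hV.chan_eq a b hb
  · intro a b q hq
    rw [hch]
    rcases hsome b q hq with ⟨hbk, h1⟩ | ⟨rfl, rfl⟩
    · rw [Config.setChan_chan_ne _ (fun h => hbk h.2)]
      exact hV.chan_recorded a b q h1
    · obtain ⟨R, hR, hRc⟩ := hV.chan_recorded a b r hk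
      by_cases haj : a = j
      · subst haj
        rw [Config.setChan_chan_self, hpend]
        by_cases hp : a ∈ r.pending
        -- In the cut the state stays in transit: it moves from the part before the marker to the
        -- recorded part `R`, and the bound is lowered to its `f`-value.
        · refine ⟨R ++ [(s, g, e)], fun m hm => ?_, ?_⟩
          · rcases List.mem_append.1 hm with hm | hm
            · exact hlb.trans (hR m hm)
            · rw [List.mem_singleton.1 hm]
              exact hlbj hp
          · rw [hRc, hc]
            simp [hp, searchesBefore]
        · exact ⟨R, fun m hm => hlb.trans (hR m hm), by rw [hRc]; simp [hp]⟩
      · rw [Config.setChan_chan_ne _ (fun h => haj h.1), hpend]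
        exact ⟨R, fun m hm => hlb.trans (hR m hm), hRc⟩

/-- A marker of the snapshot arrives at an agent that has recorded its state. -/
theorem consume_marker (hV : Cut id c V) {j k : Φ} {rest : List (Msg P Φ A)}
    (hc : c.chan j k = .marker id :: rest) {r : Snapshot Φ}
    (hk : (c.loc k).snap id = some r) {L : LocalState P Φ A}
    (hL : L.snap id = some ⟨r.lb, r.pending.erase j⟩) :
    Cut id ((c.setChan j k rest).act k L fun _ => []) V := by
  have hch : ((c.setChan j k rest).act k L fun _ => []).chan = (c.setChan j k rest).chan := by
    funext a b; simp [Config.act]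
  have hsnap : ∀ a, ((((c.setChan j k rest).act k L fun _ => []).loc a).snap id = none ↔
      (c.loc a).snap id = none) := by
    intro a
    by_cases ha : a = k
    · subst ha; rw [Config.act_loc_self, hL, hk]; simp
    · rw [Config.act_loc_ne _ ha, Config.setChan_loc]
  have hsome : ∀ a q', (((c.setChan j k rest).act k L fun _ => []).loc a).snap id = some q' →
      (a ≠ k ∧ (c.loc a).snap id = some q') ∨ (a = k ∧ q' = ⟨r.lb, r.pending.erase j⟩) := by
    intro a q' ha
    by_cases hak : a = k
    · subst hak
      rw [Config.act_loc_self, hL] at ha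
      exact Or.inr ⟨rfl, (Option.some.inj ha).symm⟩
    · rw [Config.act_loc_ne _ hak] at ha
      exact Or.inl ⟨hak, ha⟩
  have hj : (c.loc j).snap id ≠ none := hV.recorded_of_marker j k (by simp [hc])
  constructor
  · intro a b hm
    rw [hch] at hm
    rw [Ne, hsnap]
    exact hV.recorded_of_marker a b (mem_of_mem_setChan hc hm)
  · intro a b ha
    rw [Ne, hsnap] at ha
    rw [hch]
    by_cases hab : a = j ∧ b = k
    · obtain ⟨rfl, rfl⟩ := hab
      right
      rw [Config.act_loc_self]
      exact ⟨_, hL, by simp⟩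
    rw [Config.setChan_chan_ne _ hab]
    rcases hV.marker_of_recorded a b ha with h1 | ⟨q, h1, h2⟩
    · exact Or.inl h1
    · right
      by_cases hb : b = k
      · subst hb
        rw [Config.act_loc_self]
        refine ⟨_, hL, ?_⟩
        rw [Option.some.inj (hk.symm.trans h1)]
        exact fun h => h2 (Finset.mem_of_mem_erase h)
      · rw [Config.act_loc_ne _ hb]
        exact ⟨q, h1, h2⟩
  · intro a b q hq hp
    rw [Ne, hsnap]
    rcases hsome b q hq with ⟨-, h1⟩ | ⟨rfl, rfl⟩
    · exact hV.recorded_of_done a b q h1 hp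
    · by_cases haj : a = j
      · exact haj ▸ hj
      · exact hV.recorded_of_done a b r hk (fun h => hp (Finset.mem_erase.2 ⟨haj, h⟩))
  · intro a ha
    have hak : a ≠ k := by
      rintro rfl
      rw [Config.act_loc_self, hL] at ha
      simp at ha
    rw [Config.act_loc_ne _ hak] at ha ⊢
    exact hV.node_eq a ha
  · intro a q hq s' n hn ho
    rcases hsome a q hq with ⟨-, h1⟩ | ⟨rfl, rfl⟩
    · exact hV.node_lb a q h1 s' n hn ho
    · exact hV.node_lb a r hk s' n hn ho
  · intro a b hb
    have hbk : b ≠ k := by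
      rintro rfl
      rw [Config.act_loc_self, hL] at hb
      simp at hb
    rw [Config.act_loc_ne _ hbk] at hb
    rw [hch, Config.setChan_chan_ne _ (fun h => hbk h.2)]
    exact hV.chan_eq a b hb
  · intro a b q hq
    rw [hch]
    rcases hsome b q hq with ⟨hbk, h1⟩ | ⟨rfl, rfl⟩
    · rw [Config.setChan_chan_ne _ (fun h => hbk h.2)]
      exact hV.chan_recorded a b q h1
    · obtain ⟨R, hR, hRc⟩ := hV.chan_recorded a b r hk
      refine ⟨R, hR, ?_⟩
      by_cases haj : a = j
      -- With the marker at the head nothing precedes it, so ending the recording of this channel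
      -- removes nothing from the cut.
      · subst haj
        rw [hRc, hc]
        simp [searchesBefore]
      · rw [Config.setChan_chan_ne _ (fun h => haj h.1), hRc]
        simp [Finset.mem_erase, haj]

/-- An agent records its state and sends markers. -/
theorem record [Fintype Φ] (hV : Cut id c V) {k : Φ} (hk : (c.loc k).snap id = none)
    {L : LocalState P Φ A} (hL : L.snap id = some ⟨(c.loc k).lowerBound, Finset.univ⟩)
    {out : Outbox P Φ A} (hout : ∀ b, .marker id ∈ out b)
    (hout' : ∀ b, searchesBefore id (out b) = []) : Cut id (c.act k L out) V := by
  have hkm : ∀ b, .marker id ∉ c.chan k b := fun b hm => hV.recorded_of_marker k b hm hk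
  have hbefore : ∀ a b, searchesBefore id ((c.act k L out).chan a b) =
      searchesBefore id (c.chan a b) := by
    intro a b
    by_cases ha : a = k
    · subst ha
      rw [Config.act_chan_self, searchesBefore_append_of_notMem (hkm b), hout', List.append_nil]
    · rw [Config.act_chan_ne _ ha]
  have hsnap : ∀ a, a = k ∨ (c.loc a).snap id ≠ none → ((c.act k L out).loc a).snap id ≠ none := by
    intro a ha
    by_cases hak : a = k
    · subst hak; rw [Config.act_loc_self, hL]; simp
    · rw [Config.act_loc_ne _ hak]; exact ha.resolve_left hak
  have hsome : ∀ a q', ((c.act k L out).loc a).snap id = some q' →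
      (a ≠ k ∧ (c.loc a).snap id = some q') ∨
      (a = k ∧ q' = ⟨(c.loc k).lowerBound, Finset.univ⟩) := by
    intro a q' ha
    by_cases hak : a = k
    · subst hak
      rw [Config.act_loc_self, hL] at ha
      exact Or.inr ⟨rfl, (Option.some.inj ha).symm⟩
    · rw [Config.act_loc_ne _ hak] at ha
      exact Or.inl ⟨hak, ha⟩
  have hnone : ∀ a, ((c.act k L out).loc a).snap id = none →
      (c.act k L out).loc a = c.loc a := by
    intro a ha
    by_cases hak : a = k
    · exact absurd ha (hsnap a (Or.inl hak))
    · rw [Config.act_loc_ne _ hak]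
  constructor
  · intro a b hm
    refine hsnap a ?_
    by_cases ha : a = k
    · exact Or.inl ha
    · rw [Config.act_chan_ne _ ha] at hm
      exact Or.inr (hV.recorded_of_marker a b hm)
  · intro a b ha
    by_cases hak : a = k
    · subst hak
      rw [Config.act_chan_self]
      exact Or.inl (List.mem_append_right _ (hout b))
    · rw [Config.act_loc_ne _ hak] at ha
      rw [Config.act_chan_ne _ hak]
      rcases hV.marker_of_recorded a b ha with h1 | ⟨q, h1, h2⟩
      · exact Or.inl h1
      · have hb : b ≠ k := by
          rintro rfl
          simp [hk] at h1
        rw [Config.act_loc_ne _ hb]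
        exact Or.inr ⟨q, h1, h2⟩
  · intro a b q hq hp
    rcases hsome b q hq with ⟨-, h1⟩ | ⟨rfl, rfl⟩
    · exact hsnap a (Or.inr (hV.recorded_of_done a b q h1 hp))
    · simp at hp
  · intro a ha
    have heq := hnone a ha
    rw [heq] at ha ⊢
    exact hV.node_eq a ha
  · intro a q hq s' n hn ho
    rcases hsome a q hq with ⟨-, h1⟩ | ⟨rfl, rfl⟩
    · exact hV.node_lb a q h1 s' n hn ho
    -- From now on the cut keeps the nodes that the agent has at this moment; the recorded bound is
    -- the minimum over exactly these.
    · rw [hV.node_eq a hk] at hn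
      exact LocalState.lowerBound_le hn ho
  · intro a b hb
    have heq := hnone b hb
    rw [heq] at hb
    rw [hbefore]
    exact hV.chan_eq a b hb
  · intro a b q hq
    rw [hbefore]
    rcases hsome b q hq with ⟨-, h1⟩ | ⟨rfl, rfl⟩
    · exact hV.chan_recorded a b q h1
    -- No channel state has been recorded yet, and all channels are pending.
    · exact ⟨[], by simp, by simpa using hV.chan_eq a b hk⟩

end Cut

variable [Fintype Φ]

/-! ### Messages of the verification and the trace-back -/

theorem searchesBefore_eq_nil {id : Φ × ℕ} {l : List (Msg P Φ A)}
    (hl : ∀ s g e, .search s g e ∉ l) : searchesBefore id l = [] := by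
  induction l with
  | nil => rfl
  | cons m l ih =>
    have hl' : ∀ s g e, .search s g e ∉ l := fun s g e hm => hl s g e (List.mem_cons_of_mem _ hm)
    cases m with
    | search s g e => exact absurd List.mem_cons_self (hl s g e)
    | marker id' => simp [searchesBefore, ih hl']
    | _ => simpa [searchesBefore] using ih hl'

theorem mem_receiveTrace {i : Φ} {s : Finset P} {π : List A} {L : LocalState P Φ A} {b : Φ}
    {m : Msg P Φ A} : m ∈ receiveTrace i s π L b ↔ ∃ n, L.node s = some n ∧
      ((n.origin = .root ∧ m = .terminate π) ∨
      (∃ s' a, n.origin = .action s' a ∧ b = i ∧ m = .trace s' (a :: π)) ∨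
      (∃ j, n.origin = .message j ∧ b = j ∧ m = .trace s π)) := by
  unfold receiveTrace
  cases hs : L.node s with
  | none => simp
  | some n =>
    cases ho : n.origin with
    | root => simp [ho]
    | action s' a =>
      by_cases hb : b = i <;> simp [ho, hb]
    | message j =>
      by_cases hb : b = j <;> simp [ho, hb]
      exact fun h => absurd h.symm hb

theorem receiveReport_local (i j : Φ) (n : ℕ) (lb : ℝ≥0∞) (L : LocalState P Φ A) :
    (receiveReport i j n lb L).1.node = L.node ∧ (receiveReport i j n lb L).1.snap = L.snap ∧
    (receiveReport i j n lb L).1.numVerif = L.numVerif ∧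
    (receiveReport i j n lb L).1.output = L.output ∧
    ∀ k, (receiveReport i j n lb L).1.verif k = if k = n then (L.verif n).map fun v =>
      { v with lb := min v.lb lb, pending := v.pending.erase j } else L.verif k := by
  unfold receiveReport
  split
  · next hv =>
    refine ⟨rfl, rfl, rfl, rfl, fun k => ?_⟩
    split_ifs with hk
    · simp [hk, hv]
    · rfl
  · next v hv =>
    dsimp only
    split_ifs <;> refine ⟨rfl, rfl, rfl, rfl, fun k => ?_⟩ <;> by_cases hk : k = n <;>
      simp [hk, hv]

theorem mem_receiveReport {i j : Φ} {n : ℕ} {lb : ℝ≥0∞} {L : LocalState P Φ A} {b : Φ}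
    {m : Msg P Φ A} : m ∈ (receiveReport i j n lb L).2 b ↔ ∃ v, L.verif n = some v ∧
      v.pending.erase j = ∅ ∧ v.f ≤ min v.lb lb ∧ b = i ∧ m = .trace v.state [] := by
  unfold receiveReport
  split
  · next hv => simp [hv]
  · next v hv =>
    dsimp only
    split_ifs with hc
    · by_cases hb : b = i <;> simp [hv, hb]
      simp [hc.1, le_min_iff.1 hc.2]
    · simp only [List.not_mem_nil, false_iff]
      rintro ⟨v', hv', h1, h2, -⟩
      obtain rfl := Option.some.inj (hv.symm.trans hv')
      exact hc ⟨h1, h2⟩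

theorem receiveReport_accepted {i j : Φ} {n : ℕ} {lb : ℝ≥0∞} {L : LocalState P Φ A} :
    (receiveReport i j n lb L).1.accepted = true ↔ L.accepted = true ∨ ∃ v, L.verif n = some v ∧
      v.pending.erase j = ∅ ∧ v.f ≤ min v.lb lb := by
  unfold receiveReport
  split
  · next hv => simp [hv]
  · next v hv =>
    dsimp only
    split_ifs with hc
    · simp only [true_iff]
      exact Or.inr ⟨v, hv, hc.1, hc.2⟩
    · simp only [iff_self_or]
      rintro ⟨v', hv', h1, h2⟩
      obtain rfl := Option.some.inj (hv.symm.trans hv')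
      exact absurd ⟨h1, h2⟩ hc

/-- Serial numbers that have not been assigned are not in use. -/
structure Config.Fresh (c : Config P Φ A) : Prop where
  snap : ∀ k id, (c.loc k).snap id ≠ none → id.2 < (c.loc id.1).numVerif
  marker : ∀ j k id, .marker id ∈ c.chan j k → id.2 < (c.loc id.1).numVerif
  verif : ∀ i n, (c.loc i).verif n ≠ none ↔ n < (c.loc i).numVerif

/-! ### Operations of the agents and their effect on a cut -/

namespace Cut

variable {id : Φ × ℕ} {c : Config P Φ A} {V : SearchConfig P Φ A}

theorem act_recorded (hV : Cut id c V) {k : Φ} (hk : (c.loc k).snap id ≠ none)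
    {L : LocalState P Φ A} (hL : L.snap id = (c.loc k).snap id) (out : Outbox P Φ A) :
    Cut id (c.act k L out) V := by
  have h1 := hV.local_recorded hL (fun h => absurd h hk)
  have h2 := h1.send_recorded (k := k) (by rwa [Config.act_loc_self, hL]) out
  rw [Config.act_loc_self, Config.act_act] at h2
  simpa using h2

theorem act_unrecorded (hV : Cut id c V) {k : Φ} (hk : (c.loc k).snap id = none)
    {L : LocalState P Φ A} (hL : L.snap id = none) {out : Outbox P Φ A}
    (hout : ∀ b, .marker id ∉ out b) :
    Cut id (c.act k L out)
      ((V.withNodes k L.node).send k fun b => searchesBefore id (out b)) := by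
  have h1 := hV.local_unrecorded hL hk
  have h2 := h1.send_unrecorded (k := k) (by rwa [Config.act_loc_self]) out hout
  rw [Config.act_loc_self, Config.act_act] at h2
  simpa using h2

theorem act_inert (hV : Cut id c V) {k : Φ} {L : LocalState P Φ A}
    (hL : L.snap id = (c.loc k).snap id) (hn : L.node = (c.loc k).node) {out : Outbox P Φ A}
    (hout : ∀ b, .marker id ∉ out b) (hout' : ∀ b, searchesBefore id (out b) = []) :
    Cut id (c.act k L out) V := by
  by_cases hk : (c.loc k).snap id = none
  · have h1 := hV.act_unrecorded hk (hL.trans hk) hout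
    rw [SearchConfig.withNodes_self (by rw [hV.node_eq k hk, hn])] at h1
    have h2 : (V.send k fun b => searchesBefore id (out b)) = V := by
      simp [SearchConfig.send, hout']
    rwa [h2] at h1
  · exact hV.act_recorded hk hL out

variable {Q : Problem P Φ A} {h : Φ → Finset P → ℝ≥0∞}

open Relation (ReflTransGen)

theorem expandGoal (hV : Cut id c V) (hfresh : c.Fresh) {i : Φ} {s : Finset P} {n : Node P Φ A}
    (hn : (c.loc i).node s = some n) (hgoal : Q.goal ⊆ s) :
    ∃ V', ReflTransGen (SearchStep Q h) V V' ∧ Cut id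
      (c.act i (expandGoalState i s n (c.loc i)) (expandGoalOut i s n (c.loc i))) V' := by
  by_cases hid : id = (i, (c.loc i).numVerif)
  · have hk : (c.loc i).snap id = none := by
      by_contra hne
      have := hfresh.snap i id hne
      simp [hid] at this
    -- The atomic operation is split at the moment of recording: closing and sending `s` happen
    -- inside the cut, the markers follow. The order of the two messages in the channels makes both
    -- views agree.
    have h1 := hV.act_unrecorded (L := (c.loc i).setNode s { n with isOpen := false })
      (out := fun _ => [.search s n.g n.h]) hk hk (by simp)
    refine ⟨_, steps_closeGoal (hV.node_eq i hk) hn hgoal, ?_⟩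
    have h2 := h1.record (k := i) (by rw [Config.act_loc_self]; exact hk)
      (L := expandGoalState i s n (c.loc i)) (by
        rw [Config.act_loc_self]
        simp [expandGoalState, hid]) (out := fun _ => [.marker id]) (by simp)
      (by simp [searchesBefore])
    rw [Config.act_act] at h2
    have h3 : expandGoalOut i s n (c.loc i) =
        fun _ => [Msg.search s n.g n.h] ++ [Msg.marker id] := by
      rw [hid]; rfl
    rw [h3]
    exact h2
  · have hL : (expandGoalState i s n (c.loc i)).snap id = (c.loc i).snap id := by
      simp [expandGoalState, LocalState.setNode, hid]
    by_cases hk : (c.loc i).snap id = none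
    · refine ⟨_, steps_closeGoal (hV.node_eq i hk) hn hgoal, ?_⟩
      have h1 := hV.act_unrecorded hk (hL.trans hk) (out := expandGoalOut i s n (c.loc i))
        (by simp [expandGoalOut, hid])
      have h2 : (fun b => searchesBefore id (expandGoalOut i s n (c.loc i) b)) =
          fun _ => [(s, n.g, n.h)] := by
        funext b
        simp [expandGoalOut, searchesBefore]
      rw [h2] at h1
      exact h1
    · exact ⟨V, .refl, hV.act_recorded hk hL _⟩

theorem expandNonGoal (hV : Cut id c V) {i : Φ} {s : Finset P} {n : Node P Φ A} {acts : List A}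
    (hn : (c.loc i).node s = some n) (hgoal : ¬ Q.goal ⊆ s)
    (hacts : ∀ a, a ∈ acts ↔ Q.owner a = i ∧ Q.pre a ⊆ s) :
    ∃ V', ReflTransGen (SearchStep Q h) V V' ∧ Cut id
      (c.act i (expandState Q (h i) s n acts (c.loc i)) (expandOut Q s n)) V' := by
  have hL : (expandState Q (h i) s n acts (c.loc i)).snap id = (c.loc i).snap id := by
    rw [(sameProtocol_expandState Q (h i) s n acts (c.loc i)).snap]
  have hout : ∀ b, Msg.marker id ∉ expandOut Q s n b := by
    intro b
    unfold expandOut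
    split_ifs <;> simp
  by_cases hk : (c.loc i).snap id = none
  · refine ⟨_, steps_expandState (hV.node_eq i hk) hn hgoal hacts, ?_⟩
    have h1 := hV.act_unrecorded hk (hL.trans hk) hout
    simp only [searchesBefore_eq_searches (hout _)] at h1
    exact h1
  · exact ⟨V, .refl, hV.act_recorded hk hL _⟩

theorem receiveSearch (hV : Cut id c V) {i j : Φ} {s : Finset P} {g : ℝ≥0} {e : ℝ≥0∞}
    {rest : List (Msg P Φ A)} (hm : c.chan j i = .search s g e :: rest) :
    ∃ V', ReflTransGen (SearchStep Q h) V V' ∧ Cut id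
      ((c.setChan j i rest).act i (processSearch Q (h i) j s g e
        ((c.loc i).recordArrival j ((g : ℝ≥0∞) + e))) fun _ => []) V' := by
  have hproc := sameProtocol_processSearch Q (h i) j s g e
    ((c.loc i).recordArrival j ((g : ℝ≥0∞) + e))
  by_cases hk : (c.loc i).snap id = none
  · have hc : V.chan j i = (s, g, e) :: searchesBefore id rest := by
      rw [hV.chan_eq j i hk, hm]; rfl
    refine ⟨_, steps_processSearch (L := (c.loc i).recordArrival j ((g : ℝ≥0∞) + e))
      (hV.node_eq i hk) hc, ?_⟩
    exact (hV.consume_search_unrecorded hm hk).local_unrecorded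
      (by rw [hproc.snap]; simp [LocalState.recordArrival, hk]) hk
  · obtain ⟨r, hr⟩ := Option.ne_none_iff_exists'.1 hk
    exact ⟨V, .refl, hV.consume_search_recorded hm hr
      (by rw [hproc.snap]; simp [LocalState.recordArrival, hr])⟩

theorem receiveMarker (hV : Cut id c V) {i j : Φ} {id' : Φ × ℕ} {rest : List (Msg P Φ A)}
    (hm : c.chan j i = .marker id' :: rest) :
    Cut id ((c.setChan j i rest).act i (receiveMarker j id' (c.loc i)).1
      (receiveMarker j id' (c.loc i)).2) V := by
  by_cases hid : id' = id
  · subst hid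
    by_cases hk : (c.loc i).snap id' = none
    · have hji : j ≠ i := by
        rintro rfl
        exact hV.recorded_of_marker j j (by simp [hm]) hk
      -- An intermediate state: first record with all channels pending and send, then consume the
      -- marker from `j`. Since `j ≠ i`, the sending does not affect the channel on which the marker
      -- arrives.
      let L₁ : LocalState P Φ A := { c.loc i with
        snap := Function.update (c.loc i).snap id' (some ⟨(c.loc i).lowerBound, Finset.univ⟩) }
      have h1 := hV.record hk (L := L₁) (by simp [L₁])
        (out := (MADAStar.receiveMarker j id' (c.loc i)).2)
        (by intro b; simp [MADAStar.receiveMarker, hk])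
        (by intro b; simp [MADAStar.receiveMarker, hk, searchesBefore])
      have h2 := h1.consume_marker (j := j) (k := i) (rest := rest)
        (by rw [Config.act_chan_ne _ hji, hm]) (r := ⟨(c.loc i).lowerBound, Finset.univ⟩)
        (by rw [Config.act_loc_self]; simp [L₁])
        (L := (MADAStar.receiveMarker j id' (c.loc i)).1)
        (by simp [MADAStar.receiveMarker, hk])
      have heq : (((c.act i L₁ (MADAStar.receiveMarker j id' (c.loc i)).2).setChan j i rest).act i
          (MADAStar.receiveMarker j id' (c.loc i)).1 fun _ => []) =
          (c.setChan j i rest).act i (MADAStar.receiveMarker j id' (c.loc i)).1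
            (MADAStar.receiveMarker j id' (c.loc i)).2 := by
        simp only [Config.act, Config.setChan, Function.update_idem, List.append_nil, ite_self,
          Config.mk.injEq, true_and]
        funext a b
        by_cases ha : a = i
        · have : a ≠ j := fun h => hji (h.symm.trans ha)
          simp [ha, hji.symm]
        · simp [ha]
      rwa [heq] at h2
    · obtain ⟨r, hr⟩ := Option.ne_none_iff_exists'.1 hk
      have h1 := hV.consume_marker hm hr (L := (MADAStar.receiveMarker j id' (c.loc i)).1)
        (by simp [MADAStar.receiveMarker, hr])
      have h2 := h1.send_recorded (k := i)
        (by rw [Config.act_loc_self]; simp [MADAStar.receiveMarker])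
        (MADAStar.receiveMarker j id' (c.loc i)).2
      rw [Config.act_loc_self, Config.act_act] at h2
      simpa using h2
  · refine (hV.consume_inert hm (by simpa using hid) (by simp [searchesBefore, hid])).act_inert
      (k := i) (L := (MADAStar.receiveMarker j id' (c.loc i)).1) ?_ rfl (fun b => ?_)
      (fun b => ?_)
    · simp [MADAStar.receiveMarker, Ne.symm hid]
    · simp only [MADAStar.receiveMarker, List.mem_append, not_or]
      constructor <;> split_ifs <;> simp [Ne.symm hid]
    · simp only [MADAStar.receiveMarker]
      split_ifs <;> simp [searchesBefore, hid]

/-- Operations of agents that have not recorded their state are carried out in the cut as well;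
those of the others leave it unchanged. So the cut remains reachable by the search alone and
inherits its invariants. -/
theorem step (hV : Cut id c V) (hfresh : c.Fresh) {e : Event Φ} {c' : Config P Φ A}
    (hst : Step Q h e c c') :
    ∃ V', ReflTransGen (SearchStep Q h) V V' ∧ Cut id c' V' := by
  cases hst with
  | expandGoal _ i s n hrun hacc hmin hgoal => exact hV.expandGoal hfresh hmin.1 hgoal
  | expandNonGoal _ i s n acts hrun hacc hmin hgoal hnodup hacts =>
    exact hV.expandNonGoal hmin.1 hgoal hacts
  | receive _ i j m rest hrun hm =>
    cases m with
    | search s g e => exact hV.receiveSearch hm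
    | marker id' => exact ⟨V, .refl, hV.receiveMarker hm⟩
    | report n lb =>
      obtain ⟨h1, h2, -⟩ := receiveReport_local i j n lb (c.loc i)
      refine ⟨V, .refl, (hV.consume_inert hm (by simp) rfl).act_inert (congrFun h2 id) h1
        (fun b hb => ?_) (fun b => searchesBefore_eq_nil fun s g e hb => ?_)⟩
      · obtain ⟨v, -, -, -, -, h⟩ := mem_receiveReport.1 hb
        cases h
      · obtain ⟨v, -, -, -, -, h⟩ := mem_receiveReport.1 hb
        cases h
    | trace s π =>
      refine ⟨V, .refl, (hV.consume_inert hm (by simp) rfl).act_inert rfl rfl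
        (fun b hb => ?_) (fun b => searchesBefore_eq_nil fun s g e hb => ?_)⟩
      · obtain ⟨n, -, ⟨-, h⟩ | ⟨_, _, -, -, h⟩ | ⟨_, -, -, h⟩⟩ := mem_receiveTrace.1 hb <;> cases h
      · obtain ⟨n, -, ⟨-, h⟩ | ⟨_, _, -, -, h⟩ | ⟨_, -, -, h⟩⟩ := mem_receiveTrace.1 hb <;> cases h
    | terminate π =>
      exact ⟨V, .refl, (hV.consume_inert hm (by simp) rfl).act_inert (k := i)
        (L := { c.loc i with output := some π }) (out := fun _ => []) rfl rfl (by simp)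
        (by simp [searchesBefore])⟩

/-- If all agents have completed their parts of a snapshot, then every lower bound of their reports
is a lower bound of the cost of the solutions. -/
theorem le_hStar [Finite A] [Nonempty Φ] (hV : Cut id c V) (hinv : V.Inv Q)
    (hsol : ∃ π, Q.IsPlan π) {x : ℝ≥0∞}
    (hx : ∀ k, ∃ r, (c.loc k).snap id = some r ∧ r.pending = ∅ ∧ x ≤ r.lb) :
    x ≤ Q.hStar Q.init := by
  rcases hinv.hasFrontier hsol with ⟨k, s, n, hn, ho, hle⟩ | ⟨j, k, s, g, e, hm, hle⟩
  · obtain ⟨r, hr, -, hxr⟩ := hx k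
    exact (hxr.trans (hV.node_lb k r hr s n hn ho)).trans hle
  · obtain ⟨r, hr, hp, hxr⟩ := hx k
    obtain ⟨R, hR, hRc⟩ := hV.chan_recorded j k r hr
    rw [hRc, hp] at hm
    exact (hxr.trans (hR _ (by simpa using hm))).trans hle

end Cut

/-! ### The effects of an operation -/

/-- Agent `k` moves to the local state `L` and sends `out`. -/
inductive LocalOp (Q : Problem P Φ A) (h : Φ → Finset P → ℝ≥0∞) (c : Config P Φ A) (k : Φ) :
    LocalState P Φ A → Outbox P Φ A → Prop
  | expandGoal (s : Finset P) (n : Node P Φ A) (hacc : (c.loc k).accepted = false)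
      (hmin : (c.loc k).IsMin s n) (hgoal : Q.goal ⊆ s) :
      LocalOp Q h c k (expandGoalState k s n (c.loc k)) (expandGoalOut k s n (c.loc k))
  | expandNonGoal (s : Finset P) (n : Node P Φ A) (acts : List A)
      (hacc : (c.loc k).accepted = false)
      (hmin : (c.loc k).IsMin s n) (hgoal : ¬ Q.goal ⊆ s) :
      LocalOp Q h c k (expandState Q (h k) s n acts (c.loc k)) (expandOut Q s n)
  | receive (j : Φ) (m : Msg P Φ A) (hm : m ∈ c.chan j k) :
      LocalOp Q h c k (receive Q (h k) k j (c.loc k) m).1 (receive Q (h k) k j (c.loc k) m).2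

/-- The transition from `c` to `c'` consists of the operation of agent `k` that leads to the local
state `L` and sends `out`. -/
structure Transition (Q : Problem P Φ A) (h : Φ → Finset P → ℝ≥0∞) (c c' : Config P Φ A) (k : Φ)
    (L : LocalState P Φ A) (out : Outbox P Φ A) : Prop where
  op : LocalOp Q h c k L out
  running : (c.loc k).output = none
  loc_self : c'.loc k = L
  loc_ne : ∀ a, a ≠ k → c'.loc a = c.loc a
  mem_chan : ∀ a b m, m ∈ c'.chan a b → m ∈ c.chan a b ∨ a = k ∧ m ∈ out b
  mem_out : ∀ b m, m ∈ out b → m ∈ c'.chan k b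
  kept : ∀ a b m, m ∈ c.chan a b → m ∈ c'.chan a b ∨ (b = k ∧
    L = (receive Q (h k) k a (c.loc k) m).1 ∧ out = (receive Q (h k) k a (c.loc k) m).2)

section Transitions

variable {Q : Problem P Φ A} {h : Φ → Finset P → ℝ≥0∞} {c c' : Config P Φ A} {e : Event Φ}

theorem Config.mem_act_chan {k : Φ} {L : LocalState P Φ A} {out : Outbox P Φ A} {a b : Φ}
    {m : Msg P Φ A} :
    m ∈ (c.act k L out).chan a b ↔ m ∈ c.chan a b ∨ a = k ∧ m ∈ out b := by
  by_cases ha : a = k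
  · subst ha
    simp [Config.act_chan_self]
  · simp [Config.act_chan_ne _ ha, ha]

/-- The order of messages matters for the cuts and for delivery. The other invariants of the
protocol need only membership in channels, which `Transition` retains. -/
theorem Step.transition (hst : Step Q h e c c') : ∃ k L out, Transition Q h c c' k L out := by
  cases hst with
  | expandGoal _ i s n hrun hacc hmin hgoal =>
    exact ⟨i, _, _, .expandGoal s n hacc hmin hgoal, hrun, Config.act_loc_self .., fun a ha =>
      Config.act_loc_ne _ ha .., fun a b m => Config.mem_act_chan.1,
      fun b m hm => Config.mem_act_chan.2 (Or.inr ⟨rfl, hm⟩),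
      fun a b m hm => Or.inl (Config.mem_act_chan.2 (Or.inl hm))⟩
  | expandNonGoal _ i s n acts hrun hacc hmin hgoal hnodup hacts =>
    exact ⟨i, _, _, .expandNonGoal s n acts hacc hmin hgoal, hrun, Config.act_loc_self ..,
      fun a ha => Config.act_loc_ne _ ha .., fun a b m => Config.mem_act_chan.1,
      fun b m hm => Config.mem_act_chan.2 (Or.inr ⟨rfl, hm⟩),
      fun a b m hm => Or.inl (Config.mem_act_chan.2 (Or.inl hm))⟩
  | receive _ i j m rest hrun hm =>
    refine ⟨i, _, _, .receive j m (by simp [hm]), hrun, Config.act_loc_self .., fun a ha =>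
      Config.act_loc_ne _ ha .., fun a b m' hm' => ?_,
      fun b m hm => Config.mem_act_chan.2 (Or.inr ⟨rfl, hm⟩), fun a b m' hm' => ?_⟩
    · exact (Config.mem_act_chan.1 hm').imp_left (Cut.mem_of_mem_setChan hm)
    · by_cases hab : a = j ∧ b = i
      · obtain ⟨rfl, rfl⟩ := hab
        rw [hm] at hm'
        rcases List.mem_cons.1 hm' with rfl | hm'
        · exact Or.inr ⟨rfl, rfl, rfl⟩
        · refine Or.inl (Config.mem_act_chan.2 (Or.inl ?_))
          rwa [Config.setChan_chan_self]
      · refine Or.inl (Config.mem_act_chan.2 (Or.inl ?_))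
        rwa [Config.setChan_chan_ne _ hab]

theorem Transition.snap_cases {k : Φ} {L : LocalState P Φ A} {out : Outbox P Φ A}
    (ht : Transition Q h c c' k L out) {a : Φ} {id : Φ × ℕ} {r' : Snapshot Φ}
    (hr' : (c'.loc a).snap id = some r') :
    (c.loc a).snap id = some r' ∨
    (∃ (r : Snapshot Φ) (j : Φ) (s : Finset P) (g : ℝ≥0) (e : ℝ≥0∞),
      (c.loc a).snap id = some r ∧ .search s g e ∈ c.chan j a ∧ j ∈ r.pending ∧
      r' = { r with lb := min r.lb ((g : ℝ≥0∞) + e) }) ∨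
    (∃ j, .marker id ∈ c.chan j a ∧
      (((c.loc a).snap id = none ∧ r' = ⟨(c.loc a).lowerBound, Finset.univ.erase j⟩) ∨
        ∃ r, (c.loc a).snap id = some r ∧ r' = ⟨r.lb, r.pending.erase j⟩) ∧
      (r'.pending = ∅ → .report id.2 r'.lb ∈ c'.chan a id.1)) ∨
    (id = (a, (c.loc a).numVerif) ∧ ∃ s n, (c.loc a).IsMin s n ∧ Q.goal ⊆ s ∧
      c'.loc a = expandGoalState a s n (c.loc a) ∧
      r' = ⟨((c.loc a).setNode s { n with isOpen := false }).lowerBound, Finset.univ⟩) := by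
  by_cases ha : a = k
  swap
  · rw [ht.loc_ne a ha] at hr'
    exact Or.inl hr'
  subst ha
  rw [ht.loc_self] at hr'
  have hself := ht.loc_self
  have hout := ht.mem_out
  cases ht.op with
  | expandGoal s n hacc hmin hgoal =>
    by_cases hid : id = (a, (c.loc a).numVerif)
    · subst hid
      simp only [expandGoalState, Function.update_self, Option.some.injEq] at hr'
      exact Or.inr (Or.inr (Or.inr ⟨rfl, s, n, hmin, hgoal, hself, hr'.symm⟩))
    · left
      simpa [expandGoalState, LocalState.setNode, hid] using hr'
  | expandNonGoal s n acts hacc hmin hgoal =>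
    rw [(sameProtocol_expandState ..).snap] at hr'
    exact Or.inl hr'
  | receive j m hm =>
    cases m with
    | search s g e =>
      simp only [receive, (sameProtocol_processSearch ..).snap, LocalState.recordArrival,
        Option.map_eq_some_iff] at hr'
      obtain ⟨r, hr, heq⟩ := hr'
      split_ifs at heq with hj
      · exact Or.inr (Or.inl ⟨r, j, s, g, e, hr, hm, hj, heq.symm⟩)
      · exact Or.inl (heq ▸ hr)
    | marker id' =>
      by_cases hid : id = id'
      · subst hid
        refine Or.inr (Or.inr (Or.inl ⟨j, hm, ?_, ?_⟩))
        · cases hs : (c.loc a).snap id with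
          | none =>
            left
            simp only [receive, receiveMarker, hs, Function.update_self,
              Option.some.injEq] at hr'
            exact ⟨rfl, hr'.symm⟩
          | some r =>
            right
            simp only [receive, receiveMarker, hs, Function.update_self,
              Option.some.injEq] at hr'
            exact ⟨r, rfl, hr'.symm⟩
        · intro hp
          refine hout _ _ ?_
          simp only [receive, receiveMarker, Function.update_self, Option.some.injEq] at hr' ⊢
          rw [hr']
          simp [hp]
      · left
        simpa [receive, receiveMarker, hid] using hr'
    | report n lb =>
      simp only [receive, (receiveReport_local ..).2.1] at hr'
      exact Or.inl hr'
    | trace s π => exact Or.inl hr'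
    | terminate π => exact Or.inl hr'

theorem Transition.verif_cases {k : Φ} {L : LocalState P Φ A} {out : Outbox P Φ A}
    (ht : Transition Q h c c' k L out) {a : Φ} {n : ℕ} {v' : Verification P Φ}
    (hv' : (c'.loc a).verif n = some v') :
    (c.loc a).verif n = some v' ∨
    (n = (c.loc a).numVerif ∧ ∃ s nd, (c.loc a).IsMin s nd ∧ Q.goal ⊆ s ∧
      c'.loc a = expandGoalState a s nd (c.loc a) ∧ v' = ⟨s, nd.f, ⊤, Finset.univ⟩) ∨
    ∃ j lb v, .report n lb ∈ c.chan j a ∧ (c.loc a).verif n = some v ∧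
      v' = { v with lb := min v.lb lb, pending := v.pending.erase j } ∧
      (v'.pending = ∅ → v'.f ≤ v'.lb → (c'.loc a).accepted = true) := by
  by_cases ha : a = k
  swap
  · rw [ht.loc_ne a ha] at hv'
    exact Or.inl hv'
  subst ha
  have hself := ht.loc_self
  rw [ht.loc_self] at hv' ⊢
  cases ht.op with
  | expandGoal s nd hacc hmin hgoal =>
    by_cases hn : n = (c.loc a).numVerif
    · subst hn
      simp only [expandGoalState, Function.update_self, Option.some.injEq] at hv'
      exact Or.inr (Or.inl ⟨rfl, s, nd, hmin, hgoal, rfl, hv'.symm⟩)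
    · left
      simpa [expandGoalState, LocalState.setNode, hn] using hv'
  | expandNonGoal s n acts hacc hmin hgoal =>
    rw [(sameProtocol_expandState ..).verif] at hv'
    exact Or.inl hv'
  | receive j m hm =>
    cases m with
    | search s g e =>
      simp only [receive, (sameProtocol_processSearch ..).verif, LocalState.recordArrival] at hv'
      exact Or.inl hv'
    | marker id' => exact Or.inl hv'
    | report n₀ lb =>
      simp only [receive, (receiveReport_local ..).2.2.2.2] at hv' ⊢
      split_ifs at hv' with hn
      · subst hn
        obtain ⟨v, hv, heq⟩ := Option.map_eq_some_iff.1 hv'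
        refine Or.inr (Or.inr ⟨j, lb, v, hm, hv, heq.symm, fun h1 h2 => ?_⟩)
        rw [receiveReport_accepted]
        rw [← heq] at h1 h2
        exact Or.inr ⟨v, hv, h1, h2⟩
      · exact Or.inl hv'
    | trace s π => exact Or.inl hv'
    | terminate π => exact Or.inl hv'

theorem Transition.numVerif_le {k : Φ} {L : LocalState P Φ A} {out : Outbox P Φ A}
    (ht : Transition Q h c c' k L out) (a : Φ) : (c.loc a).numVerif ≤ (c'.loc a).numVerif := by
  by_cases ha : a = k
  swap
  · rw [ht.loc_ne a ha]
  subst ha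
  rw [ht.loc_self]
  cases ht.op with
  | expandGoal s nd hacc hmin hgoal => simp [expandGoalState]
  | expandNonGoal s n acts hacc hmin hgoal => rw [(sameProtocol_expandState ..).numVerif]
  | receive j m hm =>
    cases m with
    | search s g e =>
      simp [receive, (sameProtocol_processSearch ..).numVerif, LocalState.recordArrival]
    | report n lb => simp [receive, (receiveReport_local ..).2.2.1]
    | _ => exact le_rfl

theorem Transition.accepted_mono {k : Φ} {L : LocalState P Φ A} {out : Outbox P Φ A}
    (ht : Transition Q h c c' k L out) {a : Φ} (ha : (c.loc a).accepted = true) :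
    (c'.loc a).accepted = true := by
  by_cases hk : a = k
  swap
  · rwa [ht.loc_ne a hk]
  subst hk
  rw [ht.loc_self]
  cases ht.op with
  | expandGoal s nd hacc hmin hgoal => simp [hacc] at ha
  | expandNonGoal s n acts hacc hmin hgoal => simp [hacc] at ha
  | receive j m hm =>
    cases m with
    | search s g e =>
      simpa [receive, (sameProtocol_processSearch ..).accepted, LocalState.recordArrival] using ha
    | report n lb => exact receiveReport_accepted.2 (Or.inl ha)
    | _ => exact ha

/-- The operation that sets the flag also starts a trace-back. Without a broadcast this will exclude
that any agent stops expanding. -/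
theorem Transition.accepted_cases {k : Φ} {L : LocalState P Φ A} {out : Outbox P Φ A}
    (ht : Transition Q h c c' k L out) {a : Φ} (ha : (c'.loc a).accepted = true) :
    (c.loc a).accepted = true ∨ ∃ s, .trace s [] ∈ c'.chan a a := by
  by_cases hk : a = k
  swap
  · rw [ht.loc_ne a hk] at ha
    exact Or.inl ha
  subst hk
  rw [ht.loc_self] at ha
  have hout := ht.mem_out
  cases ht.op with
  | expandGoal s nd hacc hmin hgoal => exact Or.inl ha
  | expandNonGoal s n acts hacc hmin hgoal =>
    rw [(sameProtocol_expandState ..).accepted] at ha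
    exact Or.inl ha
  | receive j m hm =>
    cases m with
    | search s g e =>
      simp only [receive, (sameProtocol_processSearch ..).accepted,
        LocalState.recordArrival] at ha
      exact Or.inl ha
    | report n lb =>
      refine (receiveReport_accepted.1 ha).imp_right fun ⟨v, h1, h2, h3⟩ => ?_
      exact ⟨v.state, hout _ _ (mem_receiveReport.2 ⟨v, h1, h2, h3, rfl, rfl⟩)⟩
    | _ => exact Or.inl ha

theorem Transition.output_cases {k : Φ} {L : LocalState P Φ A} {out : Outbox P Φ A}
    (ht : Transition Q h c c' k L out) {a : Φ} {π : List A}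
    (ha : (c'.loc a).output = some π) :
    (c.loc a).output = some π ∨ ∃ j, .terminate π ∈ c.chan j a := by
  by_cases hk : a = k
  swap
  · rw [ht.loc_ne a hk] at ha
    exact Or.inl ha
  subst hk
  rw [ht.loc_self] at ha
  cases ht.op with
  | expandGoal s nd hacc hmin hgoal => exact Or.inl ha
  | expandNonGoal s n acts hacc hmin hgoal =>
    rw [(sameProtocol_expandState ..).output] at ha
    exact Or.inl ha
  | receive j m hm =>
    cases m with
    | search s g e =>
      simp only [receive, (sameProtocol_processSearch ..).output, LocalState.recordArrival] at ha
      exact Or.inl ha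
    | report n lb =>
      simp only [receive, (receiveReport_local ..).2.2.2.1] at ha
      exact Or.inl ha
    | terminate π' =>
      simp only [receive, Option.some.injEq] at ha
      exact Or.inr ⟨j, ha ▸ hm⟩
    | _ => exact Or.inl ha

theorem Transition.output_stable {k : Φ} {L : LocalState P Φ A} {out : Outbox P Φ A}
    (ht : Transition Q h c c' k L out) {a : Φ} {π : List A}
    (ha : (c.loc a).output = some π) : (c'.loc a).output = some π := by
  rw [ht.loc_ne a, ha]
  rintro rfl
  simp [ht.running] at ha

theorem Transition.trace_cases {k : Φ} {L : LocalState P Φ A} {out : Outbox P Φ A}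
    (ht : Transition Q h c c' k L out) {a b : Φ} {s : Finset P} {π : List A}
    (hm : .trace s π ∈ c'.chan a b) :
    .trace s π ∈ c.chan a b ∨
    (∃ v n j lb, .report n lb ∈ c.chan j a ∧ b = a ∧ (c.loc a).verif n = some v ∧
      v.pending.erase j = ∅ ∧ v.f ≤ min v.lb lb ∧ s = v.state ∧ π = []) ∨
    ∃ s₀ π₀ j nd, .trace s₀ π₀ ∈ c.chan j a ∧ (c.loc a).node s₀ = some nd ∧
      ((∃ x, nd.origin = .action s x ∧ b = a ∧ π = x :: π₀) ∨
        (nd.origin = .message b ∧ s = s₀ ∧ π = π₀)) := by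
  rcases ht.mem_chan a b _ hm with hm | ⟨rfl, hm⟩
  · exact Or.inl hm
  right
  cases ht.op with
  | expandGoal s nd hacc hmin hgoal => simp [expandGoalOut] at hm
  | expandNonGoal s n acts hacc hmin hgoal =>
    unfold expandOut at hm
    split_ifs at hm <;> simp at hm
  | receive j m hmm =>
    cases m with
    | search s g e => simp [receive] at hm
    | marker id =>
      simp only [receive, receiveMarker, List.mem_append] at hm
      rcases hm with hm | hm <;> split_ifs at hm <;> simp at hm
    | report n lb =>
      obtain ⟨v, h1, h2, h3, h4, h5⟩ := mem_receiveReport.1 hm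
      simp only [Msg.trace.injEq] at h5
      exact Or.inl ⟨v, n, j, lb, hmm, h4, h1, h2, h3, h5⟩
    | trace s₀ π₀ =>
      right
      obtain ⟨nd, hnd, ⟨-, h⟩ | ⟨s', x, h1, h2, h3⟩ | ⟨j', h1, h2, h3⟩⟩ := mem_receiveTrace.1 hm
      · cases h
      · simp only [Msg.trace.injEq] at h3
        obtain ⟨rfl, rfl⟩ := h3
        exact ⟨s₀, π₀, j, nd, hmm, hnd, Or.inl ⟨x, h1, h2, rfl⟩⟩
      · simp only [Msg.trace.injEq] at h3
        exact ⟨s₀, π₀, j, nd, hmm, hnd, Or.inr ⟨h2 ▸ h1, h3⟩⟩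
    | terminate π' => simp [receive] at hm

theorem Transition.terminate_cases {k : Φ} {L : LocalState P Φ A} {out : Outbox P Φ A}
    (ht : Transition Q h c c' k L out) {a b : Φ} {π : List A}
    (hm : .terminate π ∈ c'.chan a b) :
    .terminate π ∈ c.chan a b ∨ ∃ s j nd, .trace s π ∈ c.chan j a ∧ (c.loc a).node s = some nd ∧
      nd.origin = .root ∧ ∀ b, .terminate π ∈ c'.chan a b := by
  rcases ht.mem_chan a b _ hm with hm | ⟨rfl, hm⟩
  · exact Or.inl hm
  right
  have hout := ht.mem_out
  cases ht.op with
  | expandGoal s nd hacc hmin hgoal => simp [expandGoalOut] at hm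
  | expandNonGoal s n acts hacc hmin hgoal =>
    unfold expandOut at hm
    split_ifs at hm <;> simp at hm
  | receive j m hmm =>
    cases m with
    | search s g e => simp [receive] at hm
    | marker id =>
      simp only [receive, receiveMarker, List.mem_append] at hm
      rcases hm with hm | hm <;> split_ifs at hm <;> simp at hm
    | report n lb =>
      obtain ⟨v, h1, h2, h3, h4, h5⟩ := mem_receiveReport.1 hm
      cases h5
    | trace s₀ π₀ =>
      obtain ⟨nd, hnd, ⟨h1, h⟩ | ⟨s', x, h1, h2, h3⟩ | ⟨j', h1, h2, h3⟩⟩ := mem_receiveTrace.1 hm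
      · cases h
        exact ⟨s₀, j, nd, hmm, hnd, h1, fun b =>
          hout b _ (mem_receiveTrace.2 ⟨nd, hnd, Or.inl ⟨h1, rfl⟩⟩)⟩
      · cases h3
      · cases h3
    | terminate π' => simp [receive] at hm

theorem Transition.report_cases {k : Φ} {L : LocalState P Φ A} {out : Outbox P Φ A}
    (ht : Transition Q h c c' k L out) {a b : Φ} {n : ℕ} {lb : ℝ≥0∞}
    (hm : .report n lb ∈ c'.chan a b) :
    .report n lb ∈ c.chan a b ∨
    ∃ r, (c'.loc a).snap (b, n) = some r ∧ r.pending = ∅ ∧ lb = r.lb := by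
  rcases ht.mem_chan a b _ hm with hm | ⟨rfl, hm⟩
  · exact Or.inl hm
  right
  rw [ht.loc_self]
  cases ht.op with
  | expandGoal s nd hacc hmin hgoal => simp [expandGoalOut] at hm
  | expandNonGoal s n acts hacc hmin hgoal =>
    unfold expandOut at hm
    split_ifs at hm <;> simp at hm
  | receive j m hmm =>
    cases m with
    | search s g e => simp [receive] at hm
    | marker id =>
      simp only [receive, receiveMarker, List.mem_append] at hm ⊢
      rcases hm with hm | hm
      · split_ifs at hm <;> simp at hm
      · split_ifs at hm with hc
        · simp only [List.mem_singleton, Msg.report.injEq] at hm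
          obtain ⟨rfl, rfl⟩ := hm
          obtain ⟨h1, rfl⟩ := hc
          exact ⟨_, Function.update_self .., h1, rfl⟩
        · simp at hm
    | report n lb =>
      obtain ⟨v, h1, h2, h3, h4, h5⟩ := mem_receiveReport.1 hm
      cases h5
    | trace s₀ π₀ =>
      obtain ⟨nd, hnd, ⟨h1, h⟩ | ⟨s', x, h1, h2, h3⟩ | ⟨j', h1, h2, h3⟩⟩ := mem_receiveTrace.1 hm
      · cases h
      · cases h3
      · cases h3
    | terminate π' => simp [receive] at hm

theorem Transition.marker_cases {k : Φ} {L : LocalState P Φ A} {out : Outbox P Φ A}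
    (ht : Transition Q h c c' k L out) {a b : Φ} {id : Φ × ℕ} (hm : .marker id ∈ c'.chan a b) :
    .marker id ∈ c.chan a b ∨ (∃ j, .marker id ∈ c.chan j a) ∨
      (id = (a, (c.loc a).numVerif) ∧ (c'.loc a).numVerif = (c.loc a).numVerif + 1) := by
  rcases ht.mem_chan a b _ hm with hm | ⟨rfl, hm⟩
  · exact Or.inl hm
  right
  rw [ht.loc_self]
  cases ht.op with
  | expandGoal s nd hacc hmin hgoal =>
    right
    simpa [expandGoalOut, expandGoalState] using hm
  | expandNonGoal s n acts hacc hmin hgoal =>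
    unfold expandOut at hm
    split_ifs at hm <;> simp at hm
  | receive j m hmm =>
    cases m with
    | search s g e => simp [receive] at hm
    | marker id' =>
      left
      simp only [receive, receiveMarker, List.mem_append] at hm
      rcases hm with hm | hm
      · split_ifs at hm
        · simp only [List.mem_singleton, Msg.marker.injEq] at hm
          exact ⟨j, hm ▸ hmm⟩
        · simp at hm
      · split_ifs at hm <;> simp at hm
    | report n lb =>
      obtain ⟨v, h1, h2, h3, h4, h5⟩ := mem_receiveReport.1 hm
      cases h5
    | trace s₀ π₀ =>
      obtain ⟨nd, hnd, ⟨h1, h⟩ | ⟨s', x, h1, h2, h3⟩ | ⟨j', h1, h2, h3⟩⟩ := mem_receiveTrace.1 hm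
      · cases h
      · cases h3
      · cases h3
    | terminate π' => simp [receive] at hm

/-- Snapshots persist, and completed ones are final. -/
theorem Transition.snap_mono {k : Φ} {L : LocalState P Φ A} {out : Outbox P Φ A}
    (ht : Transition Q h c c' k L out) (hfresh : c.Fresh) {a : Φ} {id : Φ × ℕ} {r : Snapshot Φ}
    (hr : (c.loc a).snap id = some r) :
    ∃ r', (c'.loc a).snap id = some r' ∧ r'.pending ⊆ r.pending ∧ (r.pending = ∅ → r' = r) := by
  by_cases hk : a = k
  swap
  · rw [ht.loc_ne a hk]
    exact ⟨r, hr, le_rfl, fun _ => rfl⟩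
  subst hk
  rw [ht.loc_self]
  cases ht.op with
  | expandGoal s nd hacc hmin hgoal =>
    have hid : id ≠ (a, (c.loc a).numVerif) := by
      rintro rfl
      exact absurd (hfresh.snap a _ (by rw [hr]; simp)) (lt_irrefl _)
    exact ⟨r, by simpa [expandGoalState, LocalState.setNode, hid] using hr, le_rfl, fun _ => rfl⟩
  | expandNonGoal s n acts hacc hmin hgoal =>
    rw [(sameProtocol_expandState ..).snap]
    exact ⟨r, hr, le_rfl, fun _ => rfl⟩
  | receive j m hm =>
    cases m with
    | search s g e =>
      simp only [receive, (sameProtocol_processSearch ..).snap, LocalState.recordArrival]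
      refine ⟨_, by rw [hr]; rfl, ?_, ?_⟩
      · dsimp only
        split_ifs <;> exact le_rfl
      · intro hp
        simp [hp]
    | marker id' =>
      by_cases hid : id = id'
      · subst hid
        refine ⟨⟨r.lb, r.pending.erase j⟩, by simp [receive, receiveMarker, hr],
          Finset.erase_subset _ _, fun hp => ?_⟩
        cases r
        simp only at hp
        simp [hp]
      · exact ⟨r, by simpa [receive, receiveMarker, hid] using hr, le_rfl, fun _ => rfl⟩
    | report n lb =>
      simp only [receive, (receiveReport_local ..).2.1]
      exact ⟨r, hr, le_rfl, fun _ => rfl⟩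
    | trace s π => exact ⟨r, hr, le_rfl, fun _ => rfl⟩
    | terminate π => exact ⟨r, hr, le_rfl, fun _ => rfl⟩

/-- Freshness is needed so that a new verification does not overwrite an old one under the same
serial number. -/
theorem Transition.verif_mono {k : Φ} {L : LocalState P Φ A} {out : Outbox P Φ A}
    (ht : Transition Q h c c' k L out) (hfresh : c.Fresh) {a : Φ} {n : ℕ} {v : Verification P Φ}
    (hv : (c.loc a).verif n = some v) :
    ∃ v', (c'.loc a).verif n = some v' ∧ v'.pending ⊆ v.pending := by
  by_cases hk : a = k
  swap
  · rw [ht.loc_ne a hk]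
    exact ⟨v, hv, le_rfl⟩
  subst hk
  rw [ht.loc_self]
  cases ht.op with
  | expandGoal s nd hacc hmin hgoal =>
    have hid : n ≠ (c.loc a).numVerif := by
      rintro rfl
      exact absurd ((hfresh.verif a _).1 (by rw [hv]; simp)) (lt_irrefl _)
    exact ⟨v, by simpa [expandGoalState, LocalState.setNode, hid] using hv, le_rfl⟩
  | expandNonGoal s n acts hacc hmin hgoal =>
    rw [(sameProtocol_expandState ..).verif]
    exact ⟨v, hv, le_rfl⟩
  | receive j m hm =>
    cases m with
    | search s g e =>
      simp only [receive, (sameProtocol_processSearch ..).verif, LocalState.recordArrival]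
      exact ⟨v, hv, le_rfl⟩
    | marker id' => exact ⟨v, hv, le_rfl⟩
    | report n₀ lb =>
      simp only [receive, (receiveReport_local ..).2.2.2.2]
      split_ifs with hn
      · subst hn
        exact ⟨_, by rw [hv]; rfl, Finset.erase_subset _ _⟩
      · exact ⟨v, hv, le_rfl⟩
    | trace s π => exact ⟨v, hv, le_rfl⟩
    | terminate π => exact ⟨v, hv, le_rfl⟩

theorem Transition.fresh {k : Φ} {L : LocalState P Φ A} {out : Outbox P Φ A}
    (ht : Transition Q h c c' k L out) (hfresh : c.Fresh) : c'.Fresh where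
  snap a id hs := by
    obtain ⟨r', hr'⟩ := Option.ne_none_iff_exists'.1 hs
    rcases ht.snap_cases hr' with h1 | ⟨r, j, s, g, e, h1, -⟩ | ⟨j, h1, -⟩ | ⟨h1, s, n, -, -, h2, -⟩
    · exact (hfresh.snap a id (by simp [h1])).trans_le (ht.numVerif_le _)
    · exact (hfresh.snap a id (by simp [h1])).trans_le (ht.numVerif_le _)
    · exact (hfresh.marker _ _ id h1).trans_le (ht.numVerif_le _)
    · rw [h1]
      simp [h2, expandGoalState]
  marker a b id hm := by
    rcases ht.marker_cases hm with h1 | ⟨j, h1⟩ | ⟨h1, h2⟩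
    · exact (hfresh.marker _ _ id h1).trans_le (ht.numVerif_le _)
    · exact (hfresh.marker _ _ id h1).trans_le (ht.numVerif_le _)
    · simp [h1, h2]
  verif a n := by
    constructor
    · intro hne
      obtain ⟨v', hv'⟩ := Option.ne_none_iff_exists'.1 hne
      rcases ht.verif_cases hv' with h1 | ⟨h1, s, nd, -, -, h2, -⟩ | ⟨j, lb, v, -, h1, -⟩
      · exact ((hfresh.verif a n).1 (by simp [h1])).trans_le (ht.numVerif_le _)
      · rw [h2, h1]
        simp [expandGoalState]
      · exact ((hfresh.verif a n).1 (by simp [h1])).trans_le (ht.numVerif_le _)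
    · intro hlt
      by_cases hlt' : n < (c.loc a).numVerif
      · obtain ⟨v, hv⟩ := Option.ne_none_iff_exists'.1 ((hfresh.verif a n).2 hlt')
        obtain ⟨v', hv', -⟩ := ht.verif_mono hfresh hv
        simp [hv']
      by_cases hk : a = k
      swap
      · rw [ht.loc_ne a hk] at hlt
        exact absurd hlt hlt'
      subst hk
      rw [ht.loc_self] at hlt ⊢
      cases ht.op with
      | expandGoal s nd hacc hmin hgoal =>
        have : n = (c.loc a).numVerif := by
          simp only [expandGoalState] at hlt
          omega
        simp [expandGoalState, this]
      | expandNonGoal s n acts hacc hmin hgoal =>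
        rw [(sameProtocol_expandState ..).numVerif] at hlt
        exact absurd hlt hlt'
      | receive j m hm =>
        refine absurd ?_ hlt'
        cases m with
        | search s g e =>
          simpa [receive, (sameProtocol_processSearch ..).numVerif,
            LocalState.recordArrival] using hlt
        | report n₀ lb => simpa [receive, (receiveReport_local ..).2.2.1] using hlt
        | _ => exact hlt

end Transitions

/-! ### Invariants of the distributed system -/

/-- The nodes and the states in transit. -/
def Config.toSearch (c : Config P Φ A) : SearchConfig P Φ A where
  node := fun k => (c.loc k).node
  chan := fun j k => searches (c.chan j k)

/-- The terminating message has been sent to all agents. -/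
def Config.Broadcast (c : Config P Φ A) : Prop :=
  ∃ k, ∀ b, (∃ π, .terminate π ∈ c.chan k b) ∨ (c.loc b).output ≠ none

/-- The fields up to `output` give safety; the last four say that the protocol does not get stuck.
In `verif` the node is only required to have `g` at most the stored `f`, because it may have been
improved since; likewise the inequality in `trace` survives improvements. -/
structure Config.Sound (Q : Problem P Φ A) (c : Config P Φ A) : Prop where
  fresh : c.Fresh
  cut : ∀ id, ∃ V : SearchConfig P Φ A, V.Inv Q ∧ Cut id c V
  report : ∀ a b n lb, .report n lb ∈ c.chan a b →
    ∃ r, (c.loc a).snap (b, n) = some r ∧ r.pending = ∅ ∧ lb = r.lb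
  verif : ∀ a n v, (c.loc a).verif n = some v → Q.goal ⊆ v.state ∧
    (∃ m, (c.loc a).node v.state = some m ∧ (m.g : ℝ≥0∞) ≤ v.f) ∧
    ∀ k, k ∉ v.pending → ∃ r, (c.loc k).snap (a, n) = some r ∧ r.pending = ∅ ∧ v.lb ≤ r.lb
  trace : ∀ a b s π, .trace s π ∈ c.chan a b → Q.Solves s π ∧
    ∃ n, (c.loc b).node s = some n ∧ (n.g : ℝ≥0∞) + Q.planCost π ≤ Q.hStar Q.init
  terminate : ∀ a b π, .terminate π ∈ c.chan a b → Q.IsOptimalPlan π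
  output : ∀ a π, (c.loc a).output = some π → Q.IsOptimalPlan π
  broadcast_of_terminate : ∀ a b π, .terminate π ∈ c.chan a b → c.Broadcast
  broadcast_of_output : ∀ a π, (c.loc a).output = some π → c.Broadcast
  decided : ∀ a n v, (c.loc a).verif n = some v → v.pending = ∅ → v.f ≤ v.lb →
    (c.loc a).accepted = true
  reported : ∀ k a n r, (c.loc k).snap (a, n) = some r → r.pending = ∅ →
    .report n r.lb ∈ c.chan k a ∨ ∃ v, (c.loc a).verif n = some v ∧ k ∉ v.pending

section Sound

variable {Q : Problem P Φ A} {h : Φ → Finset P → ℝ≥0∞} {c c' : Config P Φ A} {e : Event Φ}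

/-- A snapshot that nobody has started has the present configuration as its cut. So the results on
cuts also cover the actual search, with no second simulation argument. -/
theorem Cut.of_unused {id : Φ × ℕ} (hs : ∀ k, (c.loc k).snap id = none)
    (hm : ∀ j k, .marker id ∉ c.chan j k) : Cut id c c.toSearch where
  recorded_of_marker j k h := absurd h (hm j k)
  marker_of_recorded j k h := absurd (hs j) h
  recorded_of_done j k r h := by simp [hs] at h
  node_eq k _ := rfl
  node_lb k r h := by simp [hs] at h
  chan_eq j k _ := (searchesBefore_eq_searches (hm j k)).symm
  chan_recorded j k r h := by simp [hs] at h

theorem Cut.eq_toSearch {id : Φ × ℕ} {V : SearchConfig P Φ A} (hV : Cut id c V)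
    (hs : ∀ k, (c.loc k).snap id = none) (hm : ∀ j k, .marker id ∉ c.chan j k) :
    V = c.toSearch := by
  have h1 : V.node = fun k => (c.loc k).node := by
    funext k
    exact hV.node_eq k (hs k)
  have h2 : V.chan = fun j k => searches (c.chan j k) := by
    funext j k
    rw [hV.chan_eq j k (hs k), searchesBefore_eq_searches (hm j k)]
  cases V
  simp only at h1 h2
  rw [h1, h2]
  rfl

theorem Config.Fresh.unused (hc : c.Fresh) {i : Φ} {n : ℕ} (hn : (c.loc i).numVerif ≤ n) :
    (∀ k, (c.loc k).snap (i, n) = none) ∧ ∀ j k, .marker (i, n) ∉ c.chan j k := by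
  constructor
  · intro k
    by_contra hne
    exact absurd (hc.snap k (i, n) hne) (not_lt.2 hn)
  · intro j k hm
    exact absurd (hc.marker j k (i, n) hm) (not_lt.2 hn)

theorem Step.toSearch [Nonempty Φ] (hst : Step Q h e c c') (hc : c.Fresh) :
    Relation.ReflTransGen (SearchStep Q h) c.toSearch c'.toSearch := by
  obtain ⟨k, L, out, ht⟩ := hst.transition
  obtain ⟨i⟩ := ‹Nonempty Φ›
  -- The serial number is the counter after the step, so it is unused both before and after.
  obtain ⟨h1, h2⟩ := hc.unused (ht.numVerif_le i)
  obtain ⟨h1', h2'⟩ := (ht.fresh hc).unused (le_refl (c'.loc i).numVerif)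
  obtain ⟨V', hV', hcut⟩ := (Cut.of_unused h1 h2).step hc hst
  rwa [hcut.eq_toSearch h1' h2'] at hV'

theorem Config.Sound.inv [Nonempty Φ] (hc : c.Sound Q) : c.toSearch.Inv Q := by
  obtain ⟨i⟩ := ‹Nonempty Φ›
  obtain ⟨h1, h2⟩ := hc.fresh.unused (le_refl (c.loc i).numVerif)
  obtain ⟨V, hV, hcut⟩ := hc.cut (i, (c.loc i).numVerif)
  rwa [hcut.eq_toSearch h1 h2] at hV

theorem Step.evolves [Nonempty Φ] (hst : Step Q h e c c') (hc : c.Fresh) {k : Φ} {s : Finset P}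
    {n : Node P Φ A} (hn : (c.loc k).node s = some n) :
    ∃ n', (c'.loc k).node s = some n' ∧ n.Evolves Q s n' :=
  steps_evolves (hst.toSearch hc) (k := k) hn

theorem Transition.broadcast {k : Φ} {L : LocalState P Φ A} {out : Outbox P Φ A}
    (ht : Transition Q h c c' k L out) (hb : c.Broadcast) : c'.Broadcast := by
  obtain ⟨a, ha⟩ := hb
  refine ⟨a, fun b => ?_⟩
  rcases ha b with ⟨π, hπ⟩ | hb
  · rcases ht.kept a b _ hπ with h1 | ⟨rfl, h1, -⟩
    · exact Or.inl ⟨π, h1⟩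
    · right
      rw [ht.loc_self, h1]
      simp [receive]
  · right
    obtain ⟨π, hπ⟩ := Option.ne_none_iff_exists'.1 hb
    simp [ht.output_stable hπ]

/-- The essential case is the start of a trace-back: a verification returned true, so by
`Cut.le_hStar` the goal state costs at most `h*(I)`. All later trace messages inherit the bound. -/
theorem Step.sound [Finite A] [Nonempty Φ] (hadm : ∀ i, Q.Admissible (h i))
    (hsol : ∃ π, Q.IsPlan π) (hst : Step Q h e c c') (hc : c.Sound Q) : c'.Sound Q := by
  obtain ⟨k, L, out, ht⟩ := hst.transition
  have hfresh' := ht.fresh hc.fresh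
  have hinv := hc.inv
  have hreport : ∀ a b n lb, .report n lb ∈ c'.chan a b →
      ∃ r, (c'.loc a).snap (b, n) = some r ∧ r.pending = ∅ ∧ lb = r.lb := by
    intro a b n lb hm
    rcases ht.report_cases hm with hm | hm
    · obtain ⟨r, hr, hp, hlb⟩ := hc.report a b n lb hm
      obtain ⟨r', hr', -, heq⟩ := ht.snap_mono hc.fresh hr
      rw [heq hp] at hr'
      exact ⟨r, hr', hp, hlb⟩
    · exact hm
  refine ⟨hfresh', ?_, hreport, ?_, ?_, ?_, ?_, ?_, ?_, ?_, ?_⟩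
  · intro id
    obtain ⟨V, hV, hcut⟩ := hc.cut id
    obtain ⟨V', hV', hcut'⟩ := hcut.step hc.fresh hst
    exact ⟨V', hV.steps hadm hV', hcut'⟩
  · intro a n v' hv'
    have snapmono : ∀ {k}, (∃ x, ∃ r, (c.loc k).snap (a, n) = some r ∧ r.pending = ∅ ∧
        v'.lb ≤ x ∧ x ≤ r.lb) →
        ∃ r, (c'.loc k).snap (a, n) = some r ∧ r.pending = ∅ ∧ v'.lb ≤ r.lb := by
      rintro k ⟨x, r, hr, hp, hx, hx'⟩
      obtain ⟨r', hr', -, heq⟩ := ht.snap_mono hc.fresh hr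
      rw [heq hp] at hr'
      exact ⟨r, hr', hp, hx.trans hx'⟩
    have nodemono : ∀ {s f}, (∃ m, (c.loc a).node s = some m ∧ (m.g : ℝ≥0∞) ≤ f) →
        ∃ m, (c'.loc a).node s = some m ∧ (m.g : ℝ≥0∞) ≤ f := by
      rintro s f ⟨m, hm, hle⟩
      obtain ⟨m', hm', hev⟩ := hst.evolves hc.fresh hm
      exact ⟨m', hm', le_trans (by exact_mod_cast hev.g_le) hle⟩
    rcases ht.verif_cases hv' with h1 | ⟨h1, s, nd, h2, h3, -, rfl⟩ | ⟨j, lb, v, h1, h2, rfl, -⟩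
    · obtain ⟨g1, g2, g3⟩ := hc.verif a n v' h1
      refine ⟨g1, nodemono g2, fun k hk => ?_⟩
      obtain ⟨r, hr, hp, hle⟩ := g3 k hk
      exact snapmono ⟨_, r, hr, hp, le_rfl, hle⟩
    · refine ⟨h3, nodemono ⟨nd, h2.1, ?_⟩, by simp⟩
      exact le_self_add
    · obtain ⟨g1, g2, g3⟩ := hc.verif a n v h2
      refine ⟨g1, nodemono g2, fun k hk => ?_⟩
      by_cases hkj : k = j
      · subst hkj
        obtain ⟨r, hr, hp, hle⟩ := hc.report _ _ _ _ h1
        exact snapmono ⟨_, r, hr, hp, min_le_right _ _, hle.le⟩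
      · obtain ⟨r, hr, hp, hle⟩ := g3 k (fun h => hk (Finset.mem_erase.2 ⟨hkj, h⟩))
        exact snapmono ⟨_, r, hr, hp, min_le_left _ _, hle⟩
  · intro a b s π hm
    have nodemono : ∀ {b s π}, (∃ n, (c.loc b).node s = some n ∧
        (n.g : ℝ≥0∞) + Q.planCost π ≤ Q.hStar Q.init) → ∃ n, (c'.loc b).node s = some n ∧
        (n.g : ℝ≥0∞) + Q.planCost π ≤ Q.hStar Q.init := by
      rintro b s π ⟨m, hm, hle⟩
      obtain ⟨m', hm', hev⟩ := hst.evolves hc.fresh hm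
      refine ⟨m', hm', le_trans ?_ hle⟩
      gcongr
      exact hev.g_le
    rcases ht.trace_cases hm with hm | ⟨v, n, j, lb, h1, rfl, h3, h4, h5, rfl, rfl⟩ |
      ⟨s₀, π₀, j, nd, h1, h2, h3⟩
    · obtain ⟨g1, g2⟩ := hc.trace _ _ _ _ hm
      exact ⟨g1, nodemono g2⟩
    · obtain ⟨g1, ⟨m, g2, g2'⟩, g3⟩ := hc.verif b n v h3
      refine ⟨g1, nodemono ⟨m, g2, ?_⟩⟩
      rw [Problem.planCost_nil, ENNReal.coe_zero, add_zero]
      refine g2'.trans ?_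
      -- No agent other than `j` is pending, and the report of `j` is being processed, so all parts
      -- of the snapshot are complete with bounds at least `v.f`.
      obtain ⟨V, hV, hcut⟩ := hc.cut (b, n)
      refine hcut.le_hStar hV hsol fun k => ?_
      by_cases hkj : k = j
      · subst hkj
        obtain ⟨r, hr, hp, hle⟩ := hc.report _ _ _ _ h1
        exact ⟨r, hr, hp, hle ▸ h5.trans (min_le_right _ _)⟩
      · obtain ⟨r, hr, hp, hle⟩ := g3 k (fun h => by
          have : k ∈ v.pending.erase j := Finset.mem_erase.2 ⟨hkj, h⟩
          simp [h4] at this)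
        exact ⟨r, hr, hp, (h5.trans (min_le_left _ _)).trans hle⟩
    · obtain ⟨g1, m, g2, g3⟩ := hc.trace _ _ _ _ h1
      obtain rfl : nd = m := Option.some.inj (h2.symm.trans g2)
      have hback := hinv.linked.origin a s₀ nd h2
      -- Going back over an action adds its cost to the plan and lowers `g` by at least as much;
      -- going back to a sender does not increase `g`.
      rcases h3 with ⟨x, h3, rfl, rfl⟩ | ⟨h3, rfl, rfl⟩
      · rw [h3] at hback
        obtain ⟨-, b2, rfl, n₀, b4, b5⟩ := hback
        refine ⟨⟨b2, g1⟩, nodemono ⟨n₀, b4, le_trans ?_ g3⟩⟩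
        rw [Problem.planCost_cons, ENNReal.coe_add, ← add_assoc]
        gcongr
        exact_mod_cast b5
      · rw [h3] at hback
        obtain ⟨n₀, b4, b5⟩ := hback
        refine ⟨g1, nodemono ⟨n₀, b4, le_trans ?_ g3⟩⟩
        gcongr
  · intro a b π hm
    rcases ht.terminate_cases hm with hm | ⟨s, j, nd, h1, h2, h3, -⟩
    · exact hc.terminate _ _ _ hm
    · obtain ⟨g1, m, g2, g3⟩ := hc.trace _ _ _ _ h1
      have hback := hinv.linked.origin a s nd h2
      rw [h3] at hback
      have hs : s = Q.init := hback
      subst hs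
      exact Q.isOptimalPlan_of_le g1 (le_trans le_add_self g3)
  · intro a π ha
    rcases ht.output_cases ha with ha | ⟨j, hj⟩
    · exact hc.output a π ha
    · exact hc.terminate _ _ _ hj
  · intro a b π hm
    rcases ht.terminate_cases hm with hm | ⟨s, j, nd, h1, h2, h3, h4⟩
    · exact ht.broadcast (hc.broadcast_of_terminate _ _ _ hm)
    · exact ⟨a, fun b => Or.inl ⟨π, h4 b⟩⟩
  · intro a π ha
    rcases ht.output_cases ha with ha | ⟨j, hj⟩
    · exact ht.broadcast (hc.broadcast_of_output a π ha)
    · exact ht.broadcast (hc.broadcast_of_terminate _ _ _ hj)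
  · intro a n v' hv' hp hle
    rcases ht.verif_cases hv' with h1 | ⟨h1, s, nd, h2, h3, -, rfl⟩ | ⟨j, lb, v, h1, h2, -, h4⟩
    · exact ht.accepted_mono (hc.decided a n v' h1 hp hle)
    -- A new verification waits for all agents, and there is at least one.
    · simp only [Finset.univ_eq_empty_iff] at hp
      exact (not_isEmpty_of_nonempty Φ hp).elim
    · exact h4 hp hle
  · intro b a n r' hr' hp
    have keep : (.report n r'.lb ∈ c.chan b a ∨
        ∃ v, (c.loc a).verif n = some v ∧ b ∉ v.pending) → (.report n r'.lb ∈ c'.chan b a ∨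
        ∃ v, (c'.loc a).verif n = some v ∧ b ∉ v.pending) := by
      rintro (hm | ⟨v, hv, hb⟩)
      · rcases ht.kept b a _ hm with h1 | ⟨rfl, h1, -⟩
        · exact Or.inl h1
        · right
          -- The report comes from a part of this snapshot, so its serial number has been assigned
          -- and the verification exists.
          obtain ⟨r, hr, -⟩ := hc.report _ _ _ _ hm
          have hlt := hc.fresh.snap b (a, n) (by simp [hr])
          obtain ⟨v, hv⟩ := Option.ne_none_iff_exists'.1 ((hc.fresh.verif a n).2 hlt)
          rw [ht.loc_self, h1]
          refine ⟨{ v with lb := min v.lb r'.lb, pending := v.pending.erase b }, ?_, by simp⟩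
          rw [MADAStar.receive, (receiveReport_local ..).2.2.2.2, if_pos rfl, hv]
          rfl
      · obtain ⟨v', hv', hsub⟩ := ht.verif_mono hc.fresh hv
        exact Or.inr ⟨v', hv', fun h => hb (hsub h)⟩
    rcases ht.snap_cases hr' with h1 | ⟨r, j, s, g, e, h1, -, h3, rfl⟩ | ⟨j, -, -, h3⟩ |
      ⟨-, s, nd, -, -, -, rfl⟩
    · exact keep (hc.reported b a n r' h1 hp)
    · rw [hp] at h3
      simp at h3
    · exact Or.inl (h3 hp)
    · simp only [Finset.univ_eq_empty_iff] at hp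
      exact (not_isEmpty_of_nonempty Φ hp).elim

theorem initConfig_inv (hadm : ∀ i, Q.Admissible (h i)) :
    (initConfig Q h).toSearch.Inv Q := by
  have hnode : ∀ k s n, (initConfig Q h).toSearch.node k s = some n →
      s = Q.init ∧ n = ⟨0, h k Q.init, .root, true⟩ := by
    intro k s n hn
    simp only [Config.toSearch, initConfig, Function.update_apply] at hn
    split_ifs at hn with hs
    exact ⟨hs, (Option.some.inj hn).symm⟩
  have hinit : ∀ k, (initConfig Q h).toSearch.node k Q.init =
      some ⟨0, h k Q.init, .root, true⟩ := by
    intro k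
    simp [Config.toSearch, initConfig]
  have hchan : ∀ j k m, m ∉ (initConfig Q h).toSearch.chan j k := by
    intro j k m
    simp [Config.toSearch, initConfig, searches]
  refine ⟨⟨?_, ?_, ?_, ?_, ?_, ?_⟩, ⟨?_, ?_, ?_⟩, ⟨?_, ?_, ?_⟩, ?_, ?_⟩
  · intro k s n hn
    obtain ⟨rfl, rfl⟩ := hnode k s n hn
    simp
  · intro k s n hn
    obtain ⟨rfl, rfl⟩ := hnode k s n hn
    exact hadm k _
  · intro k s n hn
    obtain ⟨rfl, rfl⟩ := hnode k s n hn
    exact Q.costSet.zero_mem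
  · exact fun j k s g e hm => absurd hm (hchan j k _)
  · exact fun j k s g e hm => absurd hm (hchan j k _)
  · exact fun j k s g e hm => absurd hm (hchan j k _)
  · exact fun j k s g e hm => absurd hm (hchan j k _)
  · exact fun k => ⟨_, hinit k, le_rfl⟩
  · intro k s n hn
    obtain ⟨rfl, rfl⟩ := hnode k s n hn
    rfl
  · intro k s n hn ho
    obtain ⟨rfl, rfl⟩ := hnode k s n hn
    simp at ho
  · intro k s n hn ho
    obtain ⟨rfl, rfl⟩ := hnode k s n hn
    simp at ho
  · intro k s n hn ho
    obtain ⟨rfl, rfl⟩ := hnode k s n hn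
    simp at ho
  · intro k s n hn
    exact ⟨s, n, [], hn, Or.inl (by rw [(hnode k s n hn).2]), by simp, fun π hπ => hπ, by simp⟩
  · intro k s n hn hopt
    exact .root k s n hn hopt (by rw [(hnode k s n hn).2])

theorem initConfig_sound (hadm : ∀ i, Q.Admissible (h i)) : (initConfig Q h).Sound Q where
  fresh := ⟨by simp [initConfig], by simp [initConfig], by simp [initConfig]⟩
  cut id := ⟨_, initConfig_inv hadm, Cut.of_unused (by simp [initConfig]) (by simp [initConfig])⟩
  report := by simp [initConfig]
  verif := by simp [initConfig]
  trace := by simp [initConfig]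
  terminate := by simp [initConfig]
  output := by simp [initConfig]
  broadcast_of_terminate := by simp [initConfig]
  broadcast_of_output := by simp [initConfig]
  decided := by simp [initConfig]
  reported := by simp [initConfig]

end Sound

/-! ### Live executions -/

section Enabled

variable {Q : Problem P Φ A} {h : Φ → Finset P → ℝ≥0∞} {c c' : Config P Φ A} {e : Event Φ}

theorem LocalState.exists_isMin [Finite P] {L : LocalState P Φ A} {s : Finset P} {n : Node P Φ A}
    (hn : L.node s = some n) (ho : n.isOpen = true) : ∃ s n, L.IsMin s n := by
  let S : Set (Finset P) := {s | ∃ n, L.node s = some n ∧ n.isOpen = true}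
  -- The default `⊤` never matters, since `S` contains only known states.
  obtain ⟨s₁, ⟨n₁, hn₁, ho₁⟩, hmin⟩ := Set.exists_min_image S
    (fun s => ((L.node s).map Node.f).getD ⊤) S.toFinite ⟨s, n, hn, ho⟩
  refine ⟨s₁, n₁, hn₁, ho₁, fun s' n' hn' ho' => ?_⟩
  simpa [hn₁, hn'] using hmin s' ⟨n', hn', ho'⟩

open Classical in
theorem expand_enabled [Finite P] [Fintype A] {k : Φ} (hrun : (c.loc k).output = none)
    (hacc : (c.loc k).accepted = false) {s : Finset P} {n : Node P Φ A}
    (hn : (c.loc k).node s = some n) (ho : n.isOpen = true) :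
    ∃ c', Step Q h (.expand k) c c' := by
  obtain ⟨s, n, hmin⟩ := LocalState.exists_isMin hn ho
  by_cases hgoal : Q.goal ⊆ s
  · exact ⟨_, .expandGoal c k s n hrun hacc hmin hgoal⟩
  · exact ⟨_, .expandNonGoal c k s n
      (Finset.univ.filter fun a => Q.owner a = k ∧ Q.pre a ⊆ s).toList hrun hacc hmin hgoal
      (Finset.nodup_toList _) (by simp)⟩

theorem expandState_closes {hi : Finset P → ℝ≥0∞} {s : Finset P} {n : Node P Φ A} {acts : List A}
    {L : LocalState P Φ A} (hn : L.node s = some n) :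
    (expandState Q hi s n acts L).node s = some { n with isOpen := false } := by
  unfold expandState
  rw [(foldl_generate_setNode Q hi s n false acts L hn).1]
  simp [LocalState.setNode]

open Classical in
/-- The contents of a channel after a step. -/
theorem Step.chan_eq (hst : Step Q h e c c') (j k : Φ) : ∃ extra, c'.chan j k =
    (if e = .receive k j then (c.chan j k).tail else c.chan j k) ++ extra ∧
    ∀ s g x, .search s g x ∈ extra → Q.goal ⊆ s ∨ ∃ n, (c.loc j).node s = some n ∧
      n.isOpen = true ∧ (c'.loc j).node s = some { n with isOpen := false } := by
  cases hst with
  | expandGoal _ i s n hrun hacc hmin hgoal =>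
    by_cases hj : j = i
    · subst hj
      refine ⟨expandGoalOut j s n (c.loc j) k, by simp [Config.act_chan_self], ?_⟩
      intro s' g x hm
      simp only [expandGoalOut, List.mem_cons, Msg.search.injEq, reduceCtorEq, List.not_mem_nil,
        or_self, or_false] at hm
      exact Or.inl (hm.1 ▸ hgoal)
    · exact ⟨[], by simp [Config.act_chan_ne _ hj], by simp⟩
  | expandNonGoal _ i s n acts hrun hacc hmin hgoal hnodup hacts =>
    by_cases hj : j = i
    · subst hj
      refine ⟨expandOut Q s n k, by simp [Config.act_chan_self], ?_⟩
      intro s' g x hm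
      have hs : s' = s := by
        unfold expandOut at hm
        split_ifs at hm
        · simp only [List.mem_singleton, Msg.search.injEq] at hm
          exact hm.1
        · simp at hm
      subst hs
      rw [Config.act_loc_self]
      exact Or.inr ⟨n, hmin.1, hmin.2.1, expandState_closes hmin.1⟩
    · exact ⟨[], by simp [Config.act_chan_ne _ hj], by simp⟩
  | receive _ i i' m rest hrun hm =>
    have hbase : (c.setChan i' i rest).chan j k =
        if Event.receive i i' = .receive k j then (c.chan j k).tail else c.chan j k := by
      by_cases hjk : j = i' ∧ k = i
      · obtain ⟨rfl, rfl⟩ := hjk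
        simp [Config.setChan_chan_self, hm]
      · rw [Config.setChan_chan_ne _ hjk, if_neg]
        rintro ⟨⟩
        exact hjk ⟨rfl, rfl⟩
    rw [← hbase]
    by_cases hj : j = i
    · subst hj
      refine ⟨_, Config.act_chan_self .., ?_⟩
      intro s' g x hx
      exfalso
      cases m with
      | search s g e => simp [MADAStar.receive] at hx
      | marker id =>
        simp only [MADAStar.receive, receiveMarker, List.mem_append] at hx
        rcases hx with hx | hx <;> split_ifs at hx <;> simp at hx
      | report n lb =>
        obtain ⟨v, h1, h2, h3, h4, h5⟩ := mem_receiveReport.1 hx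
        cases h5
      | trace s₀ π₀ =>
        obtain ⟨nd, hnd, ⟨h1, h⟩ | ⟨s', x, h1, h2, h3⟩ | ⟨j', h1, h2, h3⟩⟩ := mem_receiveTrace.1 hx
        · cases h
        · cases h3
        · cases h3
      | terminate π' => simp [MADAStar.receive] at hx
    · exact ⟨[], by rw [Config.act_chan_ne _ hj, List.append_nil], by simp⟩

theorem processSearch_open {hi : Finset P → ℝ≥0∞} {j : Φ} {s s' : Finset P} {g : ℝ≥0} {x : ℝ≥0∞}
    {L : LocalState P Φ A} {n : Node P Φ A} (hn : L.node s = some n) (ho : n.isOpen = true) :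
    ∃ n', (processSearch Q hi j s' g x L).node s = some n' ∧ n'.isOpen = true := by
  have h1 : ∃ n', (L.relax s' g (max (hi s') x) (.message j)).node s = some n' ∧
      n'.isOpen = true := by
    rcases L.relax_cases s' g (max (hi s') x) (.message j) with ⟨m, -, -, heq⟩ | ⟨-, e', -, heq⟩
    · rw [heq]; exact ⟨n, hn, ho⟩
    · rw [heq]
      by_cases hs : s = s'
      · subst hs
        exact ⟨_, Function.update_self .., rfl⟩
      · exact ⟨n, by simpa [LocalState.setNode, hs] using hn, ho⟩
  obtain ⟨n₁, hn₁, ho₁⟩ := h1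
  unfold processSearch
  dsimp only
  split_ifs
  · unfold LocalState.reopen
    split
    · exact ⟨n₁, hn₁, ho₁⟩
    · by_cases hs : s = s'
      · subst hs
        exact ⟨_, Function.update_self .., rfl⟩
      · exact ⟨n₁, by simpa [LocalState.setNode, hs] using hn₁, ho₁⟩
  · exact ⟨n₁, hn₁, ho₁⟩

theorem processSearch_goal {hi : Finset P → ℝ≥0∞} {j : Φ} {s : Finset P} {g : ℝ≥0} {x : ℝ≥0∞}
    {L : LocalState P Φ A} (hgoal : Q.goal ⊆ s) :
    ∃ n', (processSearch Q hi j s g x L).node s = some n' ∧ n'.isOpen = true ∧ n'.g ≤ g := by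
  have h1 : ∃ n', (L.relax s g (max (hi s) x) (.message j)).node s = some n' ∧ n'.g ≤ g := by
    rcases L.relax_cases s g (max (hi s) x) (.message j) with ⟨m, h1, h2, heq⟩ | ⟨-, e', -, heq⟩
    · rw [heq]; exact ⟨m, h1, h2⟩
    · rw [heq]
      exact ⟨_, Function.update_self .., le_rfl⟩
  obtain ⟨n₁, hn₁, hg₁⟩ := h1
  unfold processSearch
  dsimp only
  rw [if_pos hgoal]
  simp only [LocalState.reopen, hn₁]
  exact ⟨_, Function.update_self .., rfl, hg₁⟩

theorem receive_open {hi : Finset P → ℝ≥0∞} {i j : Φ} {s : Finset P} {m : Msg P Φ A}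
    {L : LocalState P Φ A} {n : Node P Φ A} (hn : L.node s = some n) (ho : n.isOpen = true) :
    ∃ n', (receive Q hi i j L m).1.node s = some n' ∧ n'.isOpen = true := by
  cases m with
  | search s' g x => exact processSearch_open (L := L.recordArrival j ((g : ℝ≥0∞) + x)) hn ho
  | report n lb =>
    simp only [receive, (receiveReport_local ..).1]
    exact ⟨_, hn, ho⟩
  | _ => exact ⟨n, hn, ho⟩

end Enabled

/-! ### Delivery of messages, halting and the trace-back -/

namespace IsLiveExecution

variable {Q : Problem P Φ A} {h : Φ → Finset P → ℝ≥0∞} {σ : ℕ → Config P Φ A}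
  {ev : ℕ → Option (Event Φ)}

/-- Induction over time, with the idle moments taken care of. It is used for all persistence
statements. -/
theorem stable (hexec : IsLiveExecution Q h σ ev) {p : Config P Φ A → Prop} {t₀ : ℕ}
    (hp : p (σ t₀)) (hstep : ∀ t ≥ t₀, ∀ e, ev t = some e → Step Q h e (σ t) (σ (t + 1)) →
      p (σ t) → p (σ (t + 1))) : ∀ t ≥ t₀, p (σ t) := by
  intro t ht
  induction t, ht using Nat.le_induction with
  | base => exact hp
  | succ t ht ih =>
    cases he : ev t with
    | none => rwa [hexec.idle t he]
    | some e => exact hstep t ht e he (hexec.step t e he) ih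

theorem sound [Finite A] [Nonempty Φ] (hexec : IsLiveExecution Q h σ ev)
    (hadm : ∀ i, Q.Admissible (h i)) (hsol : ∃ π, Q.IsPlan π) (t : ℕ) : (σ t).Sound Q :=
  hexec.stable (p := fun c => c.Sound Q) (t₀ := 0)
    (by rw [hexec.start]; exact initConfig_sound hadm)
    (fun t _ e _ hst hs => hst.sound hadm hsol hs) t (Nat.zero_le t)

theorem output_stable (hexec : IsLiveExecution Q h σ ev) {t₀ : ℕ} {k : Φ} {π : List A}
    (hπ : ((σ t₀).loc k).output = some π) : ∀ t ≥ t₀, ((σ t).loc k).output = some π :=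
  hexec.stable (p := fun c => (c.loc k).output = some π) hπ fun t _ e _ hst ho => by
    obtain ⟨a, L, out, ht⟩ := hst.transition
    exact ht.output_stable ho

/-- A message to an agent that does not halt is received. -/
theorem delivery (hexec : IsLiveExecution Q h σ ev) {j k : Φ}
    (hrun : ∀ t, ((σ t).loc k).output = none) {m : Msg P Φ A} {t : ℕ}
    (hm : m ∈ (σ t).chan j k) : ∃ t' ≥ t, m ∈ (σ t').chan j k ∧
      (σ (t' + 1)).loc k = (receive Q (h k) k j ((σ t').loc k) m).1 ∧
      ∀ b, ∀ m' ∈ (receive Q (h k) k j ((σ t').loc k) m).2 b, m' ∈ (σ (t' + 1)).chan k b := by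
  -- Induction on the position of the message in its channel: each reception brings it one place
  -- forward.
  have main : ∀ n t : ℕ, ((σ t).chan j k)[n]? = some m → ∃ t' ≥ t, ∃ rest,
      ev t' = some (.receive k j) ∧ (σ t').chan j k = m :: rest := by
    intro n
    induction n with
    | zero =>
      intro t hn
      by_contra hcon
      push Not at hcon
      -- New messages go to the end of the channel, so an unreceived head stays at the head. The
      -- reception is then possible forever, which contradicts liveness.
      have hev : ∀ t' ≥ t, ((σ t').chan j k)[0]? = some m := by
        refine hexec.stable (p := fun c => (c.chan j k)[0]? = some m) hn
          fun t' ht' e he hst h0 => ?_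
        obtain ⟨extra, hx, -⟩ := hst.chan_eq j k
        have hne : e ≠ .receive k j := by
          rintro rfl
          obtain ⟨rest, hrest⟩ := List.head?_eq_some_iff.1 (by simpa [List.head?_eq_getElem?] using h0)
          exact hcon t' ht' rest he hrest
        rw [hx, if_neg hne, List.getElem?_append_left]
        · exact h0
        · exact (List.getElem?_eq_some_iff.1 h0).1
      obtain ⟨t', ht', he⟩ := hexec.live (.receive k j) t fun t' ht' => by
        obtain ⟨rest, hrest⟩ := List.head?_eq_some_iff.1
          (by simpa [List.head?_eq_getElem?] using hev t' ht')
        exact ⟨_, .receive (σ t') k j m rest (hrun t') hrest⟩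
      obtain ⟨rest, hrest⟩ := List.head?_eq_some_iff.1
          (by simpa [List.head?_eq_getElem?] using hev t' ht')
      exact hcon t' ht' rest he hrest
    | succ n ih =>
      intro t hn
      by_contra hcon
      have hnext : ∀ t' ≥ t, ev t' = some (.receive k j) →
          ((σ t').chan j k)[n + 1]? = some m → False := by
        intro t' ht' he h0
        obtain ⟨extra, hx, -⟩ := (hexec.step t' _ he).chan_eq j k
        obtain ⟨t₁, ht₁, rest, h1, h2⟩ := ih (t' + 1) (by
          rw [hx, if_pos rfl, List.getElem?_append_left]
          · simpa using h0
          · have := (List.getElem?_eq_some_iff.1 h0).1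
            simp only [List.length_tail]
            omega)
        exact hcon ⟨t₁, by omega, rest, h1, h2⟩
      have hev : ∀ t' ≥ t, ((σ t').chan j k)[n + 1]? = some m := by
        refine hexec.stable (p := fun c => (c.chan j k)[n + 1]? = some m) hn
          fun t' ht' e he hst h0 => ?_
        obtain ⟨extra, hx, -⟩ := hst.chan_eq j k
        have hne : e ≠ .receive k j := by
          rintro rfl
          exact hnext t' ht' he h0
        rw [hx, if_neg hne, List.getElem?_append_left]
        · exact h0
        · exact (List.getElem?_eq_some_iff.1 h0).1
      obtain ⟨t', ht', he⟩ := hexec.live (.receive k j) t fun t' ht' => by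
        have hlen := (List.getElem?_eq_some_iff.1 (hev t' ht')).1
        cases hc : (σ t').chan j k with
        | nil => simp [hc] at hlen
        | cons m₀ rest => exact ⟨_, .receive (σ t') k j m₀ rest (hrun t') hc⟩
      exact hnext t' ht' he (hev t' ht')
  obtain ⟨n, hn⟩ := List.mem_iff_getElem?.1 hm
  obtain ⟨t', ht', rest, he, hc⟩ := main n t hn
  refine ⟨t', ht', by simp [hc], ?_⟩
  have hst := hexec.step t' _ he
  generalize σ (t' + 1) = c' at hst
  cases hst with
  | receive _ _ _ m' rest' hrun' hc' =>
    rw [hc'] at hc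
    obtain ⟨rfl, rfl⟩ := List.cons.inj hc
    rw [Config.act_loc_self]
    exact ⟨rfl, fun b m'' hm'' => Config.mem_act_chan.2 (Or.inr ⟨rfl, hm''⟩)⟩

/-- After the terminating message has been sent, all agents halt. -/
theorem halts_of_broadcast (hexec : IsLiveExecution Q h σ ev) {t₀ : ℕ}
    (hb : (σ t₀).Broadcast) : ∃ T, ∀ t ≥ T, ∀ i, ∃ π, ((σ t).loc i).output = some π := by
  have hex : ∀ i, ∃ t π, ((σ t).loc i).output = some π := by
    intro i
    by_contra hcon
    push Not at hcon
    have hrun : ∀ t, ((σ t).loc i).output = none := fun t =>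
      Option.eq_none_iff_forall_ne_some.2 (hcon t)
    obtain ⟨k, hk⟩ := hb
    rcases hk i with ⟨π, hπ⟩ | hne
    · obtain ⟨t', -, -, hloc, -⟩ := hexec.delivery hrun hπ
      exact hcon (t' + 1) π (by rw [hloc]; rfl)
    · exact hne (hrun t₀)
  choose T π hT using hex
  refine ⟨Finset.univ.sup T, fun t ht i => ⟨π i, hexec.output_stable (hT i) t ?_⟩⟩
  exact (Finset.le_sup (Finset.mem_univ i)).trans ht

section NoBroadcast

variable [Finite A] [Nonempty Φ]

theorem evolves (hexec : IsLiveExecution Q h σ ev) (hadm : ∀ i, Q.Admissible (h i))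
    (hsol : ∃ π, Q.IsPlan π) {t t' : ℕ} (ht : t ≤ t') {k : Φ} {s : Finset P} {n : Node P Φ A}
    (hn : ((σ t).loc k).node s = some n) :
    ∃ n', ((σ t').loc k).node s = some n' ∧ n.Evolves Q s n' :=
  hexec.stable (p := fun c => ∃ n', (c.loc k).node s = some n' ∧ n.Evolves Q s n')
    ⟨n, hn, .refl ..⟩ (fun t _ e _ hst ⟨n₁, hn₁, h₁⟩ => by
      obtain ⟨n₂, hn₂, h₂⟩ := hst.evolves (hexec.sound hadm hsol t).fresh hn₁
      exact ⟨n₂, hn₂, h₁.trans h₂⟩) t' ht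

/-- Induction along the chain of origins. The chain is that of time `t₀`; since nodes on optimal
paths are final, the trace message meets the same origins whenever it arrives. -/
theorem broadcast_of_trace (hexec : IsLiveExecution Q h σ ev) (hadm : ∀ i, Q.Admissible (h i))
    (hsol : ∃ π, Q.IsPlan π) (hrun : ∀ t k, ((σ t).loc k).output = none) {t₀ : ℕ} {k : Φ}
    {s : Finset P} (htr : Traceable Q (σ t₀).toSearch.node k s) :
    ∀ t ≥ t₀, ∀ a π, .trace s π ∈ (σ t).chan a k → ∃ t', (σ t').Broadcast := by
  have final : ∀ {k s n}, (σ t₀).toSearch.node k s = some n → Q.OnOptimal s n.g → ∀ t ≥ t₀,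
      ∃ n', ((σ t).loc k).node s = some n' ∧ n'.origin = n.origin := by
    intro k s n hn hopt t ht
    obtain ⟨n', hn', hev⟩ := hexec.evolves hadm hsol ht hn
    rcases hev with hlt | hev
    · exact absurd hlt (hopt.not_lt ((hexec.sound hadm hsol t).inv.values.lower k s n' hn'))
    · exact ⟨n', hn', hev.2.2.1⟩
  induction htr with
  | root k s n hn hopt ho =>
    intro t ht a π hm
    obtain ⟨t', ht', -, -, hout⟩ := hexec.delivery (fun t => hrun t k) hm
    obtain ⟨n', hn', ho'⟩ := final hn hopt t' (ht.trans ht')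
    exact ⟨t' + 1, k, fun b => Or.inl ⟨π, hout b _
      (mem_receiveTrace.2 ⟨n', hn', Or.inl ⟨ho'.trans ho, rfl⟩⟩)⟩⟩
  | action k s n hn hopt s₀ x ho htr ih =>
    intro t ht a π hm
    obtain ⟨t', ht', -, -, hout⟩ := hexec.delivery (fun t => hrun t k) hm
    obtain ⟨n', hn', ho'⟩ := final hn hopt t' (ht.trans ht')
    exact ih (t' + 1) (by omega) k (x :: π) (hout k _
      (mem_receiveTrace.2 ⟨n', hn', Or.inr (Or.inl ⟨s₀, x, ho'.trans ho, rfl, rfl⟩)⟩))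
  | message k s n hn hopt j ho htr ih =>
    intro t ht a π hm
    obtain ⟨t', ht', -, -, hout⟩ := hexec.delivery (fun t => hrun t k) hm
    obtain ⟨n', hn', ho'⟩ := final hn hopt t' (ht.trans ht')
    exact ih (t' + 1) (by omega) k π (hout j _
      (mem_receiveTrace.2 ⟨n', hn', Or.inr (Or.inr ⟨j, ho'.trans ho, rfl, rfl⟩)⟩))

/-- An acceptance would start a trace-back at a goal node on an optimal path, and this ends in a
broadcast. -/
theorem accepted_eq_false (hexec : IsLiveExecution Q h σ ev) (hadm : ∀ i, Q.Admissible (h i))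
    (hsol : ∃ π, Q.IsPlan π) (hnb : ∀ t, ¬ (σ t).Broadcast)
    (hrun : ∀ t k, ((σ t).loc k).output = none) (t : ℕ) (k : Φ) :
    ((σ t).loc k).accepted = false := by
  refine hexec.stable (p := fun c => (c.loc k).accepted = false) (t₀ := 0) ?_ ?_ t (Nat.zero_le t)
  · rw [hexec.start]
    rfl
  · intro t _ e _ hst hacc
    obtain ⟨i, L, out, ht⟩ := hst.transition
    by_contra hne
    rw [Bool.not_eq_false] at hne
    rcases ht.accepted_cases hne with h1 | ⟨s, hs⟩
    · rw [hacc] at h1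
      simp at h1
    · have hsound := hexec.sound hadm hsol (t + 1)
      obtain ⟨h1, n, hn, hle⟩ := hsound.trace _ _ _ _ hs
      obtain ⟨t', hb⟩ := hexec.broadcast_of_trace hadm hsol hrun
        (hsound.inv.traceable k s n hn ⟨[], h1, hle⟩) (t + 1) le_rfl k [] hs
      exact hnb t' hb

end NoBroadcast

end IsLiveExecution

/-! ### Some verification returns true -/

/-- From the time `T` on, the search has come to rest, except for the (re-)opening and closing of
goal states. -/
def Settled (Q : Problem P Φ A) (σ : ℕ → Config P Φ A) (T : ℕ) : Prop :=
  ∀ k s, ∀ t ≥ T, ∀ t' ≥ T,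
    (¬ Q.goal ⊆ s → ((σ t').loc k).node s = ((σ t).loc k).node s) ∧
    ∀ n, ((σ t).loc k).node s = some n →
      ∃ b, ((σ t').loc k).node s = some { n with isOpen := b }

theorem Problem.hStar_init_le_f {Q : Problem P Φ A} {s : Finset P} {n : Node P Φ A}
    (hgoal : Q.goal ⊆ s) (hn : Q.hStar Q.init ≤ n.g + Q.hStar s) : Q.hStar Q.init ≤ n.f := by
  rw [Q.hStar_eq_zero hgoal, add_zero] at hn
  exact hn.trans le_self_add

namespace IsLiveExecution

variable {Q : Problem P Φ A} {h : Φ → Finset P → ℝ≥0∞} {σ : ℕ → Config P Φ A}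
  {ev : ℕ → Option (Event Φ)}

open Filter

/-- The `g`-value of each node attains its minimum over time; from then on only the open flag can
change. A non-goal node that keeps its `g`-value cannot be reopened, so its flag becomes constant
too. -/
theorem exists_settled [Finite P] [Finite A] [Nonempty Φ] (hexec : IsLiveExecution Q h σ ev)
    (hadm : ∀ i, Q.Admissible (h i)) (hsol : ∃ π, Q.IsPlan π) : ∃ T, Settled Q σ T := by
  have key : ∀ k s, ∀ᶠ T in atTop, ∀ t ≥ T, ∀ t' ≥ T,
      (¬ Q.goal ⊆ s → ((σ t').loc k).node s = ((σ t).loc k).node s) ∧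
      ∀ n, ((σ t).loc k).node s = some n →
        ∃ b, ((σ t').loc k).node s = some { n with isOpen := b } := by
    intro k s
    by_cases hex : ∃ t n, ((σ t).loc k).node s = some n
    swap
    · push Not at hex
      have hnone : ∀ t, ((σ t).loc k).node s = none := fun t =>
        Option.eq_none_iff_forall_ne_some.2 (hex t)
      exact Eventually.of_forall fun T t _ t' _ => by simp [hnone]
    let S : Set ℝ≥0 := {g | ∃ t n, ((σ t).loc k).node s = some n ∧ n.g = g}
    have hS : S.IsWF := Q.costSet_isWF.mono (by
      rintro _ ⟨t, n, hn, rfl⟩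
      exact (hexec.sound hadm hsol t).inv.values.mem k s n hn)
    have hne : S.Nonempty := by
      obtain ⟨t, n, hn⟩ := hex
      exact ⟨_, t, n, hn, rfl⟩
    obtain ⟨t₁, n₁, hn₁, hg₁⟩ := hS.min_mem hne
    have hfix : ∀ t ≥ t₁, ∀ n, ((σ t).loc k).node s = some n → ∀ t' ≥ t, ∃ b,
        ((σ t').loc k).node s = some { n with isOpen := b } ∧
          (¬ Q.goal ⊆ s → b = true → n.isOpen = true) := by
      intro t ht n hn t' ht'
      have hle : n.g ≤ n₁.g := by
        obtain ⟨n', hn', hev⟩ := hexec.evolves hadm hsol ht hn₁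
        obtain rfl : n' = n := Option.some.inj (hn'.symm.trans hn)
        exact hev.g_le
      obtain ⟨n', hn', hev⟩ := hexec.evolves hadm hsol ht' hn
      rcases hev with hlt | ⟨h1, h2, h3, h4⟩
      · have := hS.min_le hne ⟨t', n', hn', rfl⟩
        rw [← hg₁] at this
        exact absurd (hlt.trans_le hle) (not_lt.2 this)
      · refine ⟨n'.isOpen, ?_, h4⟩
        rw [hn', ← h1, ← h2, ← h3]
    by_cases hgoal : Q.goal ⊆ s
    · refine eventually_atTop.2 ⟨t₁, fun T hT t ht t' ht' => ⟨fun h => absurd hgoal h, ?_⟩⟩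
      intro n hn
      obtain ⟨b, hb, -⟩ := hfix t₁ le_rfl n₁ hn₁ t (hT.trans ht)
      obtain ⟨b', hb', -⟩ := hfix t₁ le_rfl n₁ hn₁ t' (hT.trans ht')
      obtain rfl := Option.some.inj (hb.symm.trans hn)
      exact ⟨b', hb'⟩
    -- Either the node is closed at some time and stays closed, or it stays open forever.
    · have hconst : ∃ T ≥ t₁, ∃ n, ∀ t ≥ T, ((σ t).loc k).node s = some n := by
        by_cases hclosed : ∃ t₂ ≥ t₁, ((σ t₂).loc k).node s = some { n₁ with isOpen := false }
        · obtain ⟨t₂, ht₂, hn₂⟩ := hclosed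
          refine ⟨t₂, ht₂, { n₁ with isOpen := false }, fun t ht => ?_⟩
          obtain ⟨b, hb, hb'⟩ := hfix t₂ ht₂ _ hn₂ t ht
          have : b = false := by
            by_contra hne
            simpa using hb' hgoal (by simpa using hne)
          rw [hb, this]
        · push Not at hclosed
          refine ⟨t₁, le_rfl, { n₁ with isOpen := true }, fun t ht => ?_⟩
          obtain ⟨b, hb, -⟩ := hfix t₁ le_rfl n₁ hn₁ t ht
          cases b with
          | true => exact hb
          | false => exact absurd hb (hclosed t ht)
      obtain ⟨T₀, -, n, hT₀⟩ := hconst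
      refine eventually_atTop.2 ⟨T₀, fun T hT t ht t' ht' => ?_⟩
      rw [hT₀ t (hT.trans ht), hT₀ t' (hT.trans ht')]
      refine ⟨fun _ => rfl, fun m hm => ⟨m.isOpen, ?_⟩⟩
      rw [Option.some.inj hm]
  have hall : ∀ᶠ T in atTop, ∀ k s, ∀ t ≥ T, ∀ t' ≥ T,
      (¬ Q.goal ⊆ s → ((σ t').loc k).node s = ((σ t).loc k).node s) ∧
      ∀ n, ((σ t).loc k).node s = some n →
        ∃ b, ((σ t').loc k).node s = some { n with isOpen := b } :=
    eventually_all.2 fun k => eventually_all.2 fun s => key k s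
  exact hall.exists

/-- Expanding a non-goal state would close an open non-goal node, a change that is no longer
possible. -/
theorem expand_goal (hexec : IsLiveExecution Q h σ ev) {T : ℕ} (hT : Settled Q σ T) {t : ℕ}
    (ht : T ≤ t) {k : Φ} (he : ev t = some (.expand k)) :
    ∃ s n, ((σ t).loc k).IsMin s n ∧ Q.goal ⊆ s ∧
      (σ (t + 1)).loc k = expandGoalState k s n ((σ t).loc k) := by
  have hst := hexec.step t _ he
  have hset := hT k
  generalize hc' : σ (t + 1) = c' at hst
  cases hst with
  | expandGoal _ _ s n hrun hacc hmin hgoal =>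
    exact ⟨s, n, hmin, hgoal, Config.act_loc_self ..⟩
  | expandNonGoal _ _ s n acts hrun hacc hmin hgoal hnodup hacts =>
    have h1 := (hset s t ht (t + 1) (by omega)).1 hgoal
    rw [hc', Config.act_loc_self, expandState_closes hmin.1, hmin.1] at h1
    have h2 := hmin.2.1
    rw [← Option.some.inj h1] at h2
    simp at h2

/-- Finally, only goal states are in transit. -/
theorem exists_only_goals (hexec : IsLiveExecution Q h σ ev)
    (hrun : ∀ t k, ((σ t).loc k).output = none) {T : ℕ} (hT : Settled Q σ T) :
    ∃ T' ≥ T, ∀ t ≥ T', ∀ j k s g x, .search s g x ∈ (σ t).chan j k → Q.goal ⊆ s := by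
  have key : ∀ j k, ∃ T', ∀ t ≥ T', ∀ s g x, .search s g x ∈ (σ t).chan j k → Q.goal ⊆ s := by
    intro j k
    have hextra : ∀ t ≥ T, ∀ e, Step Q h e (σ t) (σ (t + 1)) → ∃ extra,
        (∀ s g x, .search s g x ∈ extra → Q.goal ⊆ s) ∧
        (e = .receive k j → (σ (t + 1)).chan j k = ((σ t).chan j k).tail ++ extra) ∧
        (e ≠ .receive k j → (σ (t + 1)).chan j k = (σ t).chan j k ++ extra) := by
      intro t ht e hst
      obtain ⟨extra, hx, hx'⟩ := hst.chan_eq j k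
      refine ⟨extra, fun s g x hm => ?_, fun he => by rw [hx, if_pos he],
        fun he => by rw [hx, if_neg he]⟩
      by_contra hgoal
      obtain ⟨n, h1, h2, h3⟩ := (hx' s g x hm).resolve_left hgoal
      have h4 := (hT j s t ht (t + 1) (by omega)).1 hgoal
      rw [h1, h3] at h4
      rw [← Option.some.inj h4] at h2
      simp at h2
    -- Non-goal states sit only among the first `n` messages of the channel, and newly sent states
    -- are goals. Each reception, or a moment at which the channel is empty, lowers `n`; it starts
    -- as the length of the channel.
    have main : ∀ n : ℕ, ∀ t ≥ T,
        (∀ s g x, .search s g x ∈ ((σ t).chan j k).drop n → Q.goal ⊆ s) →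
        ∃ T', ∀ t ≥ T', ∀ s g x, .search s g x ∈ (σ t).chan j k → Q.goal ⊆ s := by
      have keep : ∀ n : ℕ, ∀ t ≥ T,
          (∀ s g x, .search s g x ∈ ((σ t).chan j k).drop n → Q.goal ⊆ s) → ∀ t' ≥ t,
          ∀ s g x, .search s g x ∈ ((σ t').chan j k).drop n → Q.goal ⊆ s := by
        intro n t ht hn
        refine hexec.stable (p := fun c => ∀ s g x, .search s g x ∈ (c.chan j k).drop n →
          Q.goal ⊆ s) hn fun t' ht' e he hst ih s g x hm => ?_
        obtain ⟨extra, h1, h2, h3⟩ := hextra t' (ht.trans ht') e hst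
        by_cases hrec : e = .receive k j
        · rw [h2 hrec, List.drop_append, List.mem_append] at hm
          rcases hm with hm | hm
          · rw [List.drop_tail] at hm
            refine ih s g x ?_
            rw [← List.drop_drop (i := 1)] at hm
            exact List.mem_of_mem_drop (by simpa [Nat.add_comm] using hm)
          · exact h1 s g x (List.mem_of_mem_drop hm)
        · rw [h3 hrec, List.drop_append, List.mem_append] at hm
          rcases hm with hm | hm
          · exact ih s g x hm
          · exact h1 s g x (List.mem_of_mem_drop hm)
      intro n
      induction n with
      | zero =>
        intro t ht hn
        exact ⟨t, fun t' ht' => by simpa using keep 0 t ht hn t' ht'⟩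
      | succ n ih =>
        intro t ht hn
        by_cases hempty : ∃ t' ≥ t, (σ t').chan j k = []
        · obtain ⟨t', ht', hnil⟩ := hempty
          exact ih t' (ht.trans ht') (by simp [hnil])
        · push Not at hempty
          obtain ⟨t', ht', he⟩ := hexec.live (.receive k j) t fun t' ht' => by
            obtain ⟨m, rest, hc⟩ := List.exists_cons_of_ne_nil (hempty t' ht')
            exact ⟨_, .receive (σ t') k j m rest (hrun t' k) hc⟩
          obtain ⟨extra, h1, h2, -⟩ := hextra t' (ht.trans ht') _ (hexec.step t' _ he)
          refine ih (t' + 1) (by omega) fun s g x hm => ?_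
          rw [h2 rfl, List.drop_append, List.mem_append] at hm
          rcases hm with hm | hm
          · rw [List.drop_tail] at hm
            exact keep (n + 1) t ht hn t' ht' s g x hm
          · exact h1 s g x (List.mem_of_mem_drop hm)
    exact main ((σ T).chan j k).length T le_rfl (by simp)
  choose T' hT' using key
  refine ⟨max T (Finset.univ.sup fun j => Finset.univ.sup (T' j)), le_max_left _ _,
    fun t ht j k => hT' j k t (le_trans ?_ ht)⟩
  exact ((Finset.le_sup (f := T' j) (Finset.mem_univ k)).trans
    (Finset.le_sup (f := fun j => Finset.univ.sup (T' j)) (Finset.mem_univ j))).trans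
    (le_max_right _ _)

section Settled

variable [Finite P] [Fintype A] [Nonempty Φ]

/-- As long as an agent has an open state, it expands goal states that are at least as good. -/
theorem exists_expand_goal (hexec : IsLiveExecution Q h σ ev)
    (hrun : ∀ t k, ((σ t).loc k).output = none) (hacc : ∀ t k, ((σ t).loc k).accepted = false)
    {T : ℕ} (hT : Settled Q σ T) {t : ℕ} (ht : T ≤ t) {k : Φ} {s : Finset P} {n : Node P Φ A}
    (hn : ((σ t).loc k).node s = some n) (ho : n.isOpen = true) :
    ∃ t' ≥ t, ∃ s' n', ((σ t').loc k).IsMin s' n' ∧ Q.goal ⊆ s' ∧ n'.f ≤ n.f ∧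
      (σ (t' + 1)).loc k = expandGoalState k s' n' ((σ t').loc k) := by
  by_contra hcon
  -- An expansion while `s` is open picks a state with an `f`-value no larger than that of `s`,
  -- which has not changed since `t`; this is what is sought.
  have hbest : ∀ t' ≥ t, ev t' = some (.expand k) → ∀ n', ((σ t').loc k).node s = some n' →
      n'.isOpen = true → False := by
    intro t' ht' he n' hn' ho'
    obtain ⟨s₁, n₁, hmin, hgoal, hloc⟩ := hexec.expand_goal hT (ht.trans ht') he
    obtain ⟨b, hb⟩ := (hT k s t ht t' (ht.trans ht')).2 n hn
    refine hcon ⟨t', ht', s₁, n₁, hmin, hgoal, (hmin.2.2 s n' hn' ho').trans (le_of_eq ?_), hloc⟩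
    rw [← Option.some.inj (hb.symm.trans hn')]
    rfl
  -- Only an expansion by `k` could close `s`. Without one, `s` stays open and the expansion remains
  -- possible forever.
  have hopen : ∀ t' ≥ t, ∃ n', ((σ t').loc k).node s = some n' ∧ n'.isOpen = true := by
    refine hexec.stable (p := fun c => ∃ n', (c.loc k).node s = some n' ∧ n'.isOpen = true)
      ⟨n, hn, ho⟩ fun t' ht' e he hst ⟨n', hn', ho'⟩ => ?_
    have hne : e ≠ .expand k := by
      rintro rfl
      exact hbest t' ht' he n' hn' ho'
    generalize σ (t' + 1) = c' at hst
    cases hst with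
    | expandGoal _ i s₁ n₁ =>
      have hki : k ≠ i := fun h => hne (by rw [h])
      exact ⟨n', by rwa [Config.act_loc_ne _ hki], ho'⟩
    | expandNonGoal _ i s₁ n₁ acts =>
      have hki : k ≠ i := fun h => hne (by rw [h])
      exact ⟨n', by rwa [Config.act_loc_ne _ hki], ho'⟩
    | receive _ i j m rest =>
      by_cases hki : k = i
      · subst hki
        rw [Config.act_loc_self]
        exact receive_open hn' ho'
      · exact ⟨n', by rwa [Config.act_loc_ne _ hki], ho'⟩
  obtain ⟨t', ht', he⟩ := hexec.live (.expand k) t fun t' ht' => by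
    obtain ⟨n', hn', ho'⟩ := hopen t' ht'
    exact expand_enabled (hrun t' k) (hacc t' k) hn' ho'
  obtain ⟨n', hn', ho'⟩ := hopen t' ht'
  exact hbest t' ht' he n' hn' ho'

/-- Finally, no open state has an `f`-value below the cost of an optimal solution. -/
theorem hStar_le_of_open (hexec : IsLiveExecution Q h σ ev) (hadm : ∀ i, Q.Admissible (h i))
    (hsol : ∃ π, Q.IsPlan π) (hrun : ∀ t k, ((σ t).loc k).output = none)
    (hacc : ∀ t k, ((σ t).loc k).accepted = false) {T : ℕ} (hT : Settled Q σ T) {t : ℕ}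
    (ht : T ≤ t) {k : Φ} {s : Finset P} {n : Node P Φ A} (hn : ((σ t).loc k).node s = some n)
    (ho : n.isOpen = true) : Q.hStar Q.init ≤ n.f := by
  obtain ⟨t', -, s', n', hmin, hgoal, hle, -⟩ :=
    hexec.exists_expand_goal hrun hacc hT ht hn ho
  exact le_trans (Problem.hStar_init_le_f hgoal
    ((hexec.sound hadm hsol t').inv.values.lower k s' n' hmin.1)) hle

/-- The frontier at time `T` is an open node, or a state in transit which must be a goal and is
opened on arrival. Either way an open node of value at most `h*(I)` leads to the required expansion.
-/
theorem exists_expand_optimal (hexec : IsLiveExecution Q h σ ev)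
    (hadm : ∀ i, Q.Admissible (h i)) (hsol : ∃ π, Q.IsPlan π)
    (hrun : ∀ t k, ((σ t).loc k).output = none) (hacc : ∀ t k, ((σ t).loc k).accepted = false)
    {T : ℕ} (hT : Settled Q σ T)
    (hgoals : ∀ t ≥ T, ∀ j k s g x, .search s g x ∈ (σ t).chan j k → Q.goal ⊆ s) :
    ∃ t ≥ T, ∃ k s n, ((σ t).loc k).IsMin s n ∧ Q.goal ⊆ s ∧ n.f ≤ Q.hStar Q.init ∧
      (σ (t + 1)).loc k = expandGoalState k s n ((σ t).loc k) := by
  have hopen : ∀ t ≥ T, ∀ k s n, ((σ t).loc k).node s = some n → n.isOpen = true →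
      n.f ≤ Q.hStar Q.init →
      ∃ t ≥ T, ∃ k s n, ((σ t).loc k).IsMin s n ∧ Q.goal ⊆ s ∧ n.f ≤ Q.hStar Q.init ∧
      (σ (t + 1)).loc k = expandGoalState k s n ((σ t).loc k) := by
    intro t ht k s n hn ho hle
    obtain ⟨t', ht', s', n', h1, h2, h3, h4⟩ :=
      hexec.exists_expand_goal hrun hacc hT ht hn ho
    exact ⟨t', ht.trans ht', k, s', n', h1, h2, h3.trans hle, h4⟩
  rcases (hexec.sound hadm hsol T).inv.hasFrontier hsol with
    ⟨k, s, n, hn, ho, hle⟩ | ⟨j, k, s, g, x, hm, hle⟩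
  · exact hopen T le_rfl k s n hn ho hle
  · have hm' : .search s g x ∈ (σ T).chan j k := by
      simp only [Config.toSearch, searches, List.mem_filterMap] at hm
      obtain ⟨m, hm, heq⟩ := hm
      cases m with
      | search s' g' x' =>
        simp only [Option.some.injEq, Prod.mk.injEq] at heq
        obtain ⟨rfl, rfl, rfl⟩ := heq
        exact hm
      | _ => simp at heq
    have hgoal := hgoals T le_rfl j k s g x hm'
    obtain ⟨t', ht', -, hloc, -⟩ := hexec.delivery (fun t => hrun t k) hm'
    obtain ⟨n', hn', ho', hg'⟩ := processSearch_goal (hi := h k) (j := j) (g := g) (x := x)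
      (L := ((σ t').loc k).recordArrival j ((g : ℝ≥0∞) + x)) hgoal
    have hn'' : ((σ (t' + 1)).loc k).node s = some n' := by rw [hloc]; exact hn'
    refine hopen (t' + 1) (by omega) k s n' hn'' ho' ?_
    have hh := (hexec.sound hadm hsol (t' + 1)).inv.values.adm k s n' hn''
    -- Admissible estimates vanish at goal states, so `f` equals `g` there.
    rw [Q.hStar_eq_zero hgoal, nonpos_iff_eq_zero] at hh
    rw [Node.f, hh, add_zero]
    exact le_trans (by exact_mod_cast hg') (le_self_add.trans hle)

/-- A snapshot that has been started is completed. -/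
theorem snapshot_completes (hexec : IsLiveExecution Q h σ ev) (hadm : ∀ i, Q.Admissible (h i))
    (hsol : ∃ π, Q.IsPlan π) (hrun : ∀ t k, ((σ t).loc k).output = none) {t₀ : ℕ} {k : Φ}
    {id : Φ × ℕ} (hk : ((σ t₀).loc k).snap id ≠ none) :
    ∃ t, ∀ a, ∃ r, ((σ t).loc a).snap id = some r ∧ r.pending = ∅ := by
  have keep : ∀ {t a j}, (∃ r, ((σ t).loc a).snap id = some r ∧ j ∉ r.pending) → ∀ t' ≥ t,
      ∃ r, ((σ t').loc a).snap id = some r ∧ j ∉ r.pending := by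
    intro t a j hr
    refine hexec.stable (p := fun c => ∃ r, (c.loc a).snap id = some r ∧ j ∉ r.pending) hr ?_
    rintro t' - e - hst ⟨r, hr, hj⟩
    obtain ⟨i, L, out, ht⟩ := hst.transition
    obtain ⟨r', hr', hsub, -⟩ := ht.snap_mono (hexec.sound hadm hsol t').fresh hr
    exact ⟨r', hr', fun h => hj (hsub h)⟩
  have done : ∀ {t j}, ((σ t).loc j).snap id ≠ none → ∀ a, ∀ᶠ t in atTop,
      ∃ r, ((σ t).loc a).snap id = some r ∧ j ∉ r.pending := by
    intro t j hj a
    obtain ⟨V, -, hcut⟩ := (hexec.sound hadm hsol t).cut id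
    rcases hcut.marker_of_recorded j a hj with hm | hr
    · obtain ⟨t', -, -, hloc, -⟩ := hexec.delivery (fun t => hrun t a) hm
      refine eventually_atTop.2 ⟨t' + 1, keep ?_⟩
      rw [hloc]
      simp only [MADAStar.receive, receiveMarker, Function.update_self]
      refine ⟨_, rfl, ?_⟩
      split <;> simp
    · exact eventually_atTop.2 ⟨t, keep hr⟩
  have all : ∀ᶠ t in atTop, ∀ a, ∀ j, ∃ r, ((σ t).loc a).snap id = some r ∧ j ∉ r.pending := by
    refine eventually_all.2 fun a => eventually_all.2 fun j => ?_
    -- Two rounds of markers: those of `k` make every agent record its state, and then the markers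
    -- of each agent `j` close its channels.
    obtain ⟨t, r, hr, -⟩ := (done hk j).exists
    exact done (t := t) (by simp [hr]) a
  obtain ⟨t, ht⟩ := all.exists
  refine ⟨t, fun a => ?_⟩
  obtain ⟨r, hr, -⟩ := ht a k
  refine ⟨r, hr, Finset.eq_empty_of_forall_notMem fun j hj => ?_⟩
  obtain ⟨r', hr', hj'⟩ := ht a j
  rw [Option.some.inj (hr'.symm.trans hr)] at hj'
  exact hj' hj

/-- A verification that has been started receives all reports. -/
theorem verification_completes (hexec : IsLiveExecution Q h σ ev)
    (hadm : ∀ i, Q.Admissible (h i)) (hsol : ∃ π, Q.IsPlan π)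
    (hrun : ∀ t k, ((σ t).loc k).output = none) {t₀ : ℕ} {k : Φ} {n : ℕ}
    (hk : ((σ t₀).loc k).snap (k, n) ≠ none) :
    ∃ T, ∀ t ≥ T, ∃ v, ((σ t).loc k).verif n = some v ∧ v.pending = ∅ := by
  obtain ⟨t₁, ht₁⟩ := hexec.snapshot_completes hadm hsol hrun hk
  have keep : ∀ {t a}, (∃ v, ((σ t).loc k).verif n = some v ∧ a ∉ v.pending) → ∀ t' ≥ t,
      ∃ v, ((σ t').loc k).verif n = some v ∧ a ∉ v.pending := by
    intro t a hv
    refine hexec.stable (p := fun c => ∃ v, (c.loc k).verif n = some v ∧ a ∉ v.pending) hv ?_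
    rintro t' - e - hst ⟨v, hv, ha⟩
    obtain ⟨i, L, out, ht⟩ := hst.transition
    obtain ⟨v', hv', hsub⟩ := ht.verif_mono (hexec.sound hadm hsol t').fresh hv
    exact ⟨v', hv', fun h => ha (hsub h)⟩
  have all : ∀ᶠ t in atTop, ∀ a, ∃ v, ((σ t).loc k).verif n = some v ∧ a ∉ v.pending := by
    refine eventually_all.2 fun a => ?_
    obtain ⟨r, hr, hp⟩ := ht₁ a
    rcases (hexec.sound hadm hsol t₁).reported a k n r hr hp with hm | hv
    · obtain ⟨t', -, hm', hloc, -⟩ := hexec.delivery (fun t => hrun t k) hm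
      refine eventually_atTop.2 ⟨t' + 1, keep ?_⟩
      have hsound := hexec.sound hadm hsol t'
      obtain ⟨r', hr', -⟩ := hsound.report _ _ _ _ hm'
      obtain ⟨v, hv⟩ := Option.ne_none_iff_exists'.1
        ((hsound.fresh.verif k n).2 (hsound.fresh.snap a (k, n) (by simp [hr'])))
      rw [hloc]
      refine ⟨{ v with lb := min v.lb r.lb, pending := v.pending.erase a }, ?_, by simp⟩
      rw [MADAStar.receive, (receiveReport_local ..).2.2.2.2, if_pos rfl, hv]
      rfl
    · exact eventually_atTop.2 ⟨t₁, keep hv⟩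
  obtain ⟨T, hT⟩ := eventually_atTop.1 all
  refine ⟨T, fun t ht => ?_⟩
  obtain ⟨v, hv, -⟩ := hT t ht k
  refine ⟨v, hv, Finset.eq_empty_of_forall_notMem fun a ha => ?_⟩
  obtain ⟨v', hv', ha'⟩ := hT t ht a
  rw [Option.some.inj (hv'.symm.trans hv)] at ha'
  exact ha' ha

/-- The terminating message is sent. -/
theorem exists_broadcast (hexec : IsLiveExecution Q h σ ev) (hadm : ∀ i, Q.Admissible (h i))
    (hsol : ∃ π, Q.IsPlan π) : ∃ t, (σ t).Broadcast := by
  by_contra hnb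
  push Not at hnb
  have hrun : ∀ t k, ((σ t).loc k).output = none := by
    intro t k
    by_contra hne
    obtain ⟨π, hπ⟩ := Option.ne_none_iff_exists'.1 hne
    exact hnb t ((hexec.sound hadm hsol t).broadcast_of_output k π hπ)
  have hacc := hexec.accepted_eq_false hadm hsol hnb hrun
  obtain ⟨T₀, hT₀⟩ := hexec.exists_settled hadm hsol
  obtain ⟨T, hTT, hgoals⟩ := hexec.exists_only_goals hrun hT₀
  have hT : Settled Q σ T := fun k s t ht t' ht' => hT₀ k s t (hTT.trans ht) t' (hTT.trans ht')
  obtain ⟨t₀, ht₀, k, s, n, hmin, hgoal, hf, hloc⟩ :=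
    hexec.exists_expand_optimal hadm hsol hrun hacc hT hgoals
  set N := ((σ t₀).loc k).numVerif with hN
  have hopen : ∀ t ≥ T, ∀ {k s n}, ((σ t).loc k).node s = some n → n.isOpen = true →
      Q.hStar Q.init ≤ n.f := fun t ht {k s n} hn ho =>
    hexec.hStar_le_of_open hadm hsol hrun hacc hT ht hn ho
  -- Everything in this snapshot is recorded from `t₀` on: arriving states are goals, whose cost is
  -- at least `h*(I)`, and open nodes satisfy `hopen`.
  have hsnap : ∀ t ≥ t₀, ∀ a r, ((σ t).loc a).snap (k, N) = some r → Q.hStar Q.init ≤ r.lb := by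
    refine hexec.stable (p := fun c => ∀ a r, (c.loc a).snap (k, N) = some r →
      Q.hStar Q.init ≤ r.lb) ?_ ?_
    · intro a r hr
      have := ((hexec.sound hadm hsol t₀).fresh.unused (i := k) (n := N) le_rfl).1 a
      simp [this] at hr
    · intro t ht e he hst ih a r hr
      obtain ⟨i, L, out, htr⟩ := hst.transition
      rcases htr.snap_cases hr with h1 | ⟨r₀, j, s', g, x, h1, h2, h3, rfl⟩ |
        ⟨j, h1, h2 | ⟨r₀, h2, rfl⟩, h3⟩ | ⟨h1, s', n', h2, h3, -, rfl⟩
      · exact ih a r h1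
      · refine le_min (ih a r₀ h1) ?_
        have hg := hgoals t (ht₀.trans ht) _ _ _ _ _ h2
        have hlow := (hexec.sound hadm hsol t).inv.values.msg_lower j a s' g x (by
          simp only [Config.toSearch, searches, List.mem_filterMap]
          exact ⟨_, h2, rfl⟩)
        rw [Q.hStar_eq_zero hg, add_zero] at hlow
        exact hlow.trans le_self_add
      · rw [h2.2]
        exact LocalState.le_lowerBound fun s' n' hn' ho' => hopen t (ht₀.trans ht) hn' ho'
      · exact ih a r₀ h2
      -- The initiator records after closing `s'`, so only its other open nodes count.
      · refine LocalState.le_lowerBound fun s₁ n₁ hn₁ ho₁ => ?_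
        by_cases hs : s₁ = s'
        · subst hs
          simp only [LocalState.setNode, Function.update_self, Option.some.injEq] at hn₁
          rw [← hn₁] at ho₁
          simp at ho₁
        · refine hopen t (ht₀.trans ht) (k := a) (s := s₁) ?_ ho₁
          simpa [LocalState.setNode, hs] using hn₁
  have hsnap₀ : ((σ (t₀ + 1)).loc k).snap (k, N) ≠ none := by
    rw [hloc]
    simp [expandGoalState, hN]
  -- The bound of the verification starts at `⊤` and is lowered only by reports, all of which are at
  -- least `h*(I)`.
  have hverif : ∀ t ≥ t₀ + 1, ∃ v, ((σ t).loc k).verif N = some v ∧ v.f ≤ Q.hStar Q.init ∧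
      Q.hStar Q.init ≤ v.lb := by
    refine hexec.stable (p := fun c => ∃ v, (c.loc k).verif N = some v ∧
      v.f ≤ Q.hStar Q.init ∧ Q.hStar Q.init ≤ v.lb) ?_ ?_
    · rw [hloc]
      exact ⟨⟨s, n.f, ⊤, Finset.univ⟩, by simp [expandGoalState, hN], hf, le_top⟩
    · rintro t ht e he hst ⟨v, hv, hvf, hvlb⟩
      obtain ⟨i, L, out, htr⟩ := hst.transition
      have hsound := hexec.sound hadm hsol t
      obtain ⟨v', hv', -⟩ := htr.verif_mono hsound.fresh hv
      refine ⟨v', hv', ?_⟩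
      rcases htr.verif_cases hv' with h1 | ⟨h1, -⟩ | ⟨j, lb, v₀, h1, h2, rfl, -⟩
      · obtain rfl := Option.some.inj (hv.symm.trans h1)
        exact ⟨hvf, hvlb⟩
      · have := (hsound.fresh.verif k N).1 (by simp [hv])
        omega
      · obtain rfl := Option.some.inj (hv.symm.trans h2)
        obtain ⟨r, hr, -, hlb⟩ := hsound.report _ _ _ _ h1
        exact ⟨hvf, le_min hvlb (hlb ▸ hsnap t (by omega) j r hr)⟩
  obtain ⟨T₁, hT₁⟩ := hexec.verification_completes hadm hsol hrun hsnap₀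
  obtain ⟨v, hv, hvf, hvlb⟩ := hverif (max T₁ (t₀ + 1)) (le_max_right _ _)
  obtain ⟨v', hv', hp⟩ := hT₁ (max T₁ (t₀ + 1)) (le_max_left _ _)
  obtain rfl := Option.some.inj (hv.symm.trans hv')
  have := (hexec.sound hadm hsol (max T₁ (t₀ + 1))).decided k N v hv hp (hvf.trans hvlb)
  rw [hacc] at this
  simp at this

end Settled

end IsLiveExecution

end MADAStar

theorem theorem1 {P Φ A : Type*} [Fintype P] [DecidableEq P] [Fintype Φ] [DecidableEq Φ]
    [Nonempty Φ] [Fintype A] (Q : MADAStar.Problem P Φ A)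
    (h : Φ → Finset P → ENNReal) (hadm : ∀ i, Q.Admissible (h i))
    (hsol : ∃ π, Q.IsPlan π)
    (σ : ℕ → MADAStar.Config P Φ A) (ev : ℕ → Option (MADAStar.Event Φ))
    (hexec : MADAStar.IsLiveExecution Q h σ ev) :
    ∃ T : ℕ, ∀ t ≥ T, ∀ i, ∃ π, ((σ t).loc i).output = some π ∧ Q.IsOptimalPlan π := by
  obtain ⟨t₀, hb⟩ := hexec.exists_broadcast hadm hsol
  obtain ⟨T, hT⟩ := hexec.halts_of_broadcast hb
  refine ⟨T, fun t ht i => ?_⟩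
  obtain ⟨π, hπ⟩ := hT t ht i
  exact ⟨π, hπ, (hexec.sound hadm hsol t).output i π hπ⟩
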